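/- **Setting.** Let $\mathcal V$ be a closed symmetric monoidal Grothendieck category, with tensor product $\otimes$, internal Hom $[-,-]$ and unit $e$, having a (small) family of dualizable generators $\{g_i\}_{i\in I}$, and suppose that $e$ is finitely presented. Let $\mathcal A$ be an enriched ringoid, i.e. a skeletally small $\mathcal V$-category. For a $\mathcal V$-category $\mathcal B$, write $[\mathcal B,\mathcal V]$ for the category of $\mathcal V$-functors $\mathcal B\to\mathcal V$ and $\mathcal V$-natural transformations; it is itself a $\mathcal V$-category when $\mathcal B$ is skeletally small, with Hom-objects $[F,G]=\int_b[F(b),G(b)]$. Put $\mathcal A\,\mathrm{Mod}=[\mathcal A,\mathcal V]$ and $\mathrm{Mod}\,\mathcal A=[\mathcal A^{\mathrm{op}},\mathcal V]$, let $\mathrm{mod}\,\mathcal A$ be the full $\mathcal V$-subcategory of $\mathrm{Mod}\,\mathcal A$ of the finitely presented objects (those $M$ for which $\mathrm{Hom}(M,-)$ preserves filtered colimits), and put ${}_{\mathcal A}\mathcal C=[\mathrm{mod}\,\mathcal A,\mathcal V]$. We identify $a\in\mathcal A$ with the representable module $\mathcal A(-,a)\in\mathrm{mod}\,\mathcal A$;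 this is a $\mathcal V$-functor $\mathcal A\to\mathrm{mod}\,\mathcal A$. For $M\in\mathrm{Mod}\,\mathcal A$ and $N\in\mathcal A\,\mathrm{Mod}$ let $M\otimes_{\mathcal A}N=\int^{a\in\mathcal A}M(a)\otimes N(a)\in\mathcal V$. For $Y\in{}_{\mathcal A}\mathcal C$ and $W\in\mathcal V$ let $Y\oslash W$ be the $\mathcal V$-functor $M\mapsto Y(M)\otimes W$. **Theorem.** The categories $\mathcal A\,\mathrm{Mod}$ and ${}_{\mathcal A}\mathcal C$ are Grothendieck categories. The full subcategory $$\mathcal S_{\mathcal A}=\{Y\in{}_{\mathcal A}\mathcal C\mid Y(a)=0\text{ for all }a\in\mathcal A\}$$ is an enriched localizing subcategory of ${}_{\mathcal A}\mathcal C$: it is a Serre subcategory, it is closed under direct limits, and $Y\oslash W\in\mathcal S_{\mathcal A}$ for all $Y\in\mathcal S_{\mathcal A}$ and $W\in\mathcal V$. Let $i:\mathcal S_{\mathcal A}\to{}_{\mathcal A}\mathcal C$ be the inclusion and let $r:{}_{\mathcal A}\mathcal C\to\mathcal A\,\mathrm{Mod}$ be the restriction along $\mathcal A\to\mathrm{mod}\,\mathcal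 A$. There is a recollement $$\mathcal S_{\mathcal A}\xrightarrow{\;i\;}{}_{\mathcal A}\mathcal C\xrightarrow{\;r\;}\mathcal A\,\mathrm{Mod}$$ with adjunctions $i_L\dashv i\dashv i_R$ and $r_L\dashv r\dashv r_R$. That is, $i$, $r_L$, $r_R$ are fully faithful and the essential image of $i$ is the kernel $\{Y\mid r(Y)=0\}$ of $r$. Here 1. $r_L$ is the functor $N\mapsto-\otimes_{\mathcal A}N$; 2. $r_R$ is the enriched right Kan extension along $\mathcal A\to\mathrm{mod}\,\mathcal A$: for every $N\in\mathcal A\,\mathrm{Mod}$, the counit $r\,r_R(N)\to N$ exhibits $r_R(N)(M)$ as the end $\int_{a\in\mathcal A}\big[[M,\mathcal A(-,a)],\,N(a)\big]$ for every $M\in\mathrm{mod}\,\mathcal A$; 3. $i_R$ is the torsion functor of $\mathcal S_{\mathcal A}$: for each $X\in{}_{\mathcal A}\mathcal C$, the counit $i\,i_R(X)\to X$ is the greatest subobject of $X$ belonging to $\mathcal S_{\mathcal A}$. Let $t=i\circ i_R$, with first right derived functor $t^1$, and let ${}_{\mathcal A}\mathcal C/\mathcal S_{\mathcal A}$ be the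 full subcategory of ${}_{\mathcal A}\mathcal C$ of the $\mathcal S_{\mathcal A}$-closed objects, i.e. the objects $X$ with $t(X)=t^1(X)=0$. Then the inclusion ${}_{\mathcal A}\mathcal C/\mathcal S_{\mathcal A}\to{}_{\mathcal A}\mathcal C$ has a left adjoint $(-)_{\mathcal S_{\mathcal A}}$, and the functor $$\mathcal A\,\mathrm{Mod}\to{}_{\mathcal A}\mathcal C/\mathcal S_{\mathcal A},\qquad N\mapsto(-\otimes_{\mathcal A}N)_{\mathcal S_{\mathcal A}},$$ is an equivalence of categories. -/

import Mathlib

open CategoryTheory MonoidalCategory Limits MonoidalClosed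

universe v u w w'

set_option linter.unusedSectionVars false

namespace EnrichedRingoid

noncomputable section

section VFun

lemma uncurry_tensorHom_comp {V : Type u} [Category.{v} V] [MonoidalCategory V]
    [MonoidalClosed V] {x y z P Q : V}
    (f : P ⟶ (ihom x).obj y) (g : Q ⟶ (ihom y).obj z) :
    uncurry ((f ⊗ₘ g) ≫ MonoidalClosed.comp x y z) =
      (α_ _ _ _).inv ≫ uncurry f ▷ _ ≫ uncurry g := by
  rw [uncurry_natural_left, comp_eq, uncurry_curry, compTranspose_eq, uncurry_eq, uncurry_eq,
    MonoidalCategory.tensorHom_def]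
  simp only [MonoidalCategory.whiskerLeft_comp, comp_whiskerRight, Category.assoc]
  rw [associator_inv_naturality_right_assoc, associator_inv_naturality_middle_assoc,
    whisker_exchange_assoc]
  rfl


variable (V : Type u) [Category.{v} V] [MonoidalCategory V] [MonoidalClosed V]

/-- A `V`-functor from a `V`-category `C` to the self-enriched category `V`.  This is a wrapper
around `EnrichedFunctor V C V`; it carries the category structure given by `V`-natural
transformations. -/
structure VFun (C : Type w) [EnrichedCategory V C] where
  /-- the underlying enriched functor -/
  toFunctor : EnrichedFunctor V C V

variable {V} {C : Type w} [EnrichedCategory V C]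

namespace VFun

/-- The value of a `V`-functor at an object. -/
abbrev obj (F : VFun V C) (c : C) : V := F.toFunctor.obj c

/-- The structure morphism `F(a) ⊗ C(a,b) ⟶ F(b)` adjoint to `C(a,b) ⟶ [F(a), F(b)]`. -/
def act (F : VFun V C) (a b : C) : F.obj a ⊗ (a ⟶[V] b) ⟶ F.obj b :=
  uncurry (F.toFunctor.map a b)

lemma act_id (F : VFun V C) (a : C) :
    F.obj a ◁ eId V a ≫ F.act a a = (ρ_ (F.obj a)).hom := by
  rw [act, ← uncurry_natural_left, F.toFunctor.map_id, enrichedCategorySelf_id]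
  exact uncurry_curry _

lemma act_comp (F : VFun V C) (a b c : C) :
    F.obj a ◁ eComp V a b c ≫ F.act a c =
      (α_ _ _ _).inv ≫ F.act a b ▷ _ ≫ F.act b c := by
  rw [act, ← uncurry_natural_left, F.toFunctor.map_comp, enrichedCategorySelf_comp]
  exact uncurry_tensorHom_comp _ _

/-- A `V`-functor `C ⟶ V` from a family of objects with unital and associative structure
morphisms `F(a) ⊗ C(a,b) ⟶ F(b)`. -/
def ofAct (X : C → V) (act : ∀ a b, X a ⊗ (a ⟶[V] b) ⟶ X b)
    (act_id : ∀ a, X a ◁ eId V a ≫ act a a = (ρ_ (X a)).hom)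
    (act_comp : ∀ a b c, X a ◁ eComp V a b c ≫ act a c =
      (α_ _ _ _).inv ≫ act a b ▷ _ ≫ act b c) : VFun V C where
  toFunctor :=
    { obj := X
      map := fun a b => curry (act a b)
      map_id := fun a => by
        rw [← curry_natural_left, act_id]
        rfl
      map_comp := fun a b c => by
        rw [← curry_natural_left, act_comp, enrichedCategorySelf_comp]
        apply uncurry_injective
        rw [uncurry_curry]
        exact ((uncurry_tensorHom_comp _ _).trans (by rw [uncurry_curry, uncurry_curry])).symm }

@[simp]
lemma ofAct_obj (X : C → V) (act : ∀ a b, X a ⊗ (a ⟶[V] b) ⟶ X b) (h₁ h₂) (a : C) :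
    (ofAct X act h₁ h₂).obj a = X a := rfl

@[simp]
lemma ofAct_act (X : C → V) (act : ∀ a b, X a ⊗ (a ⟶[V] b) ⟶ X b) (h₁ h₂) (a b : C) :
    (ofAct X act h₁ h₂).act a b = act a b := uncurry_curry _

/-- A `V`-natural transformation between `V`-functors `C ⟶ V`. -/
@[ext]
structure Hom (F G : VFun V C) where
  /-- the components -/
  app : ∀ c, F.obj c ⟶ G.obj c
  /-- `V`-naturality -/
  naturality : ∀ a b, F.act a b ≫ app b = app a ▷ _ ≫ G.act a b

instance : Category (VFun V C) where
  Hom := Hom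
  id F := { app := fun c => 𝟙 _, naturality := by simp }
  comp f g :=
    { app := fun c => f.app c ≫ g.app c
      naturality := fun a b => by
        rw [← Category.assoc, f.naturality, Category.assoc, g.naturality]; simp }

@[ext]
lemma hom_ext {F G : VFun V C} {f g : F ⟶ G} (h : ∀ c, f.app c = g.app c) : f = g :=
  Hom.ext (funext h)

@[simp] lemma id_app (F : VFun V C) (c : C) : Hom.app (𝟙 F) c = 𝟙 _ := rfl

@[simp] lemma comp_app {F G H : VFun V C} (f : F ⟶ G) (g : G ⟶ H) (c : C) :
    (f ≫ g).app c = f.app c ≫ g.app c := rfl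

lemma Hom.nat {F G : VFun V C} (f : F ⟶ G) (a b : C) :
    F.act a b ≫ f.app b = f.app a ▷ _ ≫ G.act a b := f.naturality a b

end VFun

end VFun

section Induced

variable (V : Type u) [Category.{v} V] [MonoidalCategory V] {C : Type w} [EnrichedCategory V C]

/-- The index type of a family `s : S → C` of objects of a `V`-category, regarded as a
`V`-category whose hom-objects are those of `C` (a "full `V`-subcategory"). -/
@[nolint unusedArguments]
def Induced {S : Type w'} (_ : S → C) : Type w' := S

instance {S : Type w'} (s : S → C) : EnrichedCategory V (Induced s) where
  Hom a b := EnrichedCategory.Hom (s a) (s b)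
  id a := EnrichedCategory.id (s a)
  comp a b c := EnrichedCategory.comp (s a) (s b) (s c)
  id_comp _ _ := EnrichedCategory.id_comp _ _
  comp_id _ _ := EnrichedCategory.comp_id _ _
  assoc _ _ _ _ := EnrichedCategory.assoc _ _ _ _

/-- The fully faithful `V`-functor from a full `V`-subcategory. -/
def inducedIncl {S : Type w'} (s : S → C) : EnrichedFunctor V (Induced s) C where
  obj a := s a
  map _ _ := 𝟙 _
  map_id _ := Category.comp_id _
  map_comp _ _ _ := by
    rw [Category.comp_id, id_tensorHom_id, Category.id_comp]
    rfl

end Induced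

section Restriction

variable {V : Type u} [Category.{v} V] [MonoidalCategory V] [MonoidalClosed V]
  {B : Type w} [EnrichedCategory V B] {C : Type w'} [EnrichedCategory V C]

/-- Restriction of a `V`-functor `C ⟶ V` along a `V`-functor `K : B ⟶ C`. -/
def VFun.restr (K : EnrichedFunctor V B C) (F : VFun V C) : VFun V B :=
  ⟨K.comp V F.toFunctor⟩

lemma VFun.restr_act (K : EnrichedFunctor V B C) (F : VFun V C) (a b : B) :
    (F.restr K).act a b = F.obj (K.obj a) ◁ K.map a b ≫ F.act (K.obj a) (K.obj b) :=
  uncurry_natural_left _ _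

lemma restriction_aux (K : EnrichedFunctor V B C) {F G : VFun V C} (f : F ⟶ G) (a b : B) :
    (F.obj (K.obj a) ◁ K.map a b ≫ F.act (K.obj a) (K.obj b)) ≫ f.app (K.obj b) =
      f.app (K.obj a) ▷ _ ≫ G.obj (K.obj a) ◁ K.map a b ≫ G.act (K.obj a) (K.obj b) := by
  rw [Category.assoc, f.nat, whisker_exchange_assoc]

/-- The restriction functor `[C, V] ⥤ [B, V]` along a `V`-functor `K : B ⟶ C`. -/
def restriction (K : EnrichedFunctor V B C) : VFun V C ⥤ VFun V B where
  obj F := F.restr K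
  map f :=
    { app := fun a => f.app (K.obj a)
      naturality := fun a b =>
        (congrArg (· ≫ f.app (K.obj b)) (VFun.restr_act K _ a b)).trans
          ((restriction_aux K f a b).trans
            (congrArg (f.app (K.obj a) ▷ _ ≫ ·) (VFun.restr_act K _ a b).symm)) }

end Restriction

section Elements

variable {V : Type u} [Category.{v} V] [MonoidalCategory V] {C : Type w} [EnrichedCategory V C]

lemma eId_eComp (a b : C) : eId V a ▷ (a ⟶[V] b) ≫ eComp V a a b = (λ_ _).hom := by
  rw [← cancel_epi (λ_ _).inv, e_id_comp, Iso.inv_hom_id]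

lemma eComp_eId (a b : C) : (a ⟶[V] b) ◁ eId V b ≫ eComp V a b b = (ρ_ _).hom := by
  rw [← cancel_epi (ρ_ _).inv, e_comp_id, Iso.inv_hom_id]

/-- Postcomposition with a morphism of the underlying category. -/
def postcomp (a : C) {b c : C} (f : 𝟙_ V ⟶ (b ⟶[V] c)) : (a ⟶[V] b) ⟶ (a ⟶[V] c) :=
  (ρ_ _).inv ≫ _ ◁ f ≫ eComp V a b c

/-- Precomposition with a morphism of the underlying category. -/
def precomp {a b : C} (f : 𝟙_ V ⟶ (a ⟶[V] b)) (c : C) : (b ⟶[V] c) ⟶ (a ⟶[V] c) :=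
  (λ_ _).inv ≫ f ▷ _ ≫ eComp V a b c

lemma comp_postcomp {a b c : C} (f : 𝟙_ V ⟶ (a ⟶[V] b)) (g : 𝟙_ V ⟶ (b ⟶[V] c)) :
    f ≫ postcomp a g = ((λ_ (𝟙_ V)).inv ≫ (f ⊗ₘ g)) ≫ eComp V a b c := by
  rw [postcomp, rightUnitor_inv_naturality_assoc,
    MonoidalCategory.tensorHom_def, unitors_inv_equal]
  simp

/-- A small skeleton. -/
structure Reps (V : Type u) [Category.{v} V] [MonoidalCategory V] (C : Type w)
    [EnrichedCategory V C] where
  S : Type v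
  s : S → C
  r : C → S
  p : ∀ c, 𝟙_ V ⟶ (c ⟶[V] s (r c))
  q : ∀ c, 𝟙_ V ⟶ (s (r c) ⟶[V] c)
  pq : ∀ c, p c ≫ postcomp c (q c) = eId V c

lemma exists_reps (V : Type u) [Category.{v} V] [MonoidalCategory V] (C : Type w)
    [EnrichedCategory V C] [EssentiallySmall.{v} (ForgetEnrichment V C)] :
    Nonempty (Reps V C) := by
  let e := equivSmallModel.{v} (ForgetEnrichment V C)
  refine ⟨⟨SmallModel.{v} (ForgetEnrichment V C),
    fun s => ForgetEnrichment.to V (e.inverse.obj s),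
    fun c => e.functor.obj (ForgetEnrichment.of V c),
    fun c => ForgetEnrichment.homTo V (e.unit.app (ForgetEnrichment.of V c)),
    fun c => ForgetEnrichment.homTo V (e.unitInv.app (ForgetEnrichment.of V c)), fun c => ?_⟩⟩
  exact (comp_postcomp _ _).trans ((ForgetEnrichment.homTo_comp V _ _).symm.trans
    ((congrArg (ForgetEnrichment.homTo V)
      (e.unitIso.hom_inv_id_app (ForgetEnrichment.of V c))).trans
        (ForgetEnrichment.homTo_id V _)))

variable [MonoidalClosed V]

/-- The morphism `F(a) ⟶ F(b)` induced by a morphism of the underlying category. -/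
def VFun.elt (F : VFun V C) {a b : C} (f : 𝟙_ V ⟶ (a ⟶[V] b)) : F.obj a ⟶ F.obj b :=
  (ρ_ _).inv ≫ F.obj a ◁ f ≫ F.act a b

lemma VFun.act_elt (F : VFun V C) (a : C) {b c : C} (f : 𝟙_ V ⟶ (b ⟶[V] c)) :
    F.act a b ≫ F.elt f = F.obj a ◁ postcomp a f ≫ F.act a c := by
  simp only [elt, postcomp, MonoidalCategory.whiskerLeft_comp, Category.assoc, act_comp]
  rw [rightUnitor_inv_naturality_assoc, ← whisker_exchange_assoc,
    associator_inv_naturality_right_assoc, rightUnitor_tensor_inv]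
  simp

lemma VFun.elt_act (F : VFun V C) {a b : C} (f : 𝟙_ V ⟶ (a ⟶[V] b)) (c : C) :
    F.elt f ▷ _ ≫ F.act b c = F.obj a ◁ precomp f c ≫ F.act a c := by
  simp only [elt, precomp, MonoidalCategory.whiskerLeft_comp, Category.assoc, act_comp,
    comp_whiskerRight]
  rw [associator_inv_naturality_middle_assoc]
  simp

lemma VFun.elt_comp (F : VFun V C) {a b c : C} (f : 𝟙_ V ⟶ (a ⟶[V] b))
    (g : 𝟙_ V ⟶ (b ⟶[V] c)) : F.elt f ≫ F.elt g = F.elt (f ≫ postcomp a g) := by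
  conv_lhs => rw [elt]
  rw [Category.assoc, Category.assoc, act_elt, elt, MonoidalCategory.whiskerLeft_comp,
    Category.assoc]

lemma VFun.elt_eId (F : VFun V C) (a : C) : F.elt (eId V a) = 𝟙 _ := by
  rw [elt, act_id, Iso.inv_hom_id]

end Elements

section Multi

variable {V : Type u} [Category.{v} V]

/-- Restriction of the index of an end-type limit to a family of objects. -/
def pullMulticospan {C : Type w} {S : Type w'} (I : MulticospanIndex (.prod C) V) (s : S → C) :
    MulticospanIndex (.prod S) V where
  left a := I.left (s a)
  right p := I.right (s p.1, s p.2)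
  fst p := I.fst (s p.1, s p.2)
  snd p := I.snd (s p.1, s p.2)

/-- Restriction of the index of a coend-type colimit to a family of objects. -/
def pullMultispan {C : Type w} {S : Type w'} (I : MultispanIndex (.prod C) V) (s : S → C) :
    MultispanIndex (.prod S) V where
  left p := I.left (s p.1, s p.2)
  right a := I.right (s a)
  fst p := I.fst (s p.1, s p.2)
  snd p := I.snd (s p.1, s p.2)

lemma hasMultiequalizer_of_pull {C : Type w} {S : Type w'} (I : MulticospanIndex (.prod C) V)
    (s : S → C) (r : C → S) (t : ∀ c, I.left (s (r c)) ⟶ I.left c)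
    (h₁ : ∀ (W : V) (k : ∀ c, W ⟶ I.left c),
      (∀ a b, k a ≫ I.fst (a, b) = k b ≫ I.snd (a, b)) → ∀ c, k (s (r c)) ≫ t c = k c)
    (h₂ : ∀ (W : V) (k : ∀ x, W ⟶ I.left (s x)),
      (∀ a b, k a ≫ I.fst (s a, s b) = k b ≫ I.snd (s a, s b)) →
        ∀ a b, (k (r a) ≫ t a) ≫ I.fst (a, b) = (k (r b) ≫ t b) ≫ I.snd (a, b))
    (h₃ : ∀ (W : V) (k : ∀ x, W ⟶ I.left (s x)),
      (∀ a b, k a ≫ I.fst (s a, s b) = k b ≫ I.snd (s a, s b)) →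
        ∀ x, k (r (s x)) ≫ t (s x) = k x)
    [HasMultiequalizer (pullMulticospan I s)] : HasMultiequalizer I := by
  let J := pullMulticospan I s
  have hc : ∀ a b, Multiequalizer.ι J a ≫ I.fst (s a, s b) =
      Multiequalizer.ι J b ≫ I.snd (s a, s b) := fun a b => Multiequalizer.condition J (a, b)
  let K : Multifork I := Multifork.ofι I (multiequalizer J)
    (fun c => Multiequalizer.ι J (r c) ≫ t c) (fun p => h₂ _ _ hc p.1 p.2)
  have hK : IsLimit K := Multifork.IsLimit.mk K
    (fun E => Multiequalizer.lift J E.pt (fun x => E.ι (s x))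
      (fun p => E.condition (s p.1, s p.2)))
    (fun E c => by
      refine ((Category.assoc _ _ _).symm.trans (congrArg (· ≫ t c)
        (Multiequalizer.lift_ι J _ _ _ (r c)))).trans ?_
      exact h₁ _ (fun c => E.ι c) (fun a b => E.condition (a, b)) c)
    (fun E m hm => by
      apply Multiequalizer.hom_ext J
      intro x
      refine Eq.trans ?_ (Multiequalizer.lift_ι J _ _ _ x).symm
      refine Eq.trans ?_ (hm (s x))
      exact congrArg (m ≫ ·) (h₃ _ _ hc x).symm)
  exact ⟨⟨⟨K, hK⟩⟩⟩

lemma hasMulticoequalizer_of_pull {C : Type w} {S : Type w'} (I : MultispanIndex (.prod C) V)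
    (s : S → C) (r : C → S) (t : ∀ c, I.right c ⟶ I.right (s (r c)))
    (h₁ : ∀ (W : V) (k : ∀ c, I.right c ⟶ W),
      (∀ a b, I.fst (a, b) ≫ k a = I.snd (a, b) ≫ k b) → ∀ c, t c ≫ k (s (r c)) = k c)
    (h₂ : ∀ (W : V) (k : ∀ x, I.right (s x) ⟶ W),
      (∀ a b, I.fst (s a, s b) ≫ k a = I.snd (s a, s b) ≫ k b) →
        ∀ a b, I.fst (a, b) ≫ t a ≫ k (r a) = I.snd (a, b) ≫ t b ≫ k (r b))
    (h₃ : ∀ (W : V) (k : ∀ x, I.right (s x) ⟶ W),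
      (∀ a b, I.fst (s a, s b) ≫ k a = I.snd (s a, s b) ≫ k b) →
        ∀ x, t (s x) ≫ k (r (s x)) = k x)
    [HasMulticoequalizer (pullMultispan I s)] : HasMulticoequalizer I := by
  let J := pullMultispan I s
  have hc : ∀ a b, I.fst (s a, s b) ≫ Multicoequalizer.π J a =
      I.snd (s a, s b) ≫ Multicoequalizer.π J b := fun a b => Multicoequalizer.condition J (a, b)
  let K : Multicofork I := Multicofork.ofπ I (multicoequalizer J)
    (fun c => t c ≫ Multicoequalizer.π J (r c)) (fun p => h₂ _ _ hc p.1 p.2)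
  have hK : IsColimit K := Multicofork.IsColimit.mk K
    (fun E => Multicoequalizer.desc J E.pt (fun x => E.π (s x))
      (fun p => E.condition (s p.1, s p.2)))
    (fun E c => by
      refine ((Category.assoc _ _ _).trans (congrArg (t c ≫ ·)
        (Multicoequalizer.π_desc J _ _ _ (r c)))).trans ?_
      exact h₁ _ (fun c => E.π c) (fun a b => E.condition (a, b)) c)
    (fun E m hm => by
      apply Multicoequalizer.hom_ext J
      intro x
      refine Eq.trans ?_ (Multicoequalizer.π_desc J _ _ _ x).symm
      refine Eq.trans ?_ (hm (s x))
      exact congrArg (· ≫ m) (h₃ _ _ hc x).symm)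
  exact ⟨⟨⟨K, hK⟩⟩⟩

end Multi

section Swap

variable {V : Type u} [Category.{v} V] [MonoidalCategory V] [SymmetricCategory V]

/-- The symmetry `(X ⊗ Y) ⊗ Z ≅ (X ⊗ Z) ⊗ Y`. -/
def swapRight (X Y Z : V) : (X ⊗ Y) ⊗ Z ⟶ (X ⊗ Z) ⊗ Y :=
  (α_ X Y Z).hom ≫ X ◁ (β_ Y Z).hom ≫ (α_ X Z Y).inv

lemma swapRight_naturality_left {X X' : V} (f : X ⟶ X') (Y Z : V) :
    (f ▷ Y) ▷ Z ≫ swapRight X' Y Z = swapRight X Y Z ≫ (f ▷ Z) ▷ Y := by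
  simp only [swapRight, Category.assoc, associator_naturality_left_assoc,
    ← associator_inv_naturality_left]
  rw [whisker_exchange_assoc]

lemma swapRight_naturality_middle (X : V) {Y Y' : V} (f : Y ⟶ Y') (Z : V) :
    (X ◁ f) ▷ Z ≫ swapRight X Y' Z = swapRight X Y Z ≫ (X ⊗ Z) ◁ f := by
  simp only [swapRight, Category.assoc, associator_naturality_middle_assoc,
    ← associator_inv_naturality_right]
  rw [← MonoidalCategory.whiskerLeft_comp_assoc, ← MonoidalCategory.whiskerLeft_comp_assoc,
    BraidedCategory.braiding_naturality_left]

lemma swapRight_naturality_right (X Y : V) {Z Z' : V} (f : Z ⟶ Z') :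
    (X ⊗ Y) ◁ f ≫ swapRight X Y Z' = swapRight X Y Z ≫ (X ◁ f) ▷ Y := by
  simp only [swapRight, Category.assoc, associator_naturality_right_assoc,
    ← associator_inv_naturality_middle]
  rw [← MonoidalCategory.whiskerLeft_comp_assoc, ← MonoidalCategory.whiskerLeft_comp_assoc,
    BraidedCategory.braiding_naturality_right]

lemma swapRight_unit (X W : V) :
    (ρ_ X).inv ▷ W ≫ swapRight X (𝟙_ V) W = (ρ_ (X ⊗ W)).inv := by
  simp [swapRight]

end Swap

section HomObject

variable {V : Type u} [Category.{v} V] [MonoidalCategory V] [SymmetricCategory V]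
  [MonoidalClosed V] {C : Type w} [EnrichedCategory V C]

/-- The morphism `[F(a), G(a)] ⟶ [F(a) ⊗ C(a,b), G(b)]` given by the action on `G`. -/
def homFst (F G : VFun V C) (a b : C) :
    (ihom (F.obj a)).obj (G.obj a) ⟶ (ihom (F.obj a ⊗ (a ⟶[V] b))).obj (G.obj b) :=
  curry (swapRight _ _ _ ≫ (ihom.ev (F.obj a)).app (G.obj a) ▷ _ ≫ G.act a b)

/-- The morphism `[F(b), G(b)] ⟶ [F(a) ⊗ C(a,b), G(b)]` given by the action on `F`. -/
def homSnd (F G : VFun V C) (a b : C) :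
    (ihom (F.obj b)).obj (G.obj b) ⟶ (ihom (F.obj a ⊗ (a ⟶[V] b))).obj (G.obj b) :=
  (pre (F.act a b)).app (G.obj b)

/-- The diagram whose limit is the end `∫_c [F(c), G(c)]`: the product of the objects
`[F(c), G(c)]` has two families of maps to `[F(a) ⊗ C(a,b), G(b)] ≅ [C(a,b), [F(a), G(b)]]`,
given by the actions of `C(a,b)` on `G` and on `F`. -/
def homIndex (F G : VFun V C) : MulticospanIndex (.prod C) V where
  left c := (ihom (F.obj c)).obj (G.obj c)
  right p := (ihom (F.obj p.1 ⊗ (p.1 ⟶[V] p.2))).obj (G.obj p.2)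
  fst p := homFst F G p.1 p.2
  snd p := homSnd F G p.1 p.2

/-- Naturality of a family of morphisms `F(c) ⊗ W ⟶ G(c)`. -/
def IsGraded (F G : VFun V C) {W : V} {a b : C} (φ : F.obj a ⊗ W ⟶ G.obj a)
    (ψ : F.obj b ⊗ W ⟶ G.obj b) : Prop :=
  F.act a b ▷ W ≫ ψ = swapRight _ _ _ ≫ φ ▷ _ ≫ G.act a b

lemma homIndex_condition_iff (F G : VFun V C) {W : V} {a b : C}
    (x : W ⟶ (ihom (F.obj a)).obj (G.obj a)) (y : W ⟶ (ihom (F.obj b)).obj (G.obj b)) :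
    x ≫ homFst F G a b = y ≫ homSnd F G a b ↔ IsGraded F G (uncurry x) (uncurry y) := by
  have h1 : uncurry (x ≫ homFst F G a b) = swapRight _ _ _ ≫ uncurry x ▷ _ ≫ G.act a b := by
    rw [uncurry_natural_left, homFst, uncurry_curry, uncurry_eq x,
      reassoc_of% @swapRight_naturality_right, comp_whiskerRight_assoc]
  have h2 : uncurry (y ≫ homSnd F G a b) = F.act a b ▷ W ≫ uncurry y :=
    uncurry_pre_app _ _ _
  rw [IsGraded, ← h1, ← h2]
  exact ⟨fun h => (congrArg uncurry h).symm, fun h => uncurry_injective h.symm⟩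

lemma IsGraded.elt {F G : VFun V C} {W : V} {a b : C} {φ : F.obj a ⊗ W ⟶ G.obj a}
    {ψ : F.obj b ⊗ W ⟶ G.obj b} (h : IsGraded F G φ ψ) (f : 𝟙_ V ⟶ (a ⟶[V] b)) :
    F.elt f ▷ W ≫ ψ = φ ≫ G.elt f := by
  rw [VFun.elt, VFun.elt, comp_whiskerRight, comp_whiskerRight, Category.assoc, Category.assoc, h,
    reassoc_of% @swapRight_naturality_middle, reassoc_of% @swapRight_unit, whisker_exchange_assoc,
    rightUnitor_inv_naturality_assoc]

lemma IsGraded.conj {F G : VFun V C} {W : V} {a b : C} {φ : F.obj a ⊗ W ⟶ G.obj a}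
    {ψ : F.obj b ⊗ W ⟶ G.obj b} (h : IsGraded F G φ ψ) {c d : C}
    {p : 𝟙_ V ⟶ (c ⟶[V] a)} {q : 𝟙_ V ⟶ (a ⟶[V] c)}
    {p' : 𝟙_ V ⟶ (d ⟶[V] b)} {q' : 𝟙_ V ⟶ (b ⟶[V] d)}
    (hpq : p ≫ postcomp c q = eId V c) (hpq' : p' ≫ postcomp d q' = eId V d) :
    IsGraded F G (F.elt p ▷ W ≫ φ ≫ G.elt q) (F.elt p' ▷ W ≫ ψ ≫ G.elt q') := by
  have e1 : F.act c d ≫ F.elt p' =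
      F.elt p ▷ _ ≫ F.obj a ◁ (precomp q d ≫ postcomp a p') ≫ F.act a b := by
    rw [MonoidalCategory.whiskerLeft_comp_assoc, ← VFun.act_elt, ← reassoc_of% @VFun.elt_act,
      ← comp_whiskerRight_assoc, VFun.elt_comp, hpq, VFun.elt_eId]
    simp
  have e2 : G.obj a ◁ (precomp q d ≫ postcomp a p') ≫ G.act a b ≫ G.elt q' =
      G.elt q ▷ _ ≫ G.act c d := by
    rw [MonoidalCategory.whiskerLeft_comp_assoc, ← reassoc_of% @VFun.act_elt, VFun.elt_comp, hpq',
      VFun.elt_eId, Category.comp_id, VFun.elt_act]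
  unfold IsGraded
  rw [← comp_whiskerRight_assoc, e1]
  simp only [comp_whiskerRight, Category.assoc]
  rw [reassoc_of% h, ← e2, reassoc_of% @swapRight_naturality_middle, reassoc_of% @swapRight_naturality_left,
    whisker_exchange_assoc]

instance hasMultiequalizer_homIndex [EssentiallySmall.{v} (ForgetEnrichment V C)]
    [HasLimits V] (F G : VFun V C) : HasMultiequalizer (homIndex F G) := by
  obtain ⟨R⟩ := exists_reps V C
  have key : ∀ (W : V) (c : C)
      (k : W ⟶ (ihom (F.obj (R.s (R.r c)))).obj (G.obj (R.s (R.r c)))),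
      uncurry (k ≫ (pre (F.elt (R.p c))).app _ ≫ (ihom _).map (G.elt (R.q c))) =
        F.elt (R.p c) ▷ W ≫ uncurry k ≫ G.elt (R.q c) := fun W c k => by
    rw [← Category.assoc, uncurry_natural_right, uncurry_pre_app, Category.assoc]
  have key2 : ∀ (W : V) (c : C) (x : W ⟶ (ihom (F.obj c)).obj (G.obj c))
      (k : W ⟶ (ihom (F.obj (R.s (R.r c)))).obj (G.obj (R.s (R.r c)))),
      x ≫ homFst F G c (R.s (R.r c)) = k ≫ homSnd F G c (R.s (R.r c)) →
      k ≫ (pre (F.elt (R.p c))).app _ ≫ (ihom _).map (G.elt (R.q c)) = x := fun W c x k h => by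
    apply uncurry_injective
    rw [key, ← Category.assoc, ((homIndex_condition_iff F G _ _).1 h).elt, Category.assoc,
      VFun.elt_comp, R.pq, VFun.elt_eId, Category.comp_id]
  refine hasMultiequalizer_of_pull (homIndex F G) R.s R.r
    (fun c => (pre (F.elt (R.p c))).app _ ≫ (ihom _).map (G.elt (R.q c))) ?_ ?_ ?_
  · exact fun W k hk c => key2 W c _ _ (hk c (R.s (R.r c)))
  · intro W k hk a b
    refine (homIndex_condition_iff F G _ _).2 ?_
    have := ((homIndex_condition_iff F G _ _).1 (hk (R.r a) (R.r b))).conj (R.pq a) (R.pq b)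
    have e := fun c => key W c (k (R.r c))
    exact (e a).symm ▸ (e b).symm ▸ this
  · exact fun W k hk x => key2 W (R.s x) _ _ (hk x (R.r (R.s x)))

end HomObject

section HomCategory

variable {V : Type u} [Category.{v} V] [MonoidalCategory V] [SymmetricCategory V]

lemma swapRight_tensor (X Y Z W : V) :
    (α_ (X ⊗ Y) Z W).inv ≫ swapRight X Y Z ▷ W ≫ swapRight (X ⊗ Z) Y W =
      swapRight X Y (Z ⊗ W) ≫ (α_ X Z W).inv ▷ Y := by
  simp only [swapRight, BraidedCategory.braiding_tensor_right_hom]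
  monoidal

lemma swapRight_unit_right (X Y : V) :
    swapRight X Y (𝟙_ V) ≫ (ρ_ X).hom ▷ Y = (ρ_ (X ⊗ Y)).hom := by
  simp [swapRight]

variable [MonoidalClosed V] {C : Type w} [EnrichedCategory V C]

lemma homObj.lift_aux {F G : VFun V C} {W : V} (φ : ∀ c, F.obj c ⊗ W ⟶ G.obj c)
    (h : ∀ a b, IsGraded F G (φ a) (φ b)) (a b : C) :
    curry (φ a) ≫ homFst F G a b = curry (φ b) ≫ homSnd F G a b :=
  (homIndex_condition_iff F G _ _).2 (by
    rw [uncurry_curry, uncurry_curry]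
    exact h a b)

variable [EssentiallySmall.{v} (ForgetEnrichment V C)] [HasLimits V]

/-- The `V`-object of `V`-natural transformations, i.e. the end `∫_c [F(c), G(c)]`. -/
def homObj (F G : VFun V C) : V := multiequalizer (homIndex F G)

namespace homObj

/-- The projection from the end `∫_c [F(c), G(c)]`. -/
def π (F G : VFun V C) (c : C) : homObj F G ⟶ (ihom (F.obj c)).obj (G.obj c) :=
  Multiequalizer.ι (homIndex F G) c

/-- Evaluation `F(c) ⊗ ∫_c [F(c), G(c)] ⟶ G(c)`. -/
def ev (F G : VFun V C) (c : C) : F.obj c ⊗ homObj F G ⟶ G.obj c := uncurry (π F G c)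

lemma ev_graded (F G : VFun V C) (a b : C) : IsGraded F G (ev F G a) (ev F G b) :=
  (homIndex_condition_iff F G _ _).1 (Multiequalizer.condition (homIndex F G) (a, b))

/-- The universal property of the end `∫_c [F(c), G(c)]`. -/
def lift {F G : VFun V C} {W : V} (φ : ∀ c, F.obj c ⊗ W ⟶ G.obj c)
    (h : ∀ a b, IsGraded F G (φ a) (φ b)) : W ⟶ homObj F G :=
  Multiequalizer.lift (homIndex F G) W (fun c => curry (φ c))
    (fun p => lift_aux φ h p.1 p.2)

lemma lift_π {F G : VFun V C} {W : V} (φ : ∀ c, F.obj c ⊗ W ⟶ G.obj c)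
    (h : ∀ a b, IsGraded F G (φ a) (φ b)) (c : C) : lift φ h ≫ π F G c = curry (φ c) :=
  Multiequalizer.lift_ι (homIndex F G) _ _ _ c

@[simp]
lemma lift_ev {F G : VFun V C} {W : V} (φ : ∀ c, F.obj c ⊗ W ⟶ G.obj c)
    (h : ∀ a b, IsGraded F G (φ a) (φ b)) (c : C) :
    F.obj c ◁ lift φ h ≫ ev F G c = φ c := by
  rw [ev, ← uncurry_natural_left, lift_π, uncurry_curry]

lemma hom_ext {F G : VFun V C} {W : V} {x y : W ⟶ homObj F G}
    (h : ∀ c, F.obj c ◁ x ≫ ev F G c = F.obj c ◁ y ≫ ev F G c) : x = y :=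
  Multiequalizer.hom_ext (homIndex F G) _ _ (fun c => uncurry_injective
    ((uncurry_natural_left x (π F G c)).trans
      ((h c).trans (uncurry_natural_left y (π F G c)).symm)))

/-- The identity `𝟙 ⟶ ∫_c [F(c), F(c)]`. -/
def one (F : VFun V C) : 𝟙_ V ⟶ homObj F F :=
  lift (fun c => (ρ_ (F.obj c)).hom) (fun a b => by
    rw [IsGraded, reassoc_of% @swapRight_unit_right, rightUnitor_naturality])

@[simp]
lemma one_ev (F : VFun V C) (c : C) : F.obj c ◁ one F ≫ ev F F c = (ρ_ _).hom := lift_ev _ _ c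

/-- The composition `∫_c [F(c), G(c)] ⊗ ∫_c [G(c), H(c)] ⟶ ∫_c [F(c), H(c)]`. -/
def comp (F G H : VFun V C) : homObj F G ⊗ homObj G H ⟶ homObj F H :=
  lift (fun c => (α_ _ _ _).inv ≫ ev F G c ▷ _ ≫ ev G H c) (fun a b => by
    have h1 : _ = _ := ev_graded F G a b
    have h2 : _ = _ := ev_graded G H a b
    rw [IsGraded, associator_inv_naturality_left_assoc, ← comp_whiskerRight_assoc, h1]
    simp only [comp_whiskerRight, Category.assoc]
    rw [h2, ← reassoc_of% @swapRight_tensor, reassoc_of% @swapRight_naturality_left])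

@[simp]
lemma comp_ev (F G H : VFun V C) (c : C) :
    F.obj c ◁ comp F G H ≫ ev F H c = (α_ _ _ _).inv ≫ ev F G c ▷ _ ≫ ev G H c :=
  lift_ev _ _ c

end homObj

open homObj in
/-- The category of `V`-functors `C ⟶ V` is a `V`-category, with `V`-objects of morphisms
`∫_c [F(c), G(c)]`. -/
instance : EnrichedCategory V (VFun V C) where
  Hom F G := homObj F G
  id F := one F
  comp F G H := comp F G H
  id_comp F G := hom_ext (fun c => by
    simp only [MonoidalCategory.whiskerLeft_comp, Category.assoc, comp_ev]
    rw [associator_inv_naturality_middle_assoc, ← comp_whiskerRight_assoc, one_ev]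
    simp)
  comp_id F G := hom_ext (fun c => by
    simp only [MonoidalCategory.whiskerLeft_comp, Category.assoc, comp_ev]
    rw [associator_inv_naturality_right_assoc, whisker_exchange_assoc, one_ev]
    simp)
  assoc F G H K := hom_ext (fun c => by
    simp only [MonoidalCategory.whiskerLeft_comp, Category.assoc, comp_ev]
    rw [associator_inv_naturality_right_assoc, whisker_exchange_assoc, comp_ev,
      associator_inv_naturality_middle_assoc, ← comp_whiskerRight_assoc, comp_ev]
    simp)

end HomCategory

section Evaluation

variable {V : Type u} [Category.{v} V] [MonoidalCategory V] [MonoidalClosed V]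
  {C : Type w} [EnrichedCategory V C]

/-- The evaluation functor at an object `c`. -/
def evaluation (c : C) : VFun V C ⥤ V where
  obj F := F.obj c
  map f := f.app c

variable [SymmetricCategory V]

/-- Evaluation `[X, W] ⊗ X ⟶ W`. -/
def evRight (X W : V) : (ihom X).obj W ⊗ X ⟶ W := (β_ _ _).hom ≫ (ihom.ev X).app W

/-- Adjoint transposition with respect to the right variable. -/
def curryRight {X Y W : V} (f : Y ⊗ X ⟶ W) : Y ⟶ (ihom X).obj W := curry ((β_ _ _).hom ≫ f)

@[simp]
lemma curryRight_evRight {X Y W : V} (f : Y ⊗ X ⟶ W) : curryRight f ▷ X ≫ evRight X W = f := by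
  rw [evRight, curryRight, BraidedCategory.braiding_naturality_left_assoc,
    whiskerLeft_curry_ihom_ev_app, SymmetricCategory.symmetry_assoc]

lemma ihom_ext_right {X Y W : V} {f g : Y ⟶ (ihom X).obj W}
    (h : f ▷ X ≫ evRight X W = g ▷ X ≫ evRight X W) : f = g := by
  apply uncurry_injective
  rw [uncurry_eq, uncurry_eq, ← cancel_epi (β_ _ _).hom,
    ← BraidedCategory.braiding_naturality_left_assoc,
    ← BraidedCategory.braiding_naturality_left_assoc]
  exact h

lemma curryRight_comp {X Y Y' W : V} (f : Y' ⟶ Y) (g : Y ⊗ X ⟶ W) :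
    f ≫ curryRight g = curryRight (f ▷ X ≫ g) :=
  ihom_ext_right (by simp)

/-- The action morphism of the `V`-functor `x ↦ [C(x,c), W]`. -/
def coindAct (c : C) (W : V) (a b : C) :
    (ihom (a ⟶[V] c)).obj W ⊗ (a ⟶[V] b) ⟶ (ihom (b ⟶[V] c)).obj W :=
  curryRight ((α_ _ _ _).hom ≫ _ ◁ eComp V a b c ≫ evRight _ _)

/-- The `V`-functor `x ↦ [C(x,c), W]`. -/
def coind (c : C) (W : V) : VFun V C :=
  VFun.ofAct (fun x => (ihom (x ⟶[V] c)).obj W) (coindAct c W)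
    (fun a => by
      apply ihom_ext_right
      rw [coindAct, comp_whiskerRight, Category.assoc, curryRight_evRight,
        associator_naturality_middle_assoc, ← MonoidalCategory.whiskerLeft_comp_assoc, eId_eComp]
      simp)
    (fun x y z => by
      apply ihom_ext_right
      simp only [coindAct, comp_whiskerRight, Category.assoc, curryRight_evRight]
      rw [associator_naturality_left_assoc, ← whisker_exchange_assoc, curryRight_evRight,
        associator_naturality_middle_assoc, ← MonoidalCategory.whiskerLeft_comp_assoc,
        ← e_assoc']
      simp)

lemma coind_nat_aux (c : C) (F : VFun V C) {W : V} (f : F.obj c ⟶ W) (a b : C) :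
    F.act a b ≫ curryRight (F.act b c ≫ f) =
      curryRight (F.act a c ≫ f) ▷ _ ≫ coindAct c W a b := by
  apply ihom_ext_right
  simp only [coindAct, comp_whiskerRight, Category.assoc, curryRight_evRight]
  rw [associator_naturality_left_assoc, ← whisker_exchange_assoc, curryRight_evRight,
    reassoc_of% @VFun.act_comp, Iso.hom_inv_id_assoc]

/-- The morphism `[C(c,c), W] ⟶ W` given by evaluation at the identity of `c`. -/
def coindCounit (c : C) (W : V) : (ihom (c ⟶[V] c)).obj W ⟶ W :=
  (ρ_ _).inv ≫ _ ◁ eId V c ≫ evRight _ _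

lemma coind_unit_aux (c x : C) (W : V) :
    coindAct c W x c ≫ coindCounit c W = evRight (x ⟶[V] c) W := by
  rw [coindCounit, rightUnitor_inv_naturality_assoc, ← whisker_exchange_assoc, coindAct,
    curryRight_evRight,
    associator_naturality_right_assoc, ← MonoidalCategory.whiskerLeft_comp_assoc, eComp_eId]
  simp

lemma coind_left_inv_aux (c : C) (F : VFun V C) {W : V} (f : F.obj c ⟶ W) :
    curryRight (F.act c c ≫ f) ≫ coindCounit c W = f := by
  rw [coindCounit, rightUnitor_inv_naturality_assoc, ← whisker_exchange_assoc, curryRight_evRight,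
      reassoc_of% @VFun.act_id, Iso.inv_hom_id_assoc]

lemma coind_right_inv_aux (c : C) (F : VFun V C) {W : V}
    (t : ∀ x, F.obj x ⟶ (ihom (x ⟶[V] c)).obj W)
    (ht : ∀ a b, F.act a b ≫ t b = t a ▷ _ ≫ coindAct c W a b) (x : C) :
    curryRight (F.act x c ≫ t c ≫ coindCounit c W) = t x := by
  apply ihom_ext_right
  rw [curryRight_evRight, reassoc_of% ht x c, coind_unit_aux]

lemma coind_naturality_aux (c x : C) {F G : VFun V C} {W : V} (f : F ⟶ G) (g : G.obj c ⟶ W) :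
    curryRight (F.act x c ≫ f.app c ≫ g) = f.app x ≫ curryRight (G.act x c ≫ g) := by
  apply ihom_ext_right
  rw [curryRight_evRight, comp_whiskerRight, Category.assoc, curryRight_evRight, reassoc_of% f.nat]

/-- Evaluation at `c` is left adjoint to `W ↦ [C(-,c), W]`. -/
def evaluationEquiv (c : C) (F : VFun V C) (W : V) : (F.obj c ⟶ W) ≃ (F ⟶ coind c W) where
  toFun f :=
    { app := fun x => curryRight (F.act x c ≫ f)
      naturality := fun a b => (coind_nat_aux c F f a b).trans
        (congrArg (curryRight (F.act a c ≫ f) ▷ _ ≫ ·) (VFun.ofAct_act _ _ _ _ a b).symm) }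
  invFun g := g.app c ≫ coindCounit c W
  left_inv f := coind_left_inv_aux c F f
  right_inv g := VFun.hom_ext (fun x => coind_right_inv_aux c F (fun x => g.app x)
    (fun a b => (g.nat a b).trans (congrArg (g.app a ▷ _ ≫ ·) (VFun.ofAct_act _ _ _ _ a b))) x)

instance (c : C) : (evaluation (V := V) c).IsLeftAdjoint :=
  (Adjunction.adjunctionOfEquivRight (evaluationEquiv c) (fun _ _ _ f g =>
    VFun.hom_ext (fun x => coind_naturality_aux c x f g))).isLeftAdjoint

end Evaluation

section Yoneda

variable {V : Type u} [Category.{v} V] [MonoidalCategory V] [MonoidalClosed V]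
  {C : Type w} [EnrichedCategory V C]

/-- The representable `V`-functor `C(c,-)`. -/
def corep (c : C) : VFun V C :=
  VFun.ofAct (fun x => c ⟶[V] x) (eComp V c) (fun a => eComp_eId c a)
    (fun x y z => (Iso.eq_inv_comp _).2 (e_assoc' V c x y z))

lemma corep_act (c a b : C) : (corep (V := V) c).act a b = eComp V c a b :=
  VFun.ofAct_act _ _ _ _ _ _

lemma corep_nat_aux {c : C} {F : VFun V C} (x : 𝟙_ V ⟶ F.obj c) (a b : C) :
    eComp V c a b ≫ (λ_ _).inv ≫ x ▷ _ ≫ F.act c b =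
      ((λ_ _).inv ≫ x ▷ _ ≫ F.act c a) ▷ _ ≫ F.act a b := by
  rw [leftUnitor_inv_naturality_assoc, whisker_exchange_assoc, VFun.act_comp]
  simp

lemma corep_left_aux {c : C} {F : VFun V C} (f : ∀ a, (c ⟶[V] a) ⟶ F.obj a)
    (hf : ∀ a b, eComp V c a b ≫ f b = f a ▷ _ ≫ F.act a b) (a : C) :
    (λ_ _).inv ≫ (eId V c ≫ f c) ▷ _ ≫ F.act c a = f a := by
  rw [comp_whiskerRight_assoc, ← hf, reassoc_of% @eId_eComp, Iso.inv_hom_id_assoc]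

lemma corep_right_aux {c : C} {F : VFun V C} (x : 𝟙_ V ⟶ F.obj c) :
    eId V c ≫ (λ_ _).inv ≫ x ▷ _ ≫ F.act c c = x := by
  rw [leftUnitor_inv_naturality_assoc, whisker_exchange_assoc, VFun.act_id,
    rightUnitor_naturality, ← unitors_equal, Iso.inv_hom_id_assoc]

/-- The Yoneda lemma: morphisms `C(c,-) ⟶ F` correspond to morphisms `𝟙 ⟶ F(c)`. -/
def corepEquiv (c : C) (F : VFun V C) : (corep c ⟶ F) ≃ (𝟙_ V ⟶ F.obj c) where
  toFun f := eId V c ≫ f.app c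
  invFun x :=
    { app := fun a => (λ_ _).inv ≫ x ▷ _ ≫ F.act c a
      naturality := fun a b =>
        (congrArg (· ≫ _) (corep_act c a b)).trans (corep_nat_aux x a b) }
  left_inv f := VFun.hom_ext (fun a => corep_left_aux (fun a => f.app a)
    (fun a b => (congrArg (· ≫ f.app b) (corep_act c a b)).symm.trans (f.nat a b)) a)
  right_inv x := corep_right_aux x

open Opposite in
lemma corep_fp (c : C) [SymmetricCategory V] [IsFinitelyPresentable.{v} (𝟙_ V)] :
    IsFinitelyPresentable.{v} (corep (V := V) c) := by
  let e : coyoneda.obj (op (corep (V := V) c)) ≅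
      evaluation c ⋙ coyoneda.obj (op (𝟙_ V)) ⋙ uliftFunctor.{w} :=
    NatIso.ofComponents (fun F => ((corepEquiv c F).trans Equiv.ulift.symm).toIso)
      (fun f => by
        ext g
        exact ULift.ext _ _ (Category.assoc _ _ _).symm)
  rw [isFinitelyPresentable_iff_preservesFilteredColimitsOfSize]
  constructor
  intro J _ _
  have : PreservesColimitsOfShape J (coyoneda.obj (op (𝟙_ V))) := inferInstance
  exact preservesColimitsOfShape_of_natIso e.symm

end Yoneda

section Modules

variable (V : Type u) [Category.{v} V] [MonoidalCategory V] [SymmetricCategory V]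
  [MonoidalClosed V] (A : Type w) [EnrichedCategory V A]

instance [EssentiallySmall.{v} (ForgetEnrichment V A)] :
    EssentiallySmall.{v} (ForgetEnrichment V Aᵒᵖ) :=
  (essentiallySmall_congr (forgetEnrichmentOppositeEquivalence V A)).2 inferInstance

/-- The category of left `A`-modules `[A, V]`. -/
abbrev LeftMod := VFun V A

/-- The category of right `A`-modules `[Aᵒᵖ, V]`. -/
abbrev RightMod := VFun V Aᵒᵖ

variable [EssentiallySmall.{v} (ForgetEnrichment V A)] [HasLimits V]

/-- The full `V`-subcategory of finitely presented right `A`-modules. -/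
abbrev FpMod := Induced (Subtype.val : {M : RightMod V A // IsFinitelyPresentable.{v} M} → _)

/-- The category of generalised left `A`-modules `[mod A, V]`. -/
abbrev GenMod := VFun V (FpMod V A)

end Modules

section RightAct

open Opposite

variable {V : Type u} [Category.{v} V] [MonoidalCategory V] [SymmetricCategory V]
  [MonoidalClosed V] {A : Type w} [EnrichedCategory V A]

/-- The action `M(b) ⊗ A(a,b) ⟶ M(a)` on a right `A`-module. -/
def ract (M : RightMod V A) (a b : A) : M.obj (op b) ⊗ (a ⟶[V] b) ⟶ M.obj (op a) :=
  M.act (op b) (op a)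

lemma ract_id (M : RightMod V A) (a : A) :
    M.obj (op a) ◁ eId V a ≫ ract M a a = (ρ_ _).hom :=
  M.act_id (op a)

lemma ract_comp (M : RightMod V A) (a b c : A) :
    ract M b c ▷ _ ≫ ract M a b =
      (α_ _ _ _).hom ≫ _ ◁ ((β_ _ _).hom ≫ eComp V a b c) ≫ ract M a c :=
  ((Iso.eq_inv_comp _).1 (M.act_comp (op c) (op b) (op a))).symm

/-- The morphism `M(b) ⟶ M(a)` induced by a morphism `a ⟶ b` of the underlying category. -/
def relt (M : RightMod V A) {a b : A} (f : 𝟙_ V ⟶ (a ⟶[V] b)) : M.obj (op b) ⟶ M.obj (op a) :=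
  (ρ_ _).inv ≫ _ ◁ f ≫ ract M a b

lemma ract_relt (M : RightMod V A) {x a : A} (f : 𝟙_ V ⟶ (x ⟶[V] a)) (b : A) :
    ract M a b ≫ relt M f = _ ◁ precomp f b ≫ ract M x b := by
  rw [relt, rightUnitor_inv_naturality_assoc, ← whisker_exchange_assoc, ract_comp, precomp,
    associator_naturality_right_assoc, ← MonoidalCategory.whiskerLeft_comp_assoc,
    BraidedCategory.braiding_naturality_right_assoc]
  simp

lemma relt_ract (M : RightMod V A) (a : A) {b y : A} (f : 𝟙_ V ⟶ (b ⟶[V] y)) :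
    relt M f ▷ _ ≫ ract M a b = _ ◁ postcomp a f ≫ ract M a y := by
  rw [relt, comp_whiskerRight_assoc, comp_whiskerRight_assoc, ract_comp, postcomp,
    associator_naturality_middle_assoc, ← MonoidalCategory.whiskerLeft_comp_assoc,
    BraidedCategory.braiding_naturality_left_assoc]
  simp

lemma relt_comp (M : RightMod V A) {a b c : A} (f : 𝟙_ V ⟶ (a ⟶[V] b))
    (g : 𝟙_ V ⟶ (b ⟶[V] c)) : relt M g ≫ relt M f = relt M (f ≫ postcomp a g) := by
  conv_lhs => rw [relt]
  rw [Category.assoc, Category.assoc, ract_relt, relt, ← MonoidalCategory.whiskerLeft_comp_assoc]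
  congr 3
  rw [precomp, postcomp, leftUnitor_inv_naturality_assoc, rightUnitor_inv_naturality_assoc,
    whisker_exchange_assoc, unitors_inv_equal]

lemma relt_eId (M : RightMod V A) (a : A) : relt M (eId V a) = 𝟙 _ := by
  rw [relt, ract_id, Iso.inv_hom_id]

end RightAct

section Tensor

open Opposite

variable {V : Type u} [Category.{v} V] [MonoidalCategory V] [SymmetricCategory V]
  [MonoidalClosed V] {A : Type w} [EnrichedCategory V A]

/-- The morphism `M(b) ⊗ A(a,b) ⊗ N(a) ⟶ M(a) ⊗ N(a)` given by the action on `M`. -/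
def tensorFst (M : RightMod V A) (N : LeftMod V A) (a b : A) :
    (M.obj (op b) ⊗ (a ⟶[V] b)) ⊗ N.obj a ⟶ M.obj (op a) ⊗ N.obj a :=
  ract M a b ▷ N.obj a

/-- The morphism `M(b) ⊗ A(a,b) ⊗ N(a) ⟶ M(b) ⊗ N(b)` given by the action on `N`. -/
def tensorSnd (M : RightMod V A) (N : LeftMod V A) (a b : A) :
    (M.obj (op b) ⊗ (a ⟶[V] b)) ⊗ N.obj a ⟶ M.obj (op b) ⊗ N.obj b :=
  (α_ _ _ _).hom ≫ M.obj (op b) ◁ ((β_ _ _).hom ≫ N.act a b)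

/-- The diagram whose colimit is the coend `∫^a M(a) ⊗ N(a)`. -/
def tensorIndex (M : RightMod V A) (N : LeftMod V A) : MultispanIndex (.prod A) V where
  left p := (M.obj (op p.2) ⊗ (p.1 ⟶[V] p.2)) ⊗ N.obj p.1
  right a := M.obj (op a) ⊗ N.obj a
  fst p := tensorFst M N p.1 p.2
  snd p := tensorSnd M N p.1 p.2

lemma cowedge_elt {M : RightMod V A} {N : LeftMod V A} {W : V} {a b : A}
    {k : M.obj (op a) ⊗ N.obj a ⟶ W} {l : M.obj (op b) ⊗ N.obj b ⟶ W}
    (h : tensorFst M N a b ≫ k = tensorSnd M N a b ≫ l) (f : 𝟙_ V ⟶ (a ⟶[V] b)) :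
    relt M f ▷ _ ≫ k = _ ◁ N.elt f ≫ l := by
  rw [tensorFst, tensorSnd] at h
  rw [relt, comp_whiskerRight_assoc, comp_whiskerRight_assoc, h, VFun.elt]
  rw [Category.assoc, associator_naturality_middle_assoc,
    ← MonoidalCategory.whiskerLeft_comp_assoc,
    BraidedCategory.braiding_naturality_left_assoc]
  simp

lemma cowedge_conj {M : RightMod V A} {N : LeftMod V A} {W : V} {a b : A}
    {k : M.obj (op a) ⊗ N.obj a ⟶ W} {l : M.obj (op b) ⊗ N.obj b ⟶ W}
    (h : tensorFst M N a b ≫ k = tensorSnd M N a b ≫ l) {c d : A}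
    {p : 𝟙_ V ⟶ (c ⟶[V] a)} {q : 𝟙_ V ⟶ (a ⟶[V] c)}
    {p' : 𝟙_ V ⟶ (d ⟶[V] b)} {q' : 𝟙_ V ⟶ (b ⟶[V] d)}
    (hpq : p ≫ postcomp c q = eId V c) (hpq' : p' ≫ postcomp d q' = eId V d) :
    tensorFst M N c d ≫ (relt M q ⊗ₘ N.elt p) ≫ k =
      tensorSnd M N c d ≫ (relt M q' ⊗ₘ N.elt p') ≫ l := by
  have e1 : N.act c d ≫ N.elt p' =
      N.elt p ▷ _ ≫ N.obj a ◁ (precomp q d ≫ postcomp a p') ≫ N.act a b := by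
    rw [MonoidalCategory.whiskerLeft_comp_assoc, ← VFun.act_elt, ← reassoc_of% @VFun.elt_act,
      ← comp_whiskerRight_assoc, VFun.elt_comp, hpq, VFun.elt_eId]
    simp
  have e2 : ract M c d ≫ relt M q =
      relt M q' ▷ _ ≫ _ ◁ (precomp q d ≫ postcomp a p') ≫ ract M a b := by
    rw [MonoidalCategory.whiskerLeft_comp_assoc, ← relt_ract, whisker_exchange_assoc,
      ← comp_whiskerRight_assoc, relt_comp, hpq', relt_eId, ract_relt]
    simp
  rw [tensorFst, tensorSnd] at *
  have l1 : ract M c d ▷ N.obj c ≫ (relt M q ⊗ₘ N.elt p) ≫ k =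
      (relt M q' ▷ _) ▷ _ ≫ (_ ◁ (precomp q d ≫ postcomp a p')) ▷ _ ≫ _ ◁ N.elt p ≫
        ract M a b ▷ N.obj a ≫ k := by
    rw [MonoidalCategory.tensorHom_def_assoc, ← comp_whiskerRight_assoc, e2,
      whisker_exchange_assoc]
    simp only [comp_whiskerRight, Category.assoc]
  have l2 : M.obj (op d) ◁ ((β_ _ _).hom ≫ N.act c d) ≫ (relt M q' ⊗ₘ N.elt p') ≫ l =
      relt M q' ▷ _ ≫ _ ◁ ((β_ _ _).hom ≫ N.elt p ▷ _ ≫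
        N.obj a ◁ (precomp q d ≫ postcomp a p') ≫ N.act a b) ≫ l := by
    rw [MonoidalCategory.tensorHom_def_assoc, whisker_exchange_assoc, ← e1]
    simp only [MonoidalCategory.whiskerLeft_comp, Category.assoc]
  rw [l1, h, Category.assoc, Category.assoc, l2, associator_naturality_right_assoc,
    associator_naturality_middle_assoc, associator_naturality_left_assoc]
  simp only [← MonoidalCategory.whiskerLeft_comp_assoc]
  rw [BraidedCategory.braiding_naturality_right_assoc,
    BraidedCategory.braiding_naturality_left_assoc, whisker_exchange_assoc]

instance hasMulticoequalizer_tensorIndex [EssentiallySmall.{v} (ForgetEnrichment V A)]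
    [HasColimits V] (M : RightMod V A) (N : LeftMod V A) :
    HasMulticoequalizer (tensorIndex M N) := by
  obtain ⟨R⟩ := exists_reps V A
  have key : ∀ (W : V) (c : A) (x : M.obj (op c) ⊗ N.obj c ⟶ W)
      (k : M.obj (op (R.s (R.r c))) ⊗ N.obj (R.s (R.r c)) ⟶ W),
      tensorFst M N c (R.s (R.r c)) ≫ x = tensorSnd M N c (R.s (R.r c)) ≫ k →
      (relt M (R.q c) ⊗ₘ N.elt (R.p c)) ≫ k = x := fun W c x k h => by
    rw [MonoidalCategory.tensorHom_def_assoc, ← cowedge_elt h, ← comp_whiskerRight_assoc,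
      relt_comp, R.pq, relt_eId]
    simp
  exact hasMulticoequalizer_of_pull (tensorIndex M N) R.s R.r
    (fun c => relt M (R.q c) ⊗ₘ N.elt (R.p c))
    (fun W k hk c => key W c _ _ (hk c (R.s (R.r c))))
    (fun W k hk a b => cowedge_conj (hk (R.r a) (R.r b)) (R.pq a) (R.pq b))
    (fun W k hk x => key W (R.s x) _ _ (hk x (R.r (R.s x))))

end Tensor

section TensorFunctor

open Opposite

variable {V : Type u} [Category.{v} V] [MonoidalCategory V] [SymmetricCategory V]

lemma swapRight_assoc (X Y Z H : V) :
    swapRight (X ⊗ Y) Z H ≫ swapRight X Y H ▷ Z ≫ (α_ _ _ _).hom =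
      (α_ X Y Z).hom ▷ H ≫ swapRight X (Y ⊗ Z) H := by
  simp only [swapRight, BraidedCategory.braiding_tensor_left_hom]
  monoidal

variable [MonoidalClosed V] {A : Type w} [EnrichedCategory V A]
  [EssentiallySmall.{v} (ForgetEnrichment V A)] [HasColimits V]

/-- The tensor product `M ⊗_A N`, i.e. the coend `∫^a M(a) ⊗ N(a)`. -/
def tensorObj (M : RightMod V A) (N : LeftMod V A) : V := multicoequalizer (tensorIndex M N)

namespace tensorObj

/-- The canonical morphism `M(a) ⊗ N(a) ⟶ M ⊗_A N`. -/
def ι (M : RightMod V A) (N : LeftMod V A) (a : A) :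
    M.obj (op a) ⊗ N.obj a ⟶ tensorObj M N :=
  Multicoequalizer.π (tensorIndex M N) a

lemma condition (M : RightMod V A) (N : LeftMod V A) (a b : A) :
    tensorFst M N a b ≫ ι M N a = tensorSnd M N a b ≫ ι M N b :=
  Multicoequalizer.condition (tensorIndex M N) (a, b)

/-- The universal property of the coend. -/
def desc {M : RightMod V A} {N : LeftMod V A} {W : V} (k : ∀ a, M.obj (op a) ⊗ N.obj a ⟶ W)
    (h : ∀ a b, tensorFst M N a b ≫ k a = tensorSnd M N a b ≫ k b) : tensorObj M N ⟶ W :=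
  Multicoequalizer.desc (tensorIndex M N) W k (fun p => h p.1 p.2)

lemma ι_desc {M : RightMod V A} {N : LeftMod V A} {W : V}
    (k : ∀ a, M.obj (op a) ⊗ N.obj a ⟶ W)
    (h : ∀ a b, tensorFst M N a b ≫ k a = tensorSnd M N a b ≫ k b) (a : A) :
    ι M N a ≫ desc k h = k a :=
  Multicoequalizer.π_desc (tensorIndex M N) _ _ _ a

lemma hom_ext {M : RightMod V A} {N : LeftMod V A} {W : V} {f g : tensorObj M N ⟶ W}
    (h : ∀ a, ι M N a ≫ f = ι M N a ≫ g) : f = g :=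
  Multicoequalizer.hom_ext (tensorIndex M N) _ _ h

/-- The universal property of the coend, tensored with an object. -/
def descRight {M : RightMod V A} {N : LeftMod V A} {H W : V}
    (k : ∀ a, (M.obj (op a) ⊗ N.obj a) ⊗ H ⟶ W)
    (h : ∀ a b, tensorFst M N a b ▷ H ≫ k a = tensorSnd M N a b ▷ H ≫ k b) :
    tensorObj M N ⊗ H ⟶ W :=
  desc (fun a => curryRight (k a))
    (fun a b => by rw [curryRight_comp, curryRight_comp, h]) ▷ H ≫ evRight _ _

lemma ι_descRight {M : RightMod V A} {N : LeftMod V A} {H W : V}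
    (k : ∀ a, (M.obj (op a) ⊗ N.obj a) ⊗ H ⟶ W)
    (h : ∀ a b, tensorFst M N a b ▷ H ≫ k a = tensorSnd M N a b ▷ H ≫ k b) (a : A) :
    ι M N a ▷ H ≫ descRight k h = k a := by
  rw [descRight, ← comp_whiskerRight_assoc, ι_desc, curryRight_evRight]

lemma hom_ext_right {M : RightMod V A} {N : LeftMod V A} {H W : V} {f g : tensorObj M N ⊗ H ⟶ W}
    (h : ∀ a, ι M N a ▷ H ≫ f = ι M N a ▷ H ≫ g) : f = g := by
  rw [← curryRight_evRight f, ← curryRight_evRight g]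
  congr 2
  apply hom_ext
  intro a
  rw [curryRight_comp, curryRight_comp, h]

/-- The morphism `M ⊗_A N ⟶ M ⊗_A N'` induced by `N ⟶ N'`. -/
def map (M : RightMod V A) {N N' : LeftMod V A} (f : N ⟶ N') : tensorObj M N ⟶ tensorObj M N' :=
  desc (fun a => _ ◁ f.app a ≫ ι M N' a) (fun a b => by
    rw [tensorFst, tensorSnd, ← whisker_exchange_assoc, Category.assoc,
      ← MonoidalCategory.whiskerLeft_comp_assoc, Category.assoc, f.nat]
    have := condition M N' a b
    rw [tensorFst, tensorSnd] at this
    rw [this, Category.assoc, associator_naturality_right_assoc,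
      ← MonoidalCategory.whiskerLeft_comp_assoc, BraidedCategory.braiding_naturality_right_assoc])

lemma ι_map (M : RightMod V A) {N N' : LeftMod V A} (f : N ⟶ N') (a : A) :
    ι M N a ≫ map M f = _ ◁ f.app a ≫ ι M N' a :=
  ι_desc _ _ a

variable [HasLimits V]

open homObj in
lemma act_aux (M M' : RightMod V A) (N : LeftMod V A) (a b : A) :
    tensorFst M N a b ▷ homObj M M' ≫ swapRight _ _ _ ≫ ev M M' (op a) ▷ _ ≫ ι M' N a =
      tensorSnd M N a b ▷ homObj M M' ≫ swapRight _ _ _ ≫ ev M M' (op b) ▷ _ ≫ ι M' N b := by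
  have h1 : ract M a b ▷ _ ≫ ev M M' (op a) = swapRight _ _ _ ≫ ev M M' (op b) ▷ _ ≫
      ract M' a b := ev_graded M M' (op b) (op a)
  have h2 := condition M' N a b
  rw [tensorFst, tensorSnd] at h2 ⊢
  rw [reassoc_of% @swapRight_naturality_left, ← comp_whiskerRight_assoc, h1, comp_whiskerRight,
    comp_whiskerRight, Category.assoc, Category.assoc, h2, Category.assoc,
    associator_naturality_left_assoc, reassoc_of% @swapRight_assoc, ← whisker_exchange_assoc,
    ← reassoc_of% @swapRight_naturality_middle, comp_whiskerRight_assoc]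

/-- The action `(M ⊗_A N) ⊗ [M, M'] ⟶ M' ⊗_A N`. -/
def act (M M' : RightMod V A) (N : LeftMod V A) :
    tensorObj M N ⊗ homObj M M' ⟶ tensorObj M' N :=
  descRight (fun a => swapRight _ _ _ ≫ homObj.ev M M' (op a) ▷ _ ≫ ι M' N a) (act_aux M M' N)

lemma ι_act (M M' : RightMod V A) (N : LeftMod V A) (a : A) :
    ι M N a ▷ _ ≫ act M M' N = swapRight _ _ _ ≫ homObj.ev M M' (op a) ▷ _ ≫ ι M' N a :=
  ι_descRight _ _ a

lemma act_id (M : RightMod V A) (N : LeftMod V A) :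
    tensorObj M N ◁ homObj.one M ≫ act M M N = (ρ_ _).hom :=
  hom_ext_right (fun a => by
    rw [← whisker_exchange_assoc, ι_act, reassoc_of% @swapRight_naturality_right,
      ← comp_whiskerRight_assoc, homObj.one_ev, reassoc_of% @swapRight_unit_right,
      rightUnitor_naturality])

lemma act_comp (M M' M'' : RightMod V A) (N : LeftMod V A) :
    tensorObj M N ◁ homObj.comp M M' M'' ≫ act M M'' N =
      (α_ _ _ _).inv ≫ act M M' N ▷ _ ≫ act M' M'' N :=
  hom_ext_right (fun a => by
    rw [← whisker_exchange_assoc, ι_act, reassoc_of% @swapRight_naturality_right,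
      ← comp_whiskerRight_assoc, homObj.comp_ev, associator_inv_naturality_left_assoc,
      ← comp_whiskerRight_assoc, ι_act]
    simp only [comp_whiskerRight, Category.assoc]
    rw [ι_act, reassoc_of% @swapRight_naturality_left, reassoc_of% @swapRight_tensor])

end tensorObj

variable [HasLimits V]

/-- The `V`-functor `- ⊗_A N` from right `A`-modules to `V`. -/
def tensorVFun (N : LeftMod V A) : VFun V (RightMod V A) :=
  VFun.ofAct (fun M => tensorObj M N) (fun M M' => tensorObj.act M M' N)
    (fun M => tensorObj.act_id M N) (fun M M' M'' => tensorObj.act_comp M M' M'' N)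

lemma tensorVFun_act (N : LeftMod V A) (M M' : RightMod V A) :
    (tensorVFun N).act M M' = tensorObj.act M M' N :=
  VFun.ofAct_act _ _ _ _ M M'

lemma tensorVFunMap_aux {N N' : LeftMod V A} (f : N ⟶ N') (M M' : RightMod V A) :
    tensorObj.act M M' N ≫ tensorObj.map M' f =
      tensorObj.map M f ▷ _ ≫ tensorObj.act M M' N' :=
  tensorObj.hom_ext_right (fun a => by
    rw [reassoc_of% @tensorObj.ι_act, tensorObj.ι_map, ← comp_whiskerRight_assoc, tensorObj.ι_map,
      comp_whiskerRight_assoc, tensorObj.ι_act, reassoc_of% @swapRight_naturality_middle,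
      whisker_exchange_assoc])

/-- The functor `N ↦ - ⊗_A N` to `V`-functors on all right `A`-modules. -/
def tensorVFunctor : LeftMod V A ⥤ VFun V (RightMod V A) where
  obj N := tensorVFun N
  map f :=
    { app := fun M => tensorObj.map M f
      naturality := fun M M' => (congrArg (· ≫ _) (tensorVFun_act _ M M')).trans
        ((tensorVFunMap_aux f M M').trans (congrArg (_ ≫ ·) (tensorVFun_act _ M M').symm)) }
  map_id N := VFun.hom_ext (fun M => tensorObj.hom_ext (fun a =>
    (tensorObj.ι_map M (𝟙 N) a).trans (by
      refine (congrArg (· ≫ _) (MonoidalCategory.whiskerLeft_id _ _)).trans ?_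
      exact (Category.id_comp _).trans (Category.comp_id _).symm)))
  map_comp f g := VFun.hom_ext (fun M => tensorObj.hom_ext (fun a =>
    (tensorObj.ι_map M (f ≫ g) a).trans (by
      refine Eq.trans ?_ ((reassoc_of% (tensorObj.ι_map M f a)) _).symm
      rw [VFun.comp_app, MonoidalCategory.whiskerLeft_comp_assoc]
      exact congrArg (_ ≫ ·) (tensorObj.ι_map M g a).symm)))

/-- The functor `A Mod ⥤ [mod A, V]`, `N ↦ - ⊗_A N`. -/
def tensorFunctor : LeftMod V A ⥤ GenMod V A :=
  tensorVFunctor ⋙ restriction (inducedIncl V Subtype.val)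

end TensorFunctor

section YonedaFp

open Opposite

variable {V : Type u} [Category.{v} V] [MonoidalCategory V] [SymmetricCategory V]

lemma braiding_swapRight (X Y W : V) :
    (β_ X Y).hom ▷ W = swapRight X Y W ≫ (β_ (X ⊗ W) Y).hom ≫ (α_ Y X W).inv := by
  simp only [swapRight, BraidedCategory.braiding_tensor_left_hom, Category.assoc]
  rw [Iso.inv_hom_id_assoc, ← MonoidalCategory.whiskerLeft_comp_assoc,
    SymmetricCategory.symmetry]
  simp

lemma tensorHom_act_aux {X P P' Q Q' Y Z : V} (f : P ⟶ P') (g : Q ⟶ Q') (x : X ⊗ P' ⟶ Y)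
    (y : Y ⊗ Q' ⟶ Z) : X ◁ (f ⊗ₘ g) ≫ (α_ _ _ _).inv ≫ x ▷ Q' ≫ y =
      (α_ _ _ _).inv ≫ (X ◁ f ≫ x) ▷ Q ≫ Y ◁ g ≫ y := by
  rw [MonoidalCategory.tensorHom_def, MonoidalCategory.whiskerLeft_comp, Category.assoc,
    associator_inv_naturality_right_assoc, associator_inv_naturality_middle_assoc,
    whisker_exchange_assoc, comp_whiskerRight, Category.assoc]

variable [MonoidalClosed V] {A : Type w} [EnrichedCategory V A]

/-- The right `A`-module `A(-,a)` represented by `a`. -/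
abbrev rep (a : A) : RightMod V A := corep (op a)

lemma repMap_aux (a b c d : A) :
    ((β_ _ _).hom ≫ eComp V d c a) ▷ (a ⟶[V] b) ≫ eComp V d a b =
      swapRight _ _ _ ≫ eComp V c a b ▷ _ ≫ (β_ _ _).hom ≫ eComp V d c b := by
  rw [comp_whiskerRight_assoc, ← e_assoc' V d c a b, reassoc_of% @braiding_swapRight,
    BraidedCategory.braiding_naturality_left_assoc]
  simp

lemma repMap_graded (a b : A) (c d : Aᵒᵖ) :
    IsGraded (rep (V := V) a) (rep b) (W := a ⟶[V] b)
      (eComp V c.unop a b) (eComp V d.unop a b) := by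
  unfold IsGraded
  rw [corep_act, corep_act]
  exact repMap_aux a b c.unop d.unop

variable [EssentiallySmall.{v} (ForgetEnrichment V A)] [HasLimits V]

/-- The morphism `A(a,b) ⟶ [A(-,a), A(-,b)]` given by composition. -/
def repMap (a b : A) : (a ⟶[V] b) ⟶ homObj (rep (V := V) a) (rep b) :=
  homObj.lift (fun c => eComp V c.unop a b) (repMap_graded a b)

lemma repMap_ev (a b : A) (c : Aᵒᵖ) :
    (c.unop ⟶[V] a) ◁ repMap (V := V) a b ≫ homObj.ev (rep a) (rep b) c = eComp V c.unop a b :=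
  homObj.lift_ev (F := rep a) (G := rep b) _ (repMap_graded a b) c

lemma repMap_id (a : A) : eId V a ≫ repMap a a = homObj.one (rep a) :=
  homObj.hom_ext (fun c => by
    refine Eq.trans ?_ (homObj.one_ev _ _).symm
    rw [MonoidalCategory.whiskerLeft_comp, Category.assoc]
    refine (congrArg (_ ≫ ·) (repMap_ev a a c)).trans ?_
    exact eComp_eId (V := V) c.unop a)

lemma repMap_comp (a b c : A) : eComp V a b c ≫ repMap a c =
    (repMap a b ⊗ₘ repMap b c) ≫ homObj.comp (rep a) (rep b) (rep c) :=
  homObj.hom_ext (fun x => by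
    have h : (x.unop ⟶[V] a) ◁ (repMap (V := V) a b ⊗ₘ repMap b c) ≫ (α_ _ _ _).inv ≫
        homObj.ev (rep a) (rep b) x ▷ _ ≫ homObj.ev (rep b) (rep c) x =
        (α_ _ _ _).inv ≫ eComp V x.unop a b ▷ _ ≫ eComp V x.unop b c := by
      rw [← repMap_ev a b x, ← repMap_ev b c x]
      exact tensorHom_act_aux _ _ _ _
    rw [MonoidalCategory.whiskerLeft_comp, Category.assoc, MonoidalCategory.whiskerLeft_comp,
      Category.assoc, homObj.comp_ev]
    refine (congrArg (_ ≫ ·) (repMap_ev a c x)).trans (Eq.trans ?_ h.symm)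
    exact (e_assoc V x.unop a b c).symm)

variable (V A) in
/-- The `V`-functor `A ⟶ mod A`, `a ↦ A(-,a)`. -/
def yonedaFp [IsFinitelyPresentable.{v} (𝟙_ V)] : EnrichedFunctor V A (FpMod V A) where
  obj a := (⟨rep a, corep_fp _⟩ : {M : RightMod V A // IsFinitelyPresentable.{v} M})
  map a b := repMap a b
  map_id a := repMap_id a
  map_comp a b c := repMap_comp a b c

end YonedaFp

section Copower

variable {V : Type u} [Category.{v} V] [MonoidalCategory V] [SymmetricCategory V]
  [MonoidalClosed V] {C : Type w} [EnrichedCategory V C]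

lemma copower_id_aux (Y : VFun V C) (W : V) (a : C) :
    (Y.obj a ⊗ W) ◁ eId V a ≫ swapRight _ _ _ ≫ Y.act a a ▷ W = (ρ_ _).hom := by
  rw [reassoc_of% @swapRight_naturality_right, ← comp_whiskerRight, VFun.act_id, swapRight_unit_right]

lemma copower_comp_aux (Y : VFun V C) (W : V) (a b c : C) :
    (Y.obj a ⊗ W) ◁ eComp V a b c ≫ swapRight _ _ _ ≫ Y.act a c ▷ W =
      (α_ _ _ _).inv ≫ (swapRight _ _ _ ≫ Y.act a b ▷ W) ▷ _ ≫ swapRight _ _ _ ≫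
        Y.act b c ▷ W := by
  rw [reassoc_of% @swapRight_naturality_right, ← comp_whiskerRight, VFun.act_comp]
  simp only [comp_whiskerRight, Category.assoc]
  rw [reassoc_of% @swapRight_naturality_left, reassoc_of% @swapRight_tensor]

/-- The `V`-functor `Y ⊘ W : c ↦ Y(c) ⊗ W`. -/
def VFun.copower (Y : VFun V C) (W : V) : VFun V C :=
  VFun.ofAct (fun c => Y.obj c ⊗ W) (fun a b => swapRight _ _ _ ≫ Y.act a b ▷ W)
    (copower_id_aux Y W) (copower_comp_aux Y W)

end Copower

section KanExtension

variable {V : Type u} [Category.{v} V] [MonoidalCategory V] [MonoidalClosed V]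
  {B : Type w} [EnrichedCategory V B] {C : Type w'} [EnrichedCategory V C]

/-- `H : C ⟶ V` together with `ε : H ∘ K ⟶ G` is the (pointwise) enriched right Kan extension
of `G : B ⟶ V` along `K : B ⟶ C`: for every `c`, the morphisms
`H(c) ⊗ C(c,K(b)) ⟶ H(K(b)) ⟶ G(b)` exhibit `H(c)` as the end `∫_b [C(c,K(b)), G(b)]`. -/
def IsEnrichedRan (K : EnrichedFunctor V B C) (G : VFun V B) (H : VFun V C)
    (ε : (restriction K).obj H ⟶ G) : Prop :=
  ∀ (c : C) (W : V) (φ : ∀ b, W ⊗ (c ⟶[V] K.obj b) ⟶ G.obj b),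
    (∀ b b', (α_ _ _ _).hom ≫ W ◁ ((c ⟶[V] K.obj b) ◁ K.map b b' ≫ eComp V _ _ _) ≫ φ b' =
      φ b ▷ (b ⟶[V] b') ≫ G.act b b') →
    ∃! x : W ⟶ H.obj c, ∀ b, x ▷ (c ⟶[V] K.obj b) ≫ H.act c (K.obj b) ≫ ε.app b = φ b

end KanExtension

section Recollement

/-- A recollement of `C` by `S` and `Q`: adjunctions `iL ⊣ i ⊣ iR` and `rL ⊣ r ⊣ rR`, where
`i`, `rL`, `rR` are fully faithful and the essential image of `i` is the kernel of `r`. -/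
structure Recollement {S : Type*} [Category* S] {C : Type*} [Category* C] {Q : Type*}
    [Category* Q] (iL : C ⥤ S) (i : S ⥤ C) (iR : C ⥤ S) (rL : Q ⥤ C) (r : C ⥤ Q)
    (rR : Q ⥤ C) where
  /-- `iL` is left adjoint to `i` -/
  adjIL : iL ⊣ i
  /-- `iR` is right adjoint to `i` -/
  adjIR : i ⊣ iR
  /-- `rL` is left adjoint to `r` -/
  adjRL : rL ⊣ r
  /-- `rR` is right adjoint to `r` -/
  adjRR : r ⊣ rR
  full_i : i.Full
  faithful_i : i.Faithful
  full_rL : rL.Full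
  faithful_rL : rL.Faithful
  full_rR : rR.Full
  faithful_rR : rR.Faithful
  essImage_iff : ∀ X : C, i.essImage X ↔ IsZero (r.obj X)

variable {C : Type w} [Category.{w'} C] (P : ObjectProperty C)

/-- A right adjoint `R` of the inclusion of the full subcategory `P` is its torsion functor:
the counit identifies `R(X)` with the greatest subobject of `X` belonging to `P`. -/
def IsTorsionFunctor {R : C ⥤ P.FullSubcategory} (adj : P.ι ⊣ R) : Prop :=
  ∀ X : C, Mono (adj.counit.app X) ∧
    ∀ (Y : C) (f : Y ⟶ X), P Y → Mono f → ∃ g : Y ⟶ P.ι.obj (R.obj X), g ≫ adj.counit.app X = f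

variable {P}

lemma torsion_additive [Abelian C] {R : C ⥤ P.FullSubcategory} (adj : P.ι ⊣ R) :
    (R ⋙ P.ι).Additive :=
  have : R.Additive := adj.right_adjoint_additive
  inferInstance

/-- The objects `X` with `t(X) = t¹(X) = 0`, where `t : C ⥤ C` is the composition of the right
adjoint `R` of the inclusion of `P` with this inclusion, and `t¹` is the first right derived
functor of `t`. -/
def closedObjects [Abelian C] [EnoughInjectives C] {R : C ⥤ P.FullSubcategory}
    (adj : P.ι ⊣ R) : ObjectProperty C := fun X =>
  haveI := torsion_additive adj
  IsZero ((R ⋙ P.ι).obj X) ∧ IsZero (((R ⋙ P.ι).rightDerived 1).obj X)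

/-- A Serre subcategory of a Grothendieck category is localizing if it is closed under direct
limits. -/
def IsLocalizing [Abelian C] [IsGrothendieckAbelian.{v} C] (P : ObjectProperty C) : Prop :=
  P.IsSerreClass ∧
    ∀ (J : Type v) [SmallCategory J] [IsFiltered J], P.IsClosedUnderColimitsOfShape J

end Recollement

section Main

variable (V : Type u) [Category.{v} V] [MonoidalCategory V] [SymmetricCategory V]
  [MonoidalClosed V] (A : Type w) [EnrichedCategory V A]
  [EssentiallySmall.{v} (ForgetEnrichment V A)] [HasLimits V] [IsFinitelyPresentable.{v} (𝟙_ V)]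

/-- The full subcategory of `[mod A, V]` of the `V`-functors `Y` such that `Y(a) = 0` for all
`a ∈ A`, where `a` is identified with the right `A`-module `A(-,a)`. -/
def vanishing : ObjectProperty (GenMod V A) := fun Y =>
  ∀ a : A, IsZero (Y.obj ((yonedaFp V A).obj a))

/-- The restriction functor `[mod A, V] ⥤ A Mod`. -/
abbrev restrictionToA : GenMod V A ⥤ LeftMod V A := restriction (yonedaFp V A)

end Main

end

end EnrichedRingoid

open EnrichedRingoid

namespace EnrichedRingoid

noncomputable section

universe v₁ u₁

namespace VFun

section Limits

variable {V : Type u} [Category.{v} V] [MonoidalCategory V] [MonoidalClosed V]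
  {C : Type w} [EnrichedCategory V C]

/-- A `V`-natural transformation with invertible components is invertible. -/
lemma isIso_of_isIso_app {F G : VFun V C} (f : F ⟶ G) (h : ∀ c, IsIso (f.app c)) : IsIso f :=
  ⟨{ app := fun c => inv (f.app c)
     naturality := fun a b => by
      rw [← cancel_mono (f.app b), Category.assoc, Category.assoc, IsIso.inv_hom_id,
        Category.comp_id, f.nat, ← comp_whiskerRight_assoc, IsIso.inv_hom_id]
      simp },
   VFun.hom_ext (fun c => IsIso.hom_inv_id (f.app c)),
   VFun.hom_ext (fun c => IsIso.inv_hom_id (f.app c))⟩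

variable {J : Type u₁} [Category.{v₁} J] {F : J ⥤ VFun V C}

/-- The components of the projections of a cone over a diagram of `V`-functors. -/
def coneπ (s : Cone F) (j : J) (c : C) : s.pt.obj c ⟶ (F.obj j).obj c := (s.π.app j).app c

lemma coneπ_nat (s : Cone F) (j : J) (a b : C) :
    s.pt.act a b ≫ coneπ s j b = coneπ s j a ▷ _ ≫ (F.obj j).act a b := (s.π.app j).nat a b

section

variable {s : Cone F} (h : ∀ c, IsLimit ((evaluation c).mapCone s)) (t : Cone F)

/-- The components of the morphism to a pointwise limit. -/
def pointwiseLift (c : C) : t.pt.obj c ⟶ s.pt.obj c := (h c).lift ((evaluation c).mapCone t)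

lemma pointwiseLift_π (c : C) (j : J) : pointwiseLift h t c ≫ coneπ s j c = coneπ t j c :=
  (h c).fac ((evaluation c).mapCone t) j

include h in
lemma pointwise_hom_ext {c : C} {W : V} {f g : W ⟶ s.pt.obj c}
    (hfg : ∀ j, f ≫ coneπ s j c = g ≫ coneπ s j c) : f = g :=
  (h c).hom_ext hfg

/-- A cone which is a pointwise limit is a limit. -/
def isLimitOfEvaluation : IsLimit s where
  lift t :=
    { app := pointwiseLift h t
      naturality := fun a b => pointwise_hom_ext h (fun j => by
        rw [Category.assoc, Category.assoc, pointwiseLift_π, coneπ_nat, coneπ_nat,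
          ← comp_whiskerRight_assoc, pointwiseLift_π]) }
  fac t j := VFun.hom_ext (fun c => pointwiseLift_π h t c j)
  uniq t m hm := VFun.hom_ext (fun c => (h c).uniq ((evaluation c).mapCone t) (m.app c)
    (fun j => congrArg (fun f => Hom.app f c) (hm j)))

end

variable (F)

section

variable [∀ c : C, HasLimit (F ⋙ evaluation c)]

/-- The pointwise limit of a diagram of `V`-functors. -/
def limitObj (c : C) : V := limit (F ⋙ evaluation c)

/-- The projections from the pointwise limit. -/
def limitObjπ (j : J) (c : C) : limitObj F c ⟶ (F.obj j).obj c := limit.π (F ⋙ evaluation c) j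

lemma limitObj_w {i j : J} (f : i ⟶ j) (c : C) :
    limitObjπ F i c ≫ (F.map f).app c = limitObjπ F j c := limit.w (F ⋙ evaluation c) f

variable {F} in
lemma limitObj_hom_ext {c : C} {W : V} {f g : W ⟶ limitObj F c}
    (h : ∀ j, f ≫ limitObjπ F j c = g ≫ limitObjπ F j c) : f = g :=
  limit.hom_ext h

/-- The universal property of the pointwise limit. -/
def limitObjLift {c : C} {W : V} (k : ∀ j, W ⟶ (F.obj j).obj c)
    (hk : ∀ (i j : J) (f : i ⟶ j), k i ≫ (F.map f).app c = k j) : W ⟶ limitObj F c :=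
  limit.lift (F ⋙ evaluation c)
    { pt := W
      π :=
        { app := k
          naturality := fun i j f => (Category.id_comp _).trans (hk i j f).symm } }

lemma limitObjLift_π {c : C} {W : V} (k : ∀ j, W ⟶ (F.obj j).obj c)
    (hk : ∀ (i j : J) (f : i ⟶ j), k i ≫ (F.map f).app c = k j) (j : J) :
    limitObjLift F k hk ≫ limitObjπ F j c = k j :=
  limit.lift_π _ j

/-- The action on a pointwise limit of `V`-functors. -/
def limitAct (a b : C) : limitObj F a ⊗ (a ⟶[V] b) ⟶ limitObj F b :=
  limitObjLift F (fun j => limitObjπ F j a ▷ _ ≫ (F.obj j).act a b) (fun _ _ f => by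
    rw [Category.assoc, (F.map f).nat, ← comp_whiskerRight_assoc, limitObj_w])

lemma limitAct_π (a b : C) (j : J) : limitAct F a b ≫ limitObjπ F j b =
    limitObjπ F j a ▷ _ ≫ (F.obj j).act a b :=
  limitObjLift_π F _ _ j

/-- The pointwise limit of a diagram of `V`-functors. -/
def limitVFun : VFun V C :=
  ofAct (limitObj F) (limitAct F)
    (fun a => limitObj_hom_ext (fun j => by
      rw [Category.assoc, limitAct_π, whisker_exchange_assoc, act_id, rightUnitor_naturality]))
    (fun a b c => limitObj_hom_ext (fun j => by
      rw [Category.assoc, limitAct_π, whisker_exchange_assoc, act_comp,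
        Category.assoc, Category.assoc, limitAct_π, ← comp_whiskerRight_assoc, limitAct_π,
        comp_whiskerRight_assoc, associator_inv_naturality_left_assoc]))

lemma limitVFun_act (a b : C) : (limitVFun F).act a b = limitAct F a b := ofAct_act _ _ _ _ a b

/-- The pointwise limit cone of a diagram of `V`-functors. -/
def limitCone : Cone F where
  pt := limitVFun F
  π :=
    { app := fun j =>
        { app := fun c => limitObjπ F j c
          naturality := fun a b =>
            (congrArg (· ≫ _) (limitVFun_act F a b)).trans (limitAct_π F a b j) }
      naturality := fun _ _ f => VFun.hom_ext (fun c =>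
        (Category.id_comp _).trans (limitObj_w F f c).symm) }

/-- The cone `limitCone F` is a pointwise limit. -/
def evaluationMapLimitCone (c : C) : IsLimit ((evaluation c).mapCone (limitCone F)) :=
  limit.isLimit (F ⋙ evaluation c)

/-- The cone `limitCone F` is a limit. -/
def isLimitLimitCone : IsLimit (limitCone F) :=
  isLimitOfEvaluation (evaluationMapLimitCone F)

end

instance hasLimitsOfShape [HasLimitsOfShape J V] : HasLimitsOfShape J (VFun V C) :=
  ⟨fun F => ⟨⟨⟨_, isLimitLimitCone F⟩⟩⟩⟩

instance evaluation_preservesLimitsOfShape [HasLimitsOfShape J V] (c : C) :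
    PreservesLimitsOfShape J (evaluation (V := V) c) :=
  ⟨fun {F} => preservesLimit_of_preserves_limit_cone (isLimitLimitCone F)
    (evaluationMapLimitCone F c)⟩

end Limits

section Colimits

variable {V : Type u} [Category.{v} V] [MonoidalCategory V] [SymmetricCategory V]
  [MonoidalClosed V] {C : Type w} [EnrichedCategory V C]
  {J : Type u₁} [Category.{v₁} J] {F : J ⥤ VFun V C}

instance tensorLeft_isLeftAdjoint (X : V) : (tensorLeft X).IsLeftAdjoint :=
  (ihom.adjunction X).isLeftAdjoint

instance tensorRight_isLeftAdjoint (X : V) : (tensorRight X).IsLeftAdjoint :=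
  Functor.isLeftAdjoint_of_iso (BraidedCategory.tensorLeftIsoTensorRight X)

/-- The components of the coprojections of a cocone over a diagram of `V`-functors. -/
def coconeι (s : Cocone F) (j : J) (c : C) : (F.obj j).obj c ⟶ s.pt.obj c := (s.ι.app j).app c

lemma coconeι_nat (s : Cocone F) (j : J) (a b : C) :
    (F.obj j).act a b ≫ coconeι s j b = coconeι s j a ▷ _ ≫ s.pt.act a b := (s.ι.app j).nat a b

section

variable {s : Cocone F} (h : ∀ c, IsColimit ((evaluation c).mapCocone s)) (t : Cocone F)

/-- The components of the morphism from a pointwise colimit. -/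
def pointwiseDesc (c : C) : s.pt.obj c ⟶ t.pt.obj c := (h c).desc ((evaluation c).mapCocone t)

lemma ι_pointwiseDesc (c : C) (j : J) : coconeι s j c ≫ pointwiseDesc h t c = coconeι t j c :=
  (h c).fac ((evaluation c).mapCocone t) j

include h in
lemma pointwise_hom_ext_whiskerRight {c : C} {X W : V} {f g : s.pt.obj c ⊗ X ⟶ W}
    (hfg : ∀ j, coconeι s j c ▷ X ≫ f = coconeι s j c ▷ X ≫ g) : f = g :=
  (isColimitOfPreserves (tensorRight X) (h c)).hom_ext hfg

/-- A cocone which is a pointwise colimit is a colimit. -/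
def isColimitOfEvaluation : IsColimit s where
  desc t :=
    { app := pointwiseDesc h t
      naturality := fun a b => pointwise_hom_ext_whiskerRight h (fun j => by
        rw [← reassoc_of% coconeι_nat, ι_pointwiseDesc, ← comp_whiskerRight_assoc,
          ι_pointwiseDesc, coconeι_nat]) }
  fac t j := VFun.hom_ext (fun c => ι_pointwiseDesc h t c j)
  uniq t m hm := VFun.hom_ext (fun c => (h c).uniq ((evaluation c).mapCocone t) (m.app c)
    (fun j => congrArg (fun f => Hom.app f c) (hm j)))

end

variable (F)

section

variable [∀ c : C, HasColimit (F ⋙ evaluation c)]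

/-- The pointwise colimit of a diagram of `V`-functors. -/
def colimitObj (c : C) : V := colimit (F ⋙ evaluation c)

/-- The coprojections to the pointwise colimit. -/
def colimitObjι (j : J) (c : C) : (F.obj j).obj c ⟶ colimitObj F c :=
  colimit.ι (F ⋙ evaluation c) j

lemma colimitObj_w {i j : J} (f : i ⟶ j) (c : C) :
    (F.map f).app c ≫ colimitObjι F j c = colimitObjι F i c := colimit.w (F ⋙ evaluation c) f

variable {F} in
lemma colimitObj_hom_ext {c : C} {X W : V} {f g : colimitObj F c ⊗ X ⟶ W}
    (h : ∀ j, colimitObjι F j c ▷ X ≫ f = colimitObjι F j c ▷ X ≫ g) : f = g :=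
  (isColimitOfPreserves (tensorRight X) (colimit.isColimit (F ⋙ evaluation c))).hom_ext h

/-- The universal property of the pointwise colimit, tensored with an object. -/
def colimitObjDesc {c : C} {X W : V} (k : ∀ j, (F.obj j).obj c ⊗ X ⟶ W)
    (hk : ∀ (i j : J) (f : i ⟶ j), (F.map f).app c ▷ X ≫ k j = k i) : colimitObj F c ⊗ X ⟶ W :=
  (isColimitOfPreserves (tensorRight X) (colimit.isColimit (F ⋙ evaluation c))).desc
    { pt := W
      ι :=
        { app := k
          naturality := fun i j f => (hk i j f).trans (Category.comp_id _).symm } }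

lemma ι_colimitObjDesc {c : C} {X W : V} (k : ∀ j, (F.obj j).obj c ⊗ X ⟶ W)
    (hk : ∀ (i j : J) (f : i ⟶ j), (F.map f).app c ▷ X ≫ k j = k i) (j : J) :
    colimitObjι F j c ▷ X ≫ colimitObjDesc F k hk = k j :=
  (isColimitOfPreserves (tensorRight X) (colimit.isColimit (F ⋙ evaluation c))).fac _ j

/-- The action on a pointwise colimit of `V`-functors. -/
def colimitAct (a b : C) : colimitObj F a ⊗ (a ⟶[V] b) ⟶ colimitObj F b :=
  colimitObjDesc F (fun j => (F.obj j).act a b ≫ colimitObjι F j b) (fun _ _ f => by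
    rw [← reassoc_of% (F.map f).nat a b, colimitObj_w])

lemma ι_colimitAct (a b : C) (j : J) : colimitObjι F j a ▷ _ ≫ colimitAct F a b =
    (F.obj j).act a b ≫ colimitObjι F j b :=
  ι_colimitObjDesc F _ _ j

/-- The pointwise colimit of a diagram of `V`-functors. -/
def colimitVFun : VFun V C :=
  ofAct (colimitObj F) (colimitAct F)
    (fun a => colimitObj_hom_ext (fun j => by
      rw [← whisker_exchange_assoc, ι_colimitAct, reassoc_of% @act_id, rightUnitor_naturality]))
    (fun a b c => colimitObj_hom_ext (fun j => by
      rw [← whisker_exchange_assoc, ι_colimitAct, associator_inv_naturality_left_assoc,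
        ← comp_whiskerRight_assoc, ι_colimitAct, comp_whiskerRight_assoc, ι_colimitAct,
        reassoc_of% @act_comp]))

lemma colimitVFun_act (a b : C) : (colimitVFun F).act a b = colimitAct F a b :=
  ofAct_act _ _ _ _ a b

/-- The pointwise colimit cocone of a diagram of `V`-functors. -/
def colimitCocone : Cocone F where
  pt := colimitVFun F
  ι :=
    { app := fun j =>
        { app := fun c => colimitObjι F j c
          naturality := fun a b => (ι_colimitAct F a b j).symm.trans
            (congrArg (_ ≫ ·) (colimitVFun_act F a b).symm) }
      naturality := fun _ _ f => VFun.hom_ext (fun c =>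
        (colimitObj_w F f c).trans (Category.comp_id _).symm) }

/-- The cocone `colimitCocone F` is a pointwise colimit. -/
def evaluationMapColimitCocone (c : C) :
    IsColimit ((evaluation c).mapCocone (colimitCocone F)) :=
  colimit.isColimit (F ⋙ evaluation c)

/-- The cocone `colimitCocone F` is a colimit. -/
def isColimitColimitCocone : IsColimit (colimitCocone F) :=
  isColimitOfEvaluation (evaluationMapColimitCocone F)

end

instance hasColimitsOfShape [HasColimitsOfShape J V] : HasColimitsOfShape J (VFun V C) :=
  ⟨fun F => ⟨⟨⟨_, isColimitColimitCocone F⟩⟩⟩⟩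

end Colimits

end VFun

end

end EnrichedRingoid

namespace EnrichedRingoid

noncomputable section

universe v₁ u₁

namespace VFun

section Free

variable {V : Type u} [Category.{v} V] [MonoidalCategory V] [SymmetricCategory V]
  [MonoidalClosed V] {C : Type w} [EnrichedCategory V C]

lemma copower_corep_act (a : C) (W : V) (x y : C) :
    ((corep (V := V) a).copower W).act x y = swapRight _ _ _ ≫ eComp V a x y ▷ W :=
  (ofAct_act _ _ _ _ x y).trans (congrArg (fun f => swapRight _ _ _ ≫ f ▷ W) (corep_act a x y))

lemma freeDesc_aux {a : C} {W : V} {F : VFun V C} (h : W ⟶ F.obj a) (x y : C) :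
    (swapRight _ _ _ ≫ eComp V a x y ▷ W) ≫ (β_ _ _).hom ≫ h ▷ _ ≫ F.act a y =
      ((β_ _ _).hom ≫ h ▷ _ ≫ F.act a x) ▷ _ ≫ F.act x y := by
  rw [Category.assoc, BraidedCategory.braiding_naturality_left_assoc, whisker_exchange_assoc,
    act_comp]
  simp only [comp_whiskerRight, Category.assoc]
  rw [reassoc_of% @braiding_swapRight, associator_inv_naturality_left_assoc]

/-- The `V`-natural transformation `C(a,-) ⊗ W ⟶ F` corresponding to `W ⟶ F(a)`. -/
def freeDesc {a : C} {W : V} {F : VFun V C} (h : W ⟶ F.obj a) : (corep a).copower W ⟶ F where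
  app x := (β_ (a ⟶[V] x) W).hom ≫ h ▷ _ ≫ F.act a x
  naturality x y := (congrArg (· ≫ _) (copower_corep_act a W x y)).trans (freeDesc_aux h x y)

/-- The morphism `W ⟶ C(a,a) ⊗ W` given by the identity of `a`. -/
def freeUnit (a : C) (W : V) : W ⟶ (a ⟶[V] a) ⊗ W := (λ_ W).inv ≫ eId V a ▷ W

lemma freeUnit_swapRight (a : C) (W X : V) : freeUnit a W ▷ X ≫ swapRight _ _ _ =
    (β_ W X).hom ≫ ((λ_ X).inv ≫ eId V a ▷ X) ▷ W := by
  have e : eId V a ▷ (W ⊗ X) ≫ (a ⟶[V] a) ◁ (β_ W X).hom =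
    𝟙_ V ◁ (β_ W X).hom ≫ eId V a ▷ _ := (whisker_exchange _ _).symm
  rw [freeUnit, swapRight, comp_whiskerRight_assoc, associator_naturality_left_assoc,
    reassoc_of% e, associator_inv_naturality_left, leftUnitor_inv_whiskerRight, Category.assoc,
    Iso.inv_hom_id_assoc, ← leftUnitor_inv_naturality_assoc]
  simp

lemma freeUnit_desc {a : C} {W : V} {F : VFun V C} (h : W ⟶ F.obj a) :
    freeUnit a W ≫ (β_ (a ⟶[V] a) W).hom ≫ h ▷ _ ≫ F.act a a = h := by
  rw [freeUnit, Category.assoc, BraidedCategory.braiding_naturality_left_assoc,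
    whisker_exchange_assoc, act_id]
  simp

lemma freeDesc_unit_aux {a : C} {W : V} {F : VFun V C} (f : ∀ x, (a ⟶[V] x) ⊗ W ⟶ F.obj x)
    (hf : ∀ x y, (swapRight _ _ _ ≫ eComp V a x y ▷ W) ≫ f y = f x ▷ _ ≫ F.act x y) (x : C) :
    (β_ (a ⟶[V] x) W).hom ≫ (freeUnit a W ≫ f a) ▷ _ ≫ F.act a x = f x := by
  rw [comp_whiskerRight_assoc, ← hf, Category.assoc, reassoc_of% freeUnit_swapRight,
    SymmetricCategory.symmetry_assoc, ← comp_whiskerRight_assoc, Category.assoc, eId_eComp]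
  simp

/-- The `V`-functor `C(a,-) ⊗ W` represents `F ↦ Hom(W, F(a))`. -/
def freeEquiv (a : C) (W : V) (F : VFun V C) :
    ((corep a).copower W ⟶ F) ≃ (W ⟶ (evaluation a).obj F) where
  toFun f := freeUnit a W ≫ f.app a
  invFun h := freeDesc h
  left_inv f := VFun.hom_ext (freeDesc_unit_aux (fun x => f.app x) (fun x y =>
    (congrArg (· ≫ f.app y) (copower_corep_act a W x y)).symm.trans (f.nat x y)))
  right_inv h := freeUnit_desc h

/-- The functor `W ↦ C(a,-) ⊗ W`. -/
def free (a : C) : V ⥤ VFun V C :=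
  Adjunction.leftAdjointOfEquiv (G := evaluation a) (freeEquiv a)
    (fun _ _ _ _ _ => (Category.assoc _ _ _).symm)

/-- The functor `W ↦ C(a,-) ⊗ W` is left adjoint to evaluation at `a`. -/
def freeAdjunction (a : C) : free (V := V) a ⊣ evaluation a :=
  Adjunction.adjunctionOfEquivLeft (G := evaluation a) (freeEquiv a) _

end Free

section Small

variable {V : Type u} [Category.{v} V] [MonoidalCategory V] [MonoidalClosed V]
  {C : Type w} [EnrichedCategory V C]

lemma Hom.elt_nat {F G : VFun V C} (f : F ⟶ G) {a b : C} (x : 𝟙_ V ⟶ (a ⟶[V] b)) :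
    F.elt x ≫ f.app b = f.app a ≫ G.elt x := by
  rw [elt, elt, Category.assoc, Category.assoc, f.nat, whisker_exchange_assoc,
    rightUnitor_inv_naturality_assoc]

lemma hom_ext_reps (R : Reps V C) {F G : VFun V C} {f g : F ⟶ G}
    (h : ∀ x, f.app (R.s x) = g.app (R.s x)) : f = g := by
  have key (f : F ⟶ G) (c : C) : f.app c = F.elt (R.p c) ≫ f.app (R.s (R.r c)) ≫ G.elt (R.q c) := by
    rw [reassoc_of% Hom.elt_nat, elt_comp, R.pq, elt_eId, Category.comp_id]
  ext c
  rw [key f, key g, h]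

instance [EssentiallySmall.{v} (ForgetEnrichment V C)] : LocallySmall.{v} (VFun V C) where
  hom_small F G := by
    obtain ⟨R⟩ := exists_reps V C
    exact small_of_injective (β := ∀ x, F.obj (R.s x) ⟶ G.obj (R.s x))
      (f := fun f x => f.app (R.s x)) (fun f g h => hom_ext_reps R (fun x => congrFun h x))

lemma isSeparating_free [SymmetricCategory V] (R : Reps V C) {I : Type v} {g : I → V}
    (hg : (ObjectProperty.ofObj g).IsSeparating) :
    (ObjectProperty.ofObj (fun p : R.S × I => (free (R.s p.1)).obj (g p.2))).IsSeparating := by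
  intro F G f f' h
  refine hom_ext_reps R (fun x => hg _ _ ?_)
  rintro _ ⟨i⟩ k
  have := h _ ⟨(x, i)⟩ (((freeAdjunction (R.s x)).homEquiv _ _).symm k)
  exact ((freeAdjunction (R.s x)).homEquiv _ _).symm.injective
    (((freeAdjunction (R.s x)).homEquiv_naturality_right_symm k f).trans (this.trans
      ((freeAdjunction (R.s x)).homEquiv_naturality_right_symm k f').symm))

end Small

section Preadditive

variable {V : Type u} [Category.{v} V] [Abelian V] [MonoidalCategory V] [SymmetricCategory V]
  [MonoidalClosed V]

lemma additive_of_isLeftAdjoint {D : Type u₁} [Category.{v₁} D] [Abelian D] (F : V ⥤ D)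
    [F.IsLeftAdjoint] : F.Additive :=
  have : PreservesBinaryBiproducts F := preservesBinaryBiproducts_of_preservesBinaryCoproducts F
  Functor.additive_of_preservesBinaryBiproducts F

instance monoidalPreadditive : MonoidalPreadditive V where
  whiskerLeft_zero {X _ _} := (tensorLeft X).map_zero _ _
  zero_whiskerRight {X _ _} := (tensorRight X).map_zero _ _
  whiskerLeft_add {X _ _} f g :=
    have := additive_of_isLeftAdjoint (tensorLeft X)
    (tensorLeft X).map_add (f := f) (g := g)
  add_whiskerRight {X _ _} f g :=
    have := additive_of_isLeftAdjoint (tensorRight X)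
    (tensorRight X).map_add (f := f) (g := g)

variable {C : Type w} [EnrichedCategory V C]

instance (F G : VFun V C) : Zero (F ⟶ G) where
  zero := { app := fun _ => 0, naturality := fun _ _ => by simp }

instance (F G : VFun V C) : Add (F ⟶ G) where
  add f g :=
    { app := fun c => f.app c + g.app c
      naturality := fun a b => by
        rw [Preadditive.comp_add, f.nat, g.nat, MonoidalPreadditive.add_whiskerRight,
          Preadditive.add_comp] }

instance (F G : VFun V C) : Neg (F ⟶ G) where
  neg f :=
    { app := fun c => - f.app c
      naturality := fun a b => by
        have h : (- f.app a) ▷ (a ⟶[V] b) = - (f.app a ▷ (a ⟶[V] b)) := by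
          rw [eq_neg_iff_add_eq_zero, ← MonoidalPreadditive.add_whiskerRight, neg_add_cancel,
            MonoidalPreadditive.zero_whiskerRight]
        rw [Preadditive.comp_neg, f.nat, h, Preadditive.neg_comp] }

@[simp] lemma zero_app (F G : VFun V C) (c : C) : Hom.app (0 : F ⟶ G) c = 0 := rfl

@[simp] lemma add_app {F G : VFun V C} (f g : F ⟶ G) (c : C) :
    (f + g).app c = f.app c + g.app c := rfl

@[simp] lemma neg_app {F G : VFun V C} (f : F ⟶ G) (c : C) : (-f).app c = - f.app c := rfl

instance (F G : VFun V C) : AddCommGroup (F ⟶ G) where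
  add_assoc f g h := VFun.hom_ext (fun c => by simp [add_assoc])
  zero_add f := VFun.hom_ext (fun c => by simp)
  add_zero f := VFun.hom_ext (fun c => by simp)
  add_comm f g := VFun.hom_ext (fun c => by simp [add_comm])
  neg_add_cancel f := VFun.hom_ext (fun c => by simp)
  nsmul := nsmulRec
  zsmul := zsmulRec

instance : Preadditive (VFun V C) where
  add_comp F G H f f' g := VFun.hom_ext (fun c => by simp)
  comp_add F G H f g g' := VFun.hom_ext (fun c => by simp)

instance (c : C) : (evaluation (V := V) c).PreservesZeroMorphisms where

instance {F G : VFun V C} (f : F ⟶ G) : IsIso (Abelian.coimageImageComparison f) :=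
  isIso_of_isIso_app _ (fun c => (MorphismProperty.isomorphisms V).arrow_mk_iso_iff
    (Abelian.PreservesCoimageImageComparison.iso (evaluation c) f) |>.2
      (inferInstanceAs (IsIso (Abelian.coimageImageComparison _))))

instance : HasFiniteProducts (VFun V C) := ⟨fun _ => inferInstance⟩

instance : Abelian (VFun V C) := Abelian.ofCoimageImageComparisonIsIso

end Preadditive

section Grothendieck

variable {V : Type u} [Category.{v} V] [Abelian V] [MonoidalCategory V] [SymmetricCategory V]
  [MonoidalClosed V] {C : Type w} [EnrichedCategory V C]

lemma isZero_iff (F : VFun V C) : IsZero F ↔ ∀ c, IsZero (F.obj c) :=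
  ⟨fun h c => (evaluation c).map_isZero h, fun h => (IsZero.iff_id_eq_zero F).2
    (VFun.hom_ext (fun c => (h c).eq_of_src _ _))⟩

instance hasExactColimitsOfShape {J : Type u₁} [Category.{v₁} J] [HasColimitsOfShape J V]
    [HasExactColimitsOfShape J V] : HasExactColimitsOfShape J (VFun V C) := by
  have h (c : C) : PreservesFiniteLimits (colim (J := J) ⋙ evaluation (V := V) (C := C) c) :=
    have : PreservesFiniteLimits ((Functor.whiskeringRight J _ _).obj (evaluation (V := V) c)) := ⟨fun _ => inferInstance⟩
    preservesFiniteLimits_of_natIso (preservesColimitNatIso (evaluation c)).symm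
  exact ⟨⟨fun K _ _ => ⟨⟨fun hs => ⟨isLimitOfEvaluation (fun c =>
    isLimitOfPreserves (colim (J := J) ⋙ evaluation c) hs)⟩⟩⟩⟩⟩

variable [IsGrothendieckAbelian.{v} V] [EssentiallySmall.{v} (ForgetEnrichment V C)]

instance : HasSeparator (VFun V C) := by
  obtain ⟨R⟩ := exists_reps V C
  have h := isSeparating_free R (I := PUnit) (g := fun _ => separator V) (by
    intro X Y f g h
    exact isSeparator_separator V _ _ (by
      rintro _ ⟨⟩ k
      exact h _ ⟨⟨⟩⟩ k))
  exact ⟨_, isSeparator_of_isColimit_cofan h (coproductIsCoproduct _)⟩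

instance : HasFilteredColimitsOfSize.{v, v} (VFun V C) := ⟨fun _ _ _ => inferInstance⟩

instance : AB5OfSize.{v, v} (VFun V C) := ⟨fun _ _ _ => inferInstance⟩

instance : IsGrothendieckAbelian.{v} (VFun V C) where

end Grothendieck

end VFun

end

end EnrichedRingoid

namespace EnrichedRingoid

noncomputable section

section HomEquiv

variable {V : Type u} [Category.{v} V] [MonoidalCategory V] [SymmetricCategory V]
  [MonoidalClosed V] {C : Type w} [EnrichedCategory V C]
  [EssentiallySmall.{v} (ForgetEnrichment V C)] [HasLimits V]

namespace homObj

/-- The morphism `𝟙 ⟶ [F, G]` corresponding to a `V`-natural transformation. -/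
def ofHom {F G : VFun V C} (f : F ⟶ G) : 𝟙_ V ⟶ homObj F G :=
  lift (fun c => (ρ_ _).hom ≫ f.app c) (fun a b => by
    rw [IsGraded, rightUnitor_naturality_assoc, f.nat, comp_whiskerRight_assoc,
      reassoc_of% @swapRight_unit_right])

lemma ofHom_ev {F G : VFun V C} (f : F ⟶ G) (c : C) :
    F.obj c ◁ ofHom f ≫ ev F G c = (ρ_ _).hom ≫ f.app c :=
  lift_ev _ _ c

lemma toHom_aux {F G : VFun V C} (x : 𝟙_ V ⟶ homObj F G) (a b : C) :
    F.act a b ≫ (ρ_ _).inv ≫ F.obj b ◁ x ≫ ev F G b =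
      ((ρ_ _).inv ≫ F.obj a ◁ x ≫ ev F G a) ▷ _ ≫ G.act a b := by
  have h : _ = _ := ev_graded F G a b
  simp only [comp_whiskerRight, Category.assoc]
  rw [rightUnitor_inv_naturality_assoc, ← whisker_exchange_assoc, h,
    reassoc_of% @swapRight_naturality_right, rightUnitor_tensor_inv]
  simp [swapRight]

/-- The `V`-natural transformation corresponding to a morphism `𝟙 ⟶ [F, G]`. -/
def toHom {F G : VFun V C} (x : 𝟙_ V ⟶ homObj F G) : F ⟶ G where
  app c := (ρ_ _).inv ≫ F.obj c ◁ x ≫ ev F G c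
  naturality := toHom_aux x

lemma ofHom_toHom {F G : VFun V C} (x : 𝟙_ V ⟶ homObj F G) : ofHom (toHom x) = x :=
  hom_ext (fun c => (ofHom_ev _ c).trans (Iso.hom_inv_id_assoc _ _))

lemma toHom_ofHom {F G : VFun V C} (f : F ⟶ G) : toHom (ofHom f) = f :=
  VFun.hom_ext (fun c => (congrArg (_ ≫ ·) (ofHom_ev f c)).trans (Iso.inv_hom_id_assoc _ _))

lemma ofHom_id (F : VFun V C) : ofHom (𝟙 F) = one F :=
  hom_ext (fun c => (ofHom_ev _ c).trans (by rw [one_ev, VFun.id_app, Category.comp_id]))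

lemma ofHom_comp {F G H : VFun V C} (f : F ⟶ G) (g : G ⟶ H) :
    ofHom (f ≫ g) = (λ_ _).inv ≫ (ofHom f ⊗ₘ ofHom g) ≫ comp F G H :=
  hom_ext (fun c => by
    rw [ofHom_ev, VFun.comp_app]
    simp only [MonoidalCategory.whiskerLeft_comp, Category.assoc, comp_ev]
    rw [tensorHom_act_aux, ofHom_ev, ofHom_ev]
    simp)

end homObj

end HomEquiv

section FinitelyPresentable

variable {V : Type u} [Category.{v} V] [Abelian V] [IsGrothendieckAbelian.{v} V]
  [MonoidalCategory V] [SymmetricCategory V] [MonoidalClosed V]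
  {C : Type w} [EnrichedCategory V C] [EssentiallySmall.{v} (ForgetEnrichment V C)]

attribute [local instance] Cardinal.fact_isRegular_aleph0

lemma isFinitelyPresentable_of_isLeftAdjoint {D : Type u} [Category.{v} D] {E : Type w}
    [Category.{w'} E] {F : D ⥤ E} {G : E ⥤ D} (adj : F ⊣ G) [G.IsLeftAdjoint] (X : D)
    [IsFinitelyPresentable.{v} X] : IsFinitelyPresentable.{v} (F.obj X) :=
  have : G.IsFinitelyAccessible := ⟨fun _ => inferInstance⟩
  adj.isCardinalPresentable_leftAdjoint_obj _ X

lemma isFinitelyPresentable_of_hasRightDual [IsFinitelyPresentable.{v} (𝟙_ V)] (X : V)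
    [HasRightDual X] : IsFinitelyPresentable.{v} X :=
  have : IsFinitelyPresentable.{v} (𝟙_ V ⊗ X) :=
    isFinitelyPresentable_of_isLeftAdjoint (tensorRightAdjunction X Xᘁ) (𝟙_ V)
  isCardinalPresentable_of_iso (λ_ X) _

lemma isStrongGenerator_of_isSeparating {D : Type u} [Category.{v} D] [Balanced D]
    {P : ObjectProperty D} (hP : P.IsSeparating) : P.IsStrongGenerator := by
  refine ObjectProperty.isStrongGenerator_iff.2 ⟨hP, fun X Y i _ h => ?_⟩
  have : Epi i := ⟨fun f g hfg => hP _ _ (fun G hG k => by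
    obtain ⟨l, rfl⟩ := h G hG k
    simp [hfg])⟩
  exact isIso_of_mono_of_epi i

variable [IsFinitelyPresentable.{v} (𝟙_ V)] {I : Type v} {g : I → V}

lemma isLocallyFinitelyPresentable_vFun (hg : (ObjectProperty.ofObj g).IsSeparating)
    (hdual : ∀ i, Nonempty (HasRightDual (g i))) :
    IsLocallyFinitelyPresentable.{v} (VFun V C) := by
  obtain ⟨R⟩ := exists_reps V C
  refine (IsCardinalLocallyPresentable.iff_exists_isStrongGenerator _ _).2
    ⟨_, inferInstance, isStrongGenerator_of_isSeparating (VFun.isSeparating_free R hg), ?_⟩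
  rintro _ ⟨x, i⟩
  obtain ⟨_⟩ := hdual i
  have := isFinitelyPresentable_of_hasRightDual (g i)
  exact isFinitelyPresentable_of_isLeftAdjoint (VFun.freeAdjunction (R.s x)) (g i)

end FinitelyPresentable

section FpMod

variable (V : Type u) [Category.{v} V] [MonoidalCategory V] [SymmetricCategory V]
  [MonoidalClosed V] (A : Type w) [EnrichedCategory V A]
  [EssentiallySmall.{v} (ForgetEnrichment V A)] [HasLimits V]

attribute [local instance] Cardinal.fact_isRegular_aleph0

/-- The comparison between the ordinary category of finitely presented right `A`-modules and the
underlying category of the `V`-category `mod A`. -/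
def fpModForget : (isCardinalPresentable (RightMod V A) Cardinal.aleph0.{v}).FullSubcategory ⥤
    ForgetEnrichment V (FpMod V A) where
  obj M := ForgetEnrichment.of V
    (⟨M.obj, M.property⟩ : {M : RightMod V A // IsFinitelyPresentable.{v} M})
  map f := ForgetEnrichment.homOf V (C := FpMod V A) (homObj.ofHom f.hom)
  map_id M := (congrArg (ForgetEnrichment.homOf V (C := FpMod V A)) (homObj.ofHom_id M.obj)).trans
    (ForgetEnrichment.homOf_eId V _)
  map_comp f g := (congrArg (ForgetEnrichment.homOf V (C := FpMod V A))
    (homObj.ofHom_comp f.hom g.hom)).trans (ForgetEnrichment.homOf_comp V (C := FpMod V A) _ _)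

instance : (fpModForget V A).IsEquivalence where
  faithful := ⟨fun {M N f g} h => by
    ext1
    rw [← homObj.toHom_ofHom f.hom, ← homObj.toHom_ofHom g.hom]
    exact congrArg homObj.toHom h⟩
  full := ⟨fun {M N} f => ⟨ObjectProperty.homMk (homObj.toHom (ForgetEnrichment.homTo V f)),
    homObj.ofHom_toHom (ForgetEnrichment.homTo V f)⟩⟩
  essSurj := ⟨fun M => ⟨⟨(ForgetEnrichment.to V M).1, (ForgetEnrichment.to V M).2⟩,
    ⟨Iso.refl _⟩⟩⟩

end FpMod

section

variable (V : Type u) [Category.{v} V] [Abelian V] [IsGrothendieckAbelian.{v} V]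
  [MonoidalCategory V] [SymmetricCategory V] [MonoidalClosed V]
  [IsFinitelyPresentable.{v} (𝟙_ V)] {I : Type v} {g : I → V}
  (A : Type w) [EnrichedCategory V A] [EssentiallySmall.{v} (ForgetEnrichment V A)]

lemma essentiallySmall_fpMod (hg : (ObjectProperty.ofObj g).IsSeparating)
    (hdual : ∀ i, Nonempty (HasRightDual (g i))) :
    EssentiallySmall.{v} (ForgetEnrichment V (FpMod V A)) :=
  have : IsLocallyFinitelyPresentable.{v} (RightMod V A) :=
    isLocallyFinitelyPresentable_vFun hg hdual
  (essentiallySmall_congr (fpModForget V A).asEquivalence).1 inferInstance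

end

end

end EnrichedRingoid

namespace EnrichedRingoid

noncomputable section

open Opposite

section Braiding

variable {V : Type u} [Category.{v} V] [MonoidalCategory V] [SymmetricCategory V]

lemma braiding_swapRight_tensor (X Y Z : V) :
    (α_ X Y Z).inv ≫ (β_ X Y).hom ▷ Z ≫ swapRight Y X Z = (β_ X (Y ⊗ Z)).hom := by
  simp [swapRight]

lemma whiskerLeft_braiding_assoc (X Y Z : V) :
    X ◁ (β_ Z Y).hom ≫ (α_ X Y Z).inv ≫ (β_ (X ⊗ Y) Z).hom =
      (β_ X (Z ⊗ Y)).hom ≫ (α_ Z Y X).hom ≫ Z ◁ (β_ Y X).hom := by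
  simp only [BraidedCategory.braiding_tensor_left_hom, BraidedCategory.braiding_tensor_right_hom,
    Category.assoc, Iso.inv_hom_id_assoc]
  simp [← MonoidalCategory.whiskerLeft_comp_assoc, ← MonoidalCategory.whiskerLeft_comp]

lemma swapRight_swapRight (X Y Z : V) : swapRight X Y Z ≫ swapRight X Z Y = 𝟙 _ := by
  simp [swapRight, ← MonoidalCategory.whiskerLeft_comp_assoc]

end Braiding

section EnrichedYoneda

variable {V : Type u} [Category.{v} V] [MonoidalCategory V] [SymmetricCategory V]
  [MonoidalClosed V] {C : Type w} [EnrichedCategory V C]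

lemma yon_graded (F : VFun V C) (a x y : C) :
    IsGraded (corep a) F (W := F.obj a) ((β_ _ _).hom ≫ F.act a x) ((β_ _ _).hom ≫ F.act a y) := by
  have h := VFun.freeDesc_aux (𝟙 (F.obj a)) x y
  simp only [id_whiskerRight, Category.id_comp, Category.assoc] at h
  refine (congrArg (fun f => f ▷ F.obj a ≫ (β_ _ _).hom ≫ F.act a y) (corep_act a x y)).trans
    (Eq.trans ?_ (congrArg (swapRight _ _ _ ≫ ·) h))
  exact ((reassoc_of% swapRight_swapRight _ _ _) _).symm

variable [EssentiallySmall.{v} (ForgetEnrichment V C)] [HasLimits V]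

/-- The morphism `F(a) ⟶ [C(a,-), F]` given by the action of `C` on `F`. -/
def yon (F : VFun V C) (a : C) : F.obj a ⟶ homObj (corep a) F :=
  homObj.lift (fun x => (β_ (a ⟶[V] x) (F.obj a)).hom ≫ F.act a x) (yon_graded F a)

lemma yon_ev (F : VFun V C) (a x : C) :
    (a ⟶[V] x) ◁ yon F a ≫ homObj.ev (corep a) F x = (β_ _ _).hom ≫ F.act a x :=
  homObj.lift_ev (F := corep a) _ (yon_graded F a) x

lemma ev_yon (F G : VFun V C) (a : C) : homObj.ev F G a ≫ yon G a =
    yon F a ▷ _ ≫ homObj.comp (corep a) F G :=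
  homObj.hom_ext (fun x => by
    have h : _ = _ := homObj.ev_graded F G a x
    rw [MonoidalCategory.whiskerLeft_comp, Category.assoc, MonoidalCategory.whiskerLeft_comp,
      Category.assoc, homObj.comp_ev, associator_inv_naturality_middle_assoc,
      ← comp_whiskerRight_assoc]
    refine (congrArg (_ ≫ ·) (yon_ev G a x)).trans (Eq.trans ?_
      (congrArg (fun f => (α_ _ _ _).inv ≫ f ▷ _ ≫ homObj.ev F G x) (yon_ev F a x)).symm)
    rw [comp_whiskerRight_assoc, h, reassoc_of% @braiding_swapRight_tensor]
    exact BraidedCategory.braiding_naturality_right_assoc _ _ _)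

end EnrichedYoneda

section TensorAdjunction

variable {V : Type u} [Category.{v} V] [MonoidalCategory V] [SymmetricCategory V]
  [MonoidalClosed V] {A : Type w} [EnrichedCategory V A]
  [EssentiallySmall.{v} (ForgetEnrichment V A)] [HasLimits V]

/-- The morphism `M(a) ⟶ [A(-,a), M]` of the Yoneda lemma. -/
def repYon (M : RightMod V A) (a : A) : M.obj (op a) ⟶ homObj (rep a) M := yon M (op a)

/-- Evaluation `A(x,a) ⊗ [A(-,a), M] ⟶ M(x)`. -/
def repEv (M : RightMod V A) (a x : A) : (x ⟶[V] a) ⊗ homObj (rep a) M ⟶ M.obj (op x) :=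
  homObj.ev (rep a) M (op x)

lemma repYon_repEv (M : RightMod V A) (a x : A) :
    (x ⟶[V] a) ◁ repYon M a ≫ repEv M a x = (β_ _ _).hom ≫ ract M x a :=
  yon_ev M (op a) (op x)

lemma repMap_eq (a b : A) : repMap (V := V) a b = repYon (rep b) a :=
  homObj.hom_ext (fun x => by
    refine (repMap_ev a b x).trans (Eq.trans ?_ (repYon_repEv (rep b) a x.unop).symm)
    rw [ract, corep_act]
    exact (SymmetricCategory.symmetry_assoc _ _ _).symm)

lemma ract_repYon (M : RightMod V A) (a b : A) :
    ract M a b ≫ repYon M a = (β_ _ _).hom ≫ (repMap a b ⊗ₘ repYon M b) ≫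
      homObj.comp (rep a) (rep b) M :=
  homObj.hom_ext (fun x => by
    obtain ⟨x, rfl⟩ : ∃ y, x = op y := ⟨x.unop, rfl⟩
    have h : (x ⟶[V] a) ◁ (repMap a b ⊗ₘ repYon M b) ≫ (α_ _ _ _).inv ≫
        homObj.ev (rep a) (rep b) (op x) ▷ _ ≫ repEv M b x =
        (α_ _ _ _).inv ≫ eComp V x a b ▷ _ ≫ (β_ _ _).hom ≫ ract M x b := by
      rw [← repYon_repEv]
      refine (tensorHom_act_aux _ _ _ _).trans ?_
      exact congrArg (fun f => _ ≫ f ▷ _ ≫ _) (repMap_ev a b (op x))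
    have h' : (x ⟶[V] a) ◁ (ract M a b) ≫ (β_ _ _).hom ≫ ract M x a =
        (x ⟶[V] a) ◁ (β_ _ _).hom ≫ (α_ _ _ _).inv ≫ eComp V x a b ▷ _ ≫ (β_ _ _).hom ≫
          ract M x b := by
      rw [BraidedCategory.braiding_naturality_right_assoc, ract_comp,
        BraidedCategory.braiding_naturality_left_assoc, MonoidalCategory.whiskerLeft_comp_assoc,
        reassoc_of% whiskerLeft_braiding_assoc]
    simp only [MonoidalCategory.whiskerLeft_comp, Category.assoc, homObj.comp_ev]
    refine (congrArg (_ ≫ ·) (repYon_repEv M a x)).trans (h'.trans ?_)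
    exact (congrArg (_ ≫ ·) h).symm)

lemma ev_repYon (M M' : RightMod V A) (a : A) : homObj.ev M M' (op a) ≫ repYon M' a =
    repYon M a ▷ _ ≫ homObj.comp (rep a) M M' :=
  ev_yon M M' (op a)

variable [HasColimits V]

/-- The coprojection `A(a,b) ⊗ N(a) ⟶ A(-,b) ⊗_A N`. -/
def repι (N : LeftMod V A) (a b : A) : (a ⟶[V] b) ⊗ N.obj a ⟶ tensorObj (rep b) N :=
  tensorObj.ι (rep b) N a

lemma repι_condition (N : LeftMod V A) (a b c : A) :
    ((β_ (b ⟶[V] c) (a ⟶[V] b)).hom ≫ eComp V a b c) ▷ N.obj a ≫ repι N a c =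
      (α_ _ _ _).hom ≫ _ ◁ ((β_ _ _).hom ≫ N.act a b) ≫ repι N b c := by
  have h := tensorObj.condition (rep c) N a b
  rw [tensorFst, tensorSnd, Category.assoc, ract, corep_act] at h
  exact h

lemma repι_act (M : RightMod V A) (N : LeftMod V A) (x a : A) :
    repι N x a ▷ homObj (rep a) M ≫ tensorObj.act (rep a) M N =
      swapRight _ _ _ ≫ repEv M a x ▷ _ ≫ tensorObj.ι M N x :=
  tensorObj.ι_act (rep a) M N x

/-- The morphism `N(a) ⟶ A(-,a) ⊗_A N`. -/
def coYon (N : LeftMod V A) (a : A) : N.obj a ⟶ tensorObj (rep a) N :=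
  VFun.freeUnit a (N.obj a) ≫ repι N a a

lemma act_coYon (N : LeftMod V A) (a b : A) :
    N.act a b ≫ coYon N b = (β_ _ _).hom ≫ repι N a b := by
  have h : N.act a b ≫ VFun.freeUnit b (N.obj b) = (β_ _ _).hom ≫
      ((λ_ _).inv ≫ eId V b ▷ _) ▷ _ ≫ (α_ _ _ _).hom ≫ _ ◁ ((β_ _ _).hom ≫ N.act a b) := by
    rw [VFun.freeUnit, comp_whiskerRight_assoc, associator_naturality_left_assoc,
      ← whisker_exchange, leftUnitor_inv_whiskerRight_assoc, Iso.inv_hom_id_assoc,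
      ← leftUnitor_inv_naturality_assoc, Category.assoc, SymmetricCategory.symmetry_assoc]
  rw [coYon, reassoc_of% h, ← repι_condition, ← comp_whiskerRight_assoc, Category.assoc,
    BraidedCategory.braiding_naturality_left_assoc, eComp_eId]
  simp

lemma coYon_act (M : RightMod V A) (N : LeftMod V A) (a : A) :
    coYon N a ▷ _ ≫ tensorObj (rep a) N ◁ repYon M a ≫ tensorObj.act (rep a) M N =
      (β_ _ _).hom ≫ tensorObj.ι M N a := by
  rw [coYon, comp_whiskerRight_assoc, ← whisker_exchange_assoc, repι_act,
    reassoc_of% @swapRight_naturality_right, ← comp_whiskerRight_assoc, repYon_repEv,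
    reassoc_of% VFun.freeUnit_swapRight, ← comp_whiskerRight_assoc, Category.assoc,
    BraidedCategory.braiding_naturality_left_assoc, ract_id]
  simp

lemma coYon_repMap (N : LeftMod V A) (a b : A) :
    coYon N a ▷ _ ≫ tensorObj (rep a) N ◁ repMap a b ≫ tensorObj.act (rep a) (rep b) N =
      (β_ _ _).hom ≫ repι N a b := by
  rw [repMap_eq]
  exact coYon_act (rep b) N a

end TensorAdjunction

end

end EnrichedRingoid

namespace EnrichedRingoid

noncomputable section

open Opposite

section TensorAdjunction

variable {V : Type u} [Category.{v} V] [MonoidalCategory V] [SymmetricCategory V]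
  [MonoidalClosed V] {A : Type w} [EnrichedCategory V A]
  [EssentiallySmall.{v} (ForgetEnrichment V A)] [HasLimits V]

/-- The right `A`-module underlying a finitely presented one. -/
def fpVal (M : FpMod V A) : RightMod V A := (inducedIncl V Subtype.val).obj M

/-- The action of the `V`-category of finitely presented right `A`-modules on a generalised
`A`-module. -/
def genAct (Y : GenMod V A) (M M' : FpMod V A) :
    Y.obj M ⊗ homObj (fpVal M) (fpVal M') ⟶ Y.obj M' := Y.act M M'

lemma genAct_id (Y : GenMod V A) (M : FpMod V A) :
    Y.obj M ◁ homObj.one (fpVal M) ≫ genAct Y M M = (ρ_ _).hom := Y.act_id M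

lemma genAct_comp (Y : GenMod V A) (M M' M'' : FpMod V A) :
    Y.obj M ◁ homObj.comp (fpVal M) (fpVal M') (fpVal M'') ≫ genAct Y M M'' =
      (α_ _ _ _).inv ≫ genAct Y M M' ▷ _ ≫ genAct Y M' M'' := Y.act_comp M M' M''

variable [IsFinitelyPresentable.{v} (𝟙_ V)]

variable (V) in
/-- The finitely presented right `A`-module represented by `a`. -/
def fpRep (a : A) : FpMod V A := (yonedaFp V A).obj a

/-- The value of a generalised `A`-module at a representable right `A`-module. -/
abbrev repObj (Y : GenMod V A) (a : A) : V := Y.obj (fpRep V a)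

/-- The action of `[A(-,a), M]` on the value of a generalised `A`-module at `A(-,a)`. -/
def repAct (Y : GenMod V A) (a : A) (M : FpMod V A) :
    repObj Y a ⊗ homObj (rep a) (fpVal M) ⟶ Y.obj M := genAct Y (fpRep V a) M

lemma repAct_nat {Y Z : GenMod V A} (f : Y ⟶ Z) (a : A) (M : FpMod V A) :
    repAct Y a M ≫ f.app M = f.app (fpRep V a) ▷ _ ≫ repAct Z a M := f.nat _ M

lemma repAct_genAct (Y : GenMod V A) (a : A) (M M' : FpMod V A) :
    repAct Y a M ▷ _ ≫ genAct Y M M' =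
      (α_ _ _ _).hom ≫ repObj Y a ◁ homObj.comp (rep a) (fpVal M) (fpVal M') ≫ repAct Y a M' :=
  ((Iso.eq_inv_comp _).1 (genAct_comp Y (fpRep V a) M M')).symm

/-- The action of `[A(-,a), A(-,b)]` on the value of a generalised `A`-module at `A(-,a)`. -/
def repRepAct (Y : GenMod V A) (a b : A) :
    repObj Y a ⊗ homObj (rep (V := V) a) (rep b) ⟶ repObj Y b := repAct Y a (fpRep V b)

lemma repRepAct_repAct (Y : GenMod V A) (a b : A) (M : FpMod V A) :
    repRepAct Y a b ▷ _ ≫ repAct Y b M =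
      (α_ _ _ _).hom ≫ repObj Y a ◁ homObj.comp (rep a) (rep b) (fpVal M) ≫ repAct Y a M :=
  repAct_genAct Y a (fpRep V b) M

/-- The action of `A` on the values of a generalised `A`-module at representables. -/
def repRestrAct (Y : GenMod V A) (a b : A) : repObj Y a ⊗ (a ⟶[V] b) ⟶ repObj Y b :=
  repObj Y a ◁ repMap a b ≫ repRepAct Y a b

lemma restrictionToA_act (Y : GenMod V A) (a b : A) :
    ((restrictionToA V A).obj Y).act a b = repRestrAct Y a b :=
  VFun.restr_act (yonedaFp V A) Y a b

lemma repRestrAct_repAct (Y : GenMod V A) (a b : A) (M : FpMod V A) :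
    repRestrAct Y a b ▷ _ ≫ repAct Y b M = (α_ _ _ _).hom ≫
      repObj Y a ◁ ((repMap a b ▷ _) ≫ homObj.comp (rep a) (rep b) (fpVal M)) ≫ repAct Y a M := by
  rw [repRestrAct, comp_whiskerRight_assoc, repRepAct_repAct,
    associator_naturality_middle_assoc, MonoidalCategory.whiskerLeft_comp_assoc]

variable [HasColimits V]

omit [IsFinitelyPresentable.{v} (𝟙_ V)] [EssentiallySmall.{v} (ForgetEnrichment V A)]
  [HasLimits V] [HasColimits V] [MonoidalClosed V] in
lemma associator_braiding_assoc (X Y Z : V) :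
    (α_ X Y Z).hom ≫ (β_ X (Y ⊗ Z)).hom ≫ (β_ Y Z).hom ▷ X ≫ (α_ Z Y X).hom =
      (β_ (X ⊗ Y) Z).hom ≫ Z ◁ (β_ X Y).hom := by
  rw [← BraidedCategory.braiding_naturality_right_assoc,
    BraidedCategory.braiding_tensor_right_hom, BraidedCategory.braiding_tensor_left_hom]
  simp

section Desc

variable {N : LeftMod V A} {Y : GenMod V A} (f : ∀ a, N.obj a ⟶ repObj Y a)

/-- The components `M(a) ⊗ N(a) ⟶ Y(M)` of the morphism `- ⊗_A N ⟶ Y` corresponding to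
`N ⟶ r(Y)`. -/
def tensorDescι (M : FpMod V A) (a : A) : (fpVal M).obj (op a) ⊗ N.obj a ⟶ Y.obj M :=
  (β_ _ _).hom ≫ f a ▷ _ ≫ repObj Y a ◁ repYon (fpVal M) a ≫ repAct Y a M

lemma tensorDescι_condition (hf : ∀ a b, N.act a b ≫ f b = f a ▷ _ ≫ repRestrAct Y a b)
    (M : FpMod V A) (a b : A) :
    tensorFst (fpVal M) N a b ≫ tensorDescι f M a =
      tensorSnd (fpVal M) N a b ≫ tensorDescι f M b := by
  rw [tensorFst, tensorSnd, tensorDescι, tensorDescι,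
    BraidedCategory.braiding_naturality_left_assoc, whisker_exchange_assoc,
    ← MonoidalCategory.whiskerLeft_comp_assoc, ract_repYon, Category.assoc,
    BraidedCategory.braiding_naturality_right_assoc]
  have h : N.act a b ▷ _ ≫ f b ▷ _ ≫ repObj Y b ◁ repYon (fpVal M) b ≫ repAct Y b M =
      f a ▷ _ ▷ _ ≫ (α_ _ _ _).hom ≫ repObj Y a ◁ ((repMap a b ⊗ₘ repYon (fpVal M) b) ≫
        homObj.comp (rep a) (rep b) (fpVal M)) ≫ repAct Y a M := by
    rw [← comp_whiskerRight_assoc, hf, comp_whiskerRight_assoc, ← whisker_exchange_assoc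
      (repRestrAct Y a b), repRestrAct_repAct, associator_naturality_right_assoc,
      MonoidalCategory.tensorHom_def', Category.assoc,
      ← MonoidalCategory.whiskerLeft_comp_assoc]
  simp only [Category.assoc, comp_whiskerRight]
  rw [h, associator_naturality_left_assoc, reassoc_of% associator_braiding_assoc,
    whisker_exchange_assoc, ← MonoidalCategory.whiskerLeft_comp_assoc]

lemma tensorDescι_act (M M' : FpMod V A) (a : A) :
    swapRight _ _ _ ≫ homObj.ev (fpVal M) (fpVal M') (op a) ▷ _ ≫ tensorDescι f M' a =
      tensorDescι f M a ▷ _ ≫ genAct Y M M' := by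
  rw [tensorDescι, tensorDescι, BraidedCategory.braiding_naturality_left_assoc,
    whisker_exchange_assoc, ← MonoidalCategory.whiskerLeft_comp_assoc, ev_repYon]
  simp only [comp_whiskerRight, Category.assoc]
  rw [repAct_genAct, reassoc_of% @braiding_swapRight,
    associator_naturality_middle_assoc, ← MonoidalCategory.whiskerLeft_comp_assoc,
    ← associator_inv_naturality_left_assoc, Iso.inv_hom_id_assoc]

end Desc

/-- The `V`-natural transformation `- ⊗_A N ⟶ Y` corresponding to `N ⟶ r(Y)`. -/
def tensorDescApp {N : LeftMod V A} {Y : GenMod V A} (f : ∀ a, N.obj a ⟶ repObj Y a)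
    (hf : ∀ a b, N.act a b ≫ f b = f a ▷ _ ≫ repRestrAct Y a b) (M : FpMod V A) :
    tensorObj (fpVal M) N ⟶ Y.obj M :=
  tensorObj.desc (tensorDescι f M) (tensorDescι_condition f hf M)

lemma ι_tensorDescApp {N : LeftMod V A} {Y : GenMod V A} (f : ∀ a, N.obj a ⟶ repObj Y a)
    (hf : ∀ a b, N.act a b ≫ f b = f a ▷ _ ≫ repRestrAct Y a b) (M : FpMod V A) (a : A) :
    tensorObj.ι (fpVal M) N a ≫ tensorDescApp f hf M = tensorDescι f M a :=
  tensorObj.ι_desc _ _ a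

lemma tensorDescApp_nat {N : LeftMod V A} {Y : GenMod V A} (f : ∀ a, N.obj a ⟶ repObj Y a)
    (hf : ∀ a b, N.act a b ≫ f b = f a ▷ _ ≫ repRestrAct Y a b) (M M' : FpMod V A) :
    tensorObj.act (fpVal M) (fpVal M') N ≫ tensorDescApp f hf M' =
      tensorDescApp f hf M ▷ _ ≫ genAct Y M M' :=
  tensorObj.hom_ext_right (fun a => by
    rw [reassoc_of% @tensorObj.ι_act, ι_tensorDescApp, tensorDescι_act,
      ← comp_whiskerRight_assoc, ι_tensorDescApp])

omit [IsFinitelyPresentable.{v} (𝟙_ V)] in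
lemma tensorFunctor_act (N : LeftMod V A) (M M' : FpMod V A) :
    genAct (tensorFunctor.obj N) M M' = tensorObj.act (fpVal M) (fpVal M') N := by
  refine (VFun.restr_act (inducedIncl V Subtype.val) (tensorVFun N) M M').trans ?_
  refine (congrArg (· ≫ _) (MonoidalCategory.whiskerLeft_id _ _)).trans ?_
  exact (Category.id_comp _).trans (tensorVFun_act N (fpVal M) (fpVal M'))

lemma hom_restrictionToA_nat {N : LeftMod V A} {Y : GenMod V A}
    (f : N ⟶ (restrictionToA V A).obj Y) (a b : A) :
    N.act a b ≫ f.app b = f.app a ▷ _ ≫ repRestrAct Y a b :=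
  (f.nat a b).trans (congrArg (f.app a ▷ _ ≫ ·) (restrictionToA_act Y a b))

/-- The `V`-natural transformation `- ⊗_A N ⟶ Y` corresponding to `N ⟶ r(Y)`. -/
def tensorDesc {N : LeftMod V A} {Y : GenMod V A} (f : N ⟶ (restrictionToA V A).obj Y) :
    tensorFunctor.obj N ⟶ Y where
  app M := tensorDescApp (fun a => f.app a) (hom_restrictionToA_nat f) M
  naturality M M' := (congrArg (· ≫ _) (tensorFunctor_act N M M')).trans
    (tensorDescApp_nat _ _ M M')

lemma tensorUnit_aux (N : LeftMod V A) (a b : A) : N.act a b ≫ coYon N b =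
    coYon N a ▷ _ ≫ tensorObj (rep a) N ◁ repMap a b ≫ tensorObj.act (rep a) (rep b) N :=
  (act_coYon N a b).trans (coYon_repMap N a b).symm

lemma repRestrAct_tensorFunctor (N : LeftMod V A) (a b : A) :
    repRestrAct (tensorFunctor.obj N) a b =
      tensorObj (rep a) N ◁ repMap a b ≫ tensorObj.act (rep a) (rep b) N :=
  congrArg (tensorObj (rep a) N ◁ repMap a b ≫ ·)
    (tensorFunctor_act N (fpRep V a) (fpRep V b))

/-- The unit `N ⟶ r(- ⊗_A N)`. -/
def tensorUnit (N : LeftMod V A) : N ⟶ (restrictionToA V A).obj (tensorFunctor.obj N) where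
  app a := coYon N a
  naturality a b := (tensorUnit_aux N a b).trans (congrArg (coYon N a ▷ _ ≫ ·)
    ((repRestrAct_tensorFunctor N a b).symm.trans
      (restrictionToA_act (tensorFunctor.obj N) a b).symm))

omit [IsFinitelyPresentable.{v} (𝟙_ V)] in
lemma coYon_map {N N' : LeftMod V A} (g : N ⟶ N') (a : A) :
    g.app a ≫ coYon N' a = coYon N a ≫ tensorObj.map (rep a) g := by
  have h : repι N a a ≫ tensorObj.map (rep a) g = (a ⟶[V] a) ◁ g.app a ≫ repι N' a a :=
    tensorObj.ι_map (rep a) g a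
  rw [coYon, coYon, Category.assoc, h, VFun.freeUnit, VFun.freeUnit, Category.assoc, Category.assoc,
    ← whisker_exchange_assoc, leftUnitor_inv_naturality_assoc]

/-- The component of `tensorDescApp` at a representable right `A`-module. -/
def tensorDescRep {N : LeftMod V A} {Y : GenMod V A} (f : ∀ a, N.obj a ⟶ repObj Y a)
    (hf : ∀ a b, N.act a b ≫ f b = f a ▷ _ ≫ repRestrAct Y a b) (a : A) :
    tensorObj (rep a) N ⟶ repObj Y a := tensorDescApp f hf (fpRep V a)

lemma coYon_tensorDescRep {N : LeftMod V A} {Y : GenMod V A} (f : ∀ a, N.obj a ⟶ repObj Y a)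
    (hf : ∀ a b, N.act a b ≫ f b = f a ▷ _ ≫ repRestrAct Y a b) (a : A) :
    coYon N a ≫ tensorDescRep f hf a = f a := by
  have h : repι N a a ≫ tensorDescRep f hf a = (β_ (a ⟶[V] a) _).hom ≫ f a ▷ _ ≫
      repObj Y a ◁ repMap a a ≫ repRepAct Y a a := by
    rw [repMap_eq]
    exact ι_tensorDescApp f hf (fpRep V a) a
  have h' : repObj Y a ◁ homObj.one (rep (V := V) a) ≫ repRepAct Y a a = (ρ_ _).hom :=
    genAct_id Y (fpRep V a)
  rw [coYon, Category.assoc, h, VFun.freeUnit, Category.assoc,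
    BraidedCategory.braiding_naturality_left_assoc, whisker_exchange_assoc,
    ← MonoidalCategory.whiskerLeft_comp_assoc, repMap_id, h', rightUnitor_naturality]
  simp

lemma tensorUnit_desc {N : LeftMod V A} {Y : GenMod V A} (f : N ⟶ (restrictionToA V A).obj Y) :
    tensorUnit N ≫ (restrictionToA V A).map (tensorDesc f) = f :=
  VFun.hom_ext (fun a => coYon_tensorDescRep _ (hom_restrictionToA_nat f) a)

lemma repAct_tensorFunctor (N : LeftMod V A) (a : A) (M : FpMod V A) :
    repAct (tensorFunctor.obj N) a M = tensorObj.act (rep a) (fpVal M) N :=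
  tensorFunctor_act N (fpRep V a) M

lemma tensorDescι_coYon {N : LeftMod V A} {Y : GenMod V A} (t : tensorFunctor.obj N ⟶ Y)
    (T : ∀ M : FpMod V A, tensorObj (fpVal M) N ⟶ Y.obj M) (hT : ∀ M, T M = t.app M)
    (T' : ∀ a, tensorObj (rep a) N ⟶ repObj Y a) (hT' : ∀ a, T' a = T (fpRep V a))
    (M : FpMod V A) (a : A) :
    tensorDescι (fun a => coYon N a ≫ T' a) M a = tensorObj.ι (fpVal M) N a ≫ T M := by
  have h : tensorObj.act (rep a) (fpVal M) N ≫ T M = T' a ▷ _ ≫ repAct Y a M := by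
    rw [hT', hT, hT]
    exact (congrArg (· ≫ _) (repAct_tensorFunctor N a M)).symm.trans (repAct_nat t a M)
  rw [tensorDescι, comp_whiskerRight_assoc, ← whisker_exchange_assoc (T' a), ← h,
    reassoc_of% coYon_act (fpVal M) N a, SymmetricCategory.symmetry_assoc]

lemma tensorDesc_unit {N : LeftMod V A} {Y : GenMod V A} (t : tensorFunctor.obj N ⟶ Y) :
    tensorDesc (tensorUnit N ≫ (restrictionToA V A).map t) = t :=
  VFun.hom_ext (fun M => tensorObj.hom_ext (fun a => (ι_tensorDescApp _
    (hom_restrictionToA_nat (tensorUnit N ≫ (restrictionToA V A).map t)) M a).trans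
    (tensorDescι_coYon t (fun M => t.app M) (fun _ => rfl) (fun a => t.app (fpRep V a))
      (fun _ => rfl) M a)))

lemma tensorUnit_map {N N' : LeftMod V A} {Y : GenMod V A} (g : N ⟶ N')
    (f : N' ⟶ (restrictionToA V A).obj Y) :
    g ≫ tensorUnit N' ≫ (restrictionToA V A).map (tensorDesc f) =
      tensorUnit N ≫ (restrictionToA V A).map (tensorFunctor.map g ≫ tensorDesc f) :=
  VFun.hom_ext (fun a => (reassoc_of% coYon_map g a) _)

variable (V A) in
/-- The functor `N ↦ - ⊗_A N` is left adjoint to the restriction functor. -/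
def tensorAdjunction : tensorFunctor ⊣ restrictionToA V A :=
  Adjunction.mkOfHomEquiv
    { homEquiv := fun N _ =>
        { toFun := fun t => tensorUnit N ≫ (restrictionToA V A).map t
          invFun := tensorDesc
          left_inv := tensorDesc_unit
          right_inv := tensorUnit_desc }
      homEquiv_naturality_left_symm := fun g f =>
        (congrArg tensorDesc ((congrArg (g ≫ ·) (tensorUnit_desc f).symm).trans
          (tensorUnit_map g f))).trans (tensorDesc_unit _)
      homEquiv_naturality_right := fun {N _ _} t s =>
        (congrArg (tensorUnit N ≫ ·) ((restrictionToA V A).map_comp t s)).trans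
          (Category.assoc _ _ _).symm }

omit [IsFinitelyPresentable.{v} (𝟙_ V)] [EssentiallySmall.{v} (ForgetEnrichment V A)]
  [HasLimits V] [HasColimits V] in
lemma coYonInv_aux (N : LeftMod V A) (a b c : A) :
    tensorFst (rep a) N b c ≫ (β_ (b ⟶[V] a) (N.obj b)).hom ≫ N.act b a =
      tensorSnd (rep a) N b c ≫ (β_ (c ⟶[V] a) (N.obj c)).hom ≫ N.act c a := by
  have h : ((β_ (c ⟶[V] a) (b ⟶[V] c)).hom ≫ eComp V b c a) ▷ N.obj b ≫ (β_ _ _).hom ≫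
      N.act b a = (α_ _ _ _).hom ≫ (c ⟶[V] a) ◁ ((β_ _ _).hom ≫ N.act b c) ≫ (β_ _ _).hom ≫
      N.act c a := by
    rw [BraidedCategory.braiding_naturality_left_assoc,
      BraidedCategory.braiding_naturality_right_assoc, comp_whiskerRight_assoc,
      MonoidalCategory.whiskerLeft_comp_assoc, VFun.act_comp,
      ← reassoc_of% associator_braiding_assoc, Iso.hom_inv_id_assoc]
  rw [tensorFst, tensorSnd, ract, corep_act, Category.assoc]
  exact h

/-- The inverse `A(-,a) ⊗_A N ⟶ N(a)` of `coYon`. -/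
def coYonInv (N : LeftMod V A) (a : A) : tensorObj (rep a) N ⟶ N.obj a :=
  tensorObj.desc (fun c => (β_ (c ⟶[V] a) (N.obj c)).hom ≫ N.act c a) (coYonInv_aux N a)

lemma repι_coYonInv (N : LeftMod V A) (b a : A) :
    repι N b a ≫ coYonInv N a = (β_ (b ⟶[V] a) (N.obj b)).hom ≫ N.act b a :=
  tensorObj.ι_desc _ _ b

instance (N : LeftMod V A) (a : A) : IsIso (coYon N a) :=
  ⟨coYonInv N a, by
    rw [coYon, Category.assoc, repι_coYonInv]
    simpa using VFun.freeUnit_desc (𝟙 (N.obj a)),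
    tensorObj.hom_ext (fun b => by
      have h : repι N b a ≫ coYonInv N a ≫ coYon N a = repι N b a := by
        rw [reassoc_of% repι_coYonInv, act_coYon, SymmetricCategory.symmetry_assoc]
      exact h.trans (Category.comp_id _).symm)⟩

instance tensorUnit_isIso (N : LeftMod V A) : IsIso (tensorUnit N) :=
  VFun.isIso_of_isIso_app _ (fun a => inferInstanceAs (IsIso (coYon N a)))

end TensorAdjunction

end

end EnrichedRingoid

namespace EnrichedRingoid

noncomputable section

section RightKanExtension

variable {V : Type u} [Category.{v} V] [MonoidalCategory V] [SymmetricCategory V]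
  [MonoidalClosed V] {B : Type w} [EnrichedCategory V B] {C : Type w'} [EnrichedCategory V C]

/-- The morphism `C(c,K(b)) ⊗ B(b,b') ⟶ C(c,K(b'))`. -/
def corepAct (K : EnrichedFunctor V B C) (c : C) (b b' : B) :
    (c ⟶[V] K.obj b) ⊗ (b ⟶[V] b') ⟶ (c ⟶[V] K.obj b') :=
  (c ⟶[V] K.obj b) ◁ K.map b b' ≫ eComp V _ _ _

lemma corep_restr_act (K : EnrichedFunctor V B C) (c : C) (b b' : B) :
    ((corep c).restr K).act b b' = corepAct K c b b' :=
  (VFun.restr_act K (corep c) b b').trans (congrArg (_ ≫ ·) (corep_act c _ _))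

lemma eComp_corepAct (K : EnrichedFunctor V B C) (c c' : C) (b b' : B) :
    eComp V c c' (K.obj b) ▷ _ ≫ corepAct K c b b' =
      (α_ _ _ _).hom ≫ _ ◁ corepAct K c' b b' ≫ eComp V c c' (K.obj b') := by
  rw [corepAct, corepAct, ← whisker_exchange_assoc, MonoidalCategory.whiskerLeft_comp,
    Category.assoc, ← e_assoc', associator_naturality_right_assoc]

lemma eId_corepAct (K : EnrichedFunctor V B C) (b b' : B) :
    eId V (K.obj b) ▷ _ ≫ corepAct K (K.obj b) b b' = (λ_ _).hom ≫ K.map b b' := by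
  rw [corepAct, ← whisker_exchange_assoc, eId_eComp, leftUnitor_naturality]

/-- The condition on a family `W ⊗ C(c,K(b)) ⟶ G(b)` to factor through the end
`∫_b [C(c,K(b)), G(b)]`. -/
def IsRanCone (K : EnrichedFunctor V B C) (G : VFun V B) (c : C) {W : V}
    (φ : ∀ b, W ⊗ (c ⟶[V] K.obj b) ⟶ G.obj b) : Prop :=
  ∀ b b', (α_ _ _ _).hom ≫ W ◁ corepAct K c b b' ≫ φ b' = φ b ▷ (b ⟶[V] b') ≫ G.act b b'

lemma braiding_tensor_swapRight (X Y Z : V) :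
    swapRight X Y Z ≫ (β_ X Z).hom ▷ Y ≫ (α_ _ _ _).hom = (β_ (X ⊗ Y) Z).hom := by
  rw [braiding_swapRight]
  simp [reassoc_of% swapRight_swapRight]

lemma isRanCone_iff (K : EnrichedFunctor V B C) (G : VFun V B) (c : C) {W : V}
    (φ : ∀ b, W ⊗ (c ⟶[V] K.obj b) ⟶ G.obj b) :
    IsRanCone K G c φ ↔ ∀ b b', corepAct K c b b' ▷ W ≫ (β_ _ _).hom ≫ φ b' =
      swapRight _ _ _ ≫ ((β_ (c ⟶[V] K.obj b) W).hom ≫ φ b) ▷ _ ≫ G.act b b' := by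
  refine forall₂_congr (fun b b' => ?_)
  rw [BraidedCategory.braiding_naturality_left_assoc, ← braiding_tensor_swapRight,
    comp_whiskerRight_assoc, Category.assoc, Category.assoc]
  have : IsIso (swapRight (c ⟶[V] K.obj b) (b ⟶[V] b') W) :=
    ⟨swapRight _ _ _, swapRight_swapRight _ _ _, swapRight_swapRight _ _ _⟩
  rw [cancel_epi, cancel_epi]

variable [EssentiallySmall.{v} (ForgetEnrichment V B)] [HasLimits V]

/-- The end `∫_b [C(c,K(b)), G(b)]`. -/
def ranObj (K : EnrichedFunctor V B C) (G : VFun V B) (c : C) : V :=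
  homObj ((corep c).restr K) G

/-- Evaluation `C(c,K(b)) ⊗ ∫_b [C(c,K(b)), G(b)] ⟶ G(b)`. -/
def ranEvLeft (K : EnrichedFunctor V B C) (G : VFun V B) (c : C) (b : B) :
    (c ⟶[V] K.obj b) ⊗ ranObj K G c ⟶ G.obj b :=
  homObj.ev ((corep c).restr K) G b

/-- The morphism `∫_b [C(c,K(b)), G(b)] ⊗ C(c,K(b)) ⟶ G(b)`. -/
def ranEv (K : EnrichedFunctor V B C) (G : VFun V B) (c : C) (b : B) :
    ranObj K G c ⊗ (c ⟶[V] K.obj b) ⟶ G.obj b :=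
  (β_ _ _).hom ≫ ranEvLeft K G c b

variable {K : EnrichedFunctor V B C} {G : VFun V B}

lemma ranEv_isRanCone (c : C) : IsRanCone K G c (ranEv K G c) := by
  refine (isRanCone_iff K G c _).2 (fun b b' => ?_)
  have h : corepAct K c b b' ▷ ranObj K G c ≫ ranEvLeft K G c b' =
      swapRight _ _ _ ≫ ranEvLeft K G c b ▷ _ ≫ G.act b b' :=
    (congrArg (fun f => f ▷ ranObj K G c ≫ ranEvLeft K G c b')
      (corep_restr_act K c b b')).symm.trans (homObj.ev_graded ((corep c).restr K) G b b')
  rw [ranEv, ranEv, SymmetricCategory.symmetry_assoc, SymmetricCategory.symmetry_assoc, h]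

lemma ranLift_aux {c : C} {W : V} {φ : ∀ b, W ⊗ (c ⟶[V] K.obj b) ⟶ G.obj b}
    (h : IsRanCone K G c φ) (b b' : B) :
    IsGraded ((corep c).restr K) G (W := W) ((β_ (c ⟶[V] K.obj b) W).hom ≫ φ b)
      ((β_ (c ⟶[V] K.obj b') W).hom ≫ φ b') :=
  (congrArg (fun f => f ▷ W ≫ (β_ (c ⟶[V] K.obj b') W).hom ≫ φ b')
    (corep_restr_act K c b b')).trans ((isRanCone_iff K G c φ).1 h b b')

/-- The universal property of the end `∫_b [C(c,K(b)), G(b)]`. -/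
def ranLift {c : C} {W : V} (φ : ∀ b, W ⊗ (c ⟶[V] K.obj b) ⟶ G.obj b)
    (h : IsRanCone K G c φ) : W ⟶ ranObj K G c :=
  homObj.lift (fun b => (β_ (c ⟶[V] K.obj b) W).hom ≫ φ b) (ranLift_aux h)

lemma ranLift_ranEv {c : C} {W : V} (φ : ∀ b, W ⊗ (c ⟶[V] K.obj b) ⟶ G.obj b)
    (h : IsRanCone K G c φ) (b : B) :
    ranLift φ h ▷ _ ≫ ranEv K G c b = φ b := by
  have e : (c ⟶[V] K.obj b) ◁ ranLift φ h ≫ ranEvLeft K G c b =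
      (β_ (c ⟶[V] K.obj b) W).hom ≫ φ b := homObj.lift_ev _ (ranLift_aux h) b
  rw [ranEv, BraidedCategory.braiding_naturality_left_assoc, e,
    SymmetricCategory.symmetry_assoc]

lemma ranObj_hom_ext {c : C} {W : V} {x y : W ⟶ ranObj K G c}
    (h : ∀ b, x ▷ _ ≫ ranEv K G c b = y ▷ _ ≫ ranEv K G c b) : x = y :=
  homObj.hom_ext (fun b => by
    have e : (c ⟶[V] K.obj b) ◁ x ≫ ranEvLeft K G c b =
        (c ⟶[V] K.obj b) ◁ y ≫ ranEvLeft K G c b := by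
      rw [← cancel_epi (β_ _ _).hom, ← BraidedCategory.braiding_naturality_left_assoc,
        ← BraidedCategory.braiding_naturality_left_assoc]
      exact h b
    exact e)

variable (K G)

lemma ranAct_aux (c c' : C) : IsRanCone K G c' (W := ranObj K G c ⊗ (c ⟶[V] c'))
    (fun b => (α_ _ _ _).hom ≫ ranObj K G c ◁ eComp V c c' (K.obj b) ≫ ranEv K G c b) := by
  intro b b'
  simp only [comp_whiskerRight, Category.assoc]
  rw [← ranEv_isRanCone c b b', associator_naturality_middle_assoc,
    ← MonoidalCategory.whiskerLeft_comp_assoc, eComp_corepAct, associator_naturality_right_assoc]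
  simp only [MonoidalCategory.whiskerLeft_comp, Category.assoc, pentagon_assoc]

/-- The action of `C` on the ends `∫_b [C(c,K(b)), G(b)]`. -/
def ranAct (c c' : C) : ranObj K G c ⊗ (c ⟶[V] c') ⟶ ranObj K G c' :=
  ranLift (fun b => (α_ _ _ _).hom ≫ ranObj K G c ◁ eComp V c c' (K.obj b) ≫ ranEv K G c b)
    (ranAct_aux K G c c')

lemma ranAct_ranEv (c c' : C) (b : B) : ranAct K G c c' ▷ _ ≫ ranEv K G c' b =
    (α_ _ _ _).hom ≫ ranObj K G c ◁ eComp V c c' (K.obj b) ≫ ranEv K G c b :=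
  ranLift_ranEv _ (ranAct_aux K G c c') b

lemma ranAct_id (c : C) :
    ranObj K G c ◁ eId V c ≫ ranAct K G c c = (ρ_ (ranObj K G c)).hom :=
  ranObj_hom_ext (fun b => by
    rw [comp_whiskerRight_assoc, ranAct_ranEv, associator_naturality_middle_assoc,
      ← MonoidalCategory.whiskerLeft_comp_assoc, eId_eComp]
    simp)

lemma ranAct_comp (a b c : C) : ranObj K G a ◁ eComp V a b c ≫ ranAct K G a c =
    (α_ _ _ _).inv ≫ ranAct K G a b ▷ _ ≫ ranAct K G b c :=
  ranObj_hom_ext (fun x => by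
    simp only [comp_whiskerRight, Category.assoc]
    rw [ranAct_ranEv, ranAct_ranEv, associator_naturality_middle_assoc,
      associator_naturality_left_assoc, ← whisker_exchange_assoc, ranAct_ranEv,
      ← MonoidalCategory.whiskerLeft_comp_assoc, ← e_assoc', associator_naturality_right_assoc]
    simp)

/-- The right Kan extension of `G` along `K`. -/
def ran : VFun V C :=
  VFun.ofAct (ranObj K G) (ranAct K G) (ranAct_id K G) (ranAct_comp K G)

lemma ran_act (c c' : C) : (ran K G).act c c' = ranAct K G c c' := VFun.ofAct_act _ _ _ _ c c'

/-- The counit `∫_x [C(K(b),K(x)), G(x)] ⟶ G(b)`. -/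
def ranε (b : B) : ranObj K G (K.obj b) ⟶ G.obj b :=
  (ρ_ _).inv ≫ _ ◁ eId V (K.obj b) ≫ ranEv K G (K.obj b) b

lemma ranAct_ranε (c : C) (b : B) : ranAct K G c (K.obj b) ≫ ranε K G b = ranEv K G c b := by
  rw [ranε, rightUnitor_inv_naturality_assoc, ← whisker_exchange_assoc, ranAct_ranEv,
    associator_naturality_right_assoc, ← MonoidalCategory.whiskerLeft_comp_assoc, eComp_eId]
  simp

lemma ranε_nat (b b' : B) :
    (ranObj K G (K.obj b) ◁ K.map b b' ≫ ranAct K G _ (K.obj b')) ≫ ranε K G b' =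
      ranε K G b ▷ _ ≫ G.act b b' := by
  rw [Category.assoc, ranAct_ranε, ranε]
  simp only [comp_whiskerRight, Category.assoc]
  rw [← ranEv_isRanCone, associator_naturality_middle_assoc,
    ← MonoidalCategory.whiskerLeft_comp_assoc, eId_corepAct]
  simp

/-- The counit of the right Kan extension. -/
def ranCounit : (restriction K).obj (ran K G) ⟶ G where
  app b := ranε K G b
  naturality b b' := (congrArg (· ≫ ranε K G b') ((VFun.restr_act K (ran K G) b b').trans
    (congrArg (ranObj K G (K.obj b) ◁ K.map b b' ≫ ·) (ran_act K G _ _)))).trans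
      (ranε_nat K G b b')

lemma isEnrichedRan_ranCounit : IsEnrichedRan K G (ran K G) (ranCounit K G) := by
  intro c W φ h
  have e : ∀ (x : W ⟶ ranObj K G c) (b : B), x ▷ (c ⟶[V] K.obj b) ≫ (ran K G).act c (K.obj b) ≫
      (ranCounit K G).app b = x ▷ _ ≫ ranEv K G c b := fun x b =>
    congrArg (x ▷ _ ≫ ·) ((congrArg (· ≫ ranε K G b) (ran_act K G c (K.obj b))).trans
      (ranAct_ranε K G c b))
  refine ⟨ranLift φ h, fun b => (e _ b).trans (ranLift_ranEv φ h b), fun y hy => ?_⟩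
  exact ranObj_hom_ext (fun b => ((e y b).symm.trans (hy b)).trans (ranLift_ranEv φ h b).symm)

variable {K G}

section Lift

variable {Y : VFun V C} (f : ∀ b, Y.obj (K.obj b) ⟶ G.obj b)
  (hf : ∀ b b', (Y.obj (K.obj b) ◁ K.map b b' ≫ Y.act (K.obj b) (K.obj b')) ≫ f b' =
    f b ▷ _ ≫ G.act b b')

include hf in
lemma ranHom_aux (c : C) : IsRanCone K G c (fun b => Y.act c (K.obj b) ≫ f b) := by
  intro b b'
  rw [comp_whiskerRight_assoc, ← hf, corepAct, MonoidalCategory.whiskerLeft_comp_assoc,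
    reassoc_of% @VFun.act_comp, Category.assoc, ← whisker_exchange_assoc,
    associator_inv_naturality_right_assoc, Iso.hom_inv_id_assoc]

/-- The components of the morphism to the right Kan extension. -/
def ranHomApp (c : C) : Y.obj c ⟶ ranObj K G c :=
  ranLift (fun b => Y.act c (K.obj b) ≫ f b) (ranHom_aux f hf c)

lemma ranHomApp_ranEv (c : C) (b : B) :
    ranHomApp f hf c ▷ _ ≫ ranEv K G c b = Y.act c (K.obj b) ≫ f b :=
  ranLift_ranEv _ (ranHom_aux f hf c) b

lemma ranHomApp_nat (c c' : C) :
    Y.act c c' ≫ ranHomApp f hf c' = ranHomApp f hf c ▷ _ ≫ ranAct K G c c' :=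
  ranObj_hom_ext (fun b => by
    rw [comp_whiskerRight_assoc, comp_whiskerRight_assoc, ranHomApp_ranEv, ranAct_ranEv,
      associator_naturality_left_assoc, ← whisker_exchange_assoc, ranHomApp_ranEv,
      reassoc_of% @VFun.act_comp, Iso.hom_inv_id_assoc])

lemma ranHomApp_ranε (b : B) : ranHomApp f hf (K.obj b) ≫ ranε K G b = f b := by
  rw [ranε, rightUnitor_inv_naturality_assoc, ← whisker_exchange_assoc, ranHomApp_ranEv,
    reassoc_of% @VFun.act_id, Iso.inv_hom_id_assoc]

end Lift

omit [EssentiallySmall.{v} (ForgetEnrichment V B)] [HasLimits V] in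
lemma hom_restr_nat {Y : VFun V C} (f : (restriction K).obj Y ⟶ G) (b b' : B) :
    (Y.obj (K.obj b) ◁ K.map b b' ≫ Y.act (K.obj b) (K.obj b')) ≫ f.app b' =
      f.app b ▷ _ ≫ G.act b b' :=
  (congrArg (· ≫ f.app b') (VFun.restr_act K Y b b')).symm.trans (f.nat b b')

/-- The morphism `Y ⟶ Ran_K G` corresponding to a morphism `Y ∘ K ⟶ G`. -/
def ranHom {Y : VFun V C} (f : (restriction K).obj Y ⟶ G) : Y ⟶ ran K G where
  app c := ranHomApp (fun b => f.app b) (hom_restr_nat f) c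
  naturality c c' := (ranHomApp_nat _ (hom_restr_nat f) c c').trans
    (congrArg (_ ≫ ·) (ran_act K G c c').symm)

variable (K G) in
/-- Morphisms to the right Kan extension. -/
def ranEquiv (Y : VFun V C) : ((restriction K).obj Y ⟶ G) ≃ (Y ⟶ ran K G) where
  toFun := ranHom
  invFun t := (restriction K).map t ≫ ranCounit K G
  left_inv f := VFun.hom_ext (fun b => ranHomApp_ranε _ (hom_restr_nat f) b)
  right_inv t := VFun.hom_ext (fun c => ranObj_hom_ext (fun b =>
    (ranHomApp_ranEv _ (hom_restr_nat ((restriction K).map t ≫ ranCounit K G)) c b).trans (by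
      have h : Y.act c (K.obj b) ≫ t.app (K.obj b) = t.app c ▷ _ ≫ ranAct K G c (K.obj b) :=
        (t.nat c (K.obj b)).trans (congrArg (_ ≫ ·) (ran_act K G _ _))
      refine ((reassoc_of% h) (ranε K G b)).trans ((Category.assoc _ _ _).trans ?_)
      exact congrArg (t.app c ▷ _ ≫ ·) (ranAct_ranε K G c b))))

lemma ranEquiv_symm_naturality (K : EnrichedFunctor V B C) (G : VFun V B) (Y Y' : VFun V C)
    (s : Y' ⟶ Y) (t : Y ⟶ ran K G) :
    (ranEquiv K G Y').symm (s ≫ t) = (restriction K).map s ≫ (ranEquiv K G Y).symm t :=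
  VFun.hom_ext (fun b => Category.assoc (s.app (K.obj b)) (t.app (K.obj b)) (ranε K G b))

variable (K)

/-- Right Kan extension along `K`. -/
def ranFunctor : VFun V B ⥤ VFun V C :=
  Adjunction.rightAdjointOfEquiv (F := restriction K) (G_obj := ran K)
    (fun Y G => ranEquiv K G Y)
    (fun Y' Y G s f => by
      apply (ranEquiv K G Y').symm.injective
      rw [Equiv.symm_apply_apply, ranEquiv_symm_naturality, Equiv.symm_apply_apply])

/-- Restriction along `K` is left adjoint to right Kan extension along `K`. -/
def ranAdjunction : restriction (V := V) K ⊣ ranFunctor K :=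
  Adjunction.adjunctionOfEquivRight _ _

lemma ranAdjunction_counit_app (G : VFun V B) :
    (ranAdjunction K).counit.app G = ranCounit K G := by
  refine (Adjunction.adjunctionOfEquivRight_counit_app _ _ G).trans ?_
  exact VFun.hom_ext (fun b => Category.id_comp (ranε K G b))

lemma isEnrichedRan_counit (G : VFun V B) :
    IsEnrichedRan K G ((ranFunctor K).obj G) ((ranAdjunction K).counit.app G) := by
  rw [ranAdjunction_counit_app]
  exact isEnrichedRan_ranCounit K G

end RightKanExtension

end

end EnrichedRingoid

namespace EnrichedRingoid

noncomputable section

section AdjointTriple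

variable {C : Type*} [Category* C] [Abelian C] {Q : Type*} [Category* Q] [Abelian Q]
  {rL : Q ⥤ C} {r : C ⥤ Q} {rR : Q ⥤ C}

section Kernel

variable {P : ObjectProperty C} (hP : ∀ Y, P Y ↔ IsZero (r.obj Y))

include hP

lemma eq_inverseImage_isZero : P = ObjectProperty.inverseImage (IsZero (C := Q)) r := by
  ext Y
  exact hP Y

lemma isSerreClass_of_exact [PreservesFiniteLimits r] [PreservesFiniteColimits r] :
    P.IsSerreClass := by
  rw [eq_inverseImage_isZero hP]
  infer_instance

lemma isClosedUnderColimits_of_preserves (J : Type*) [Category* J]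
    [PreservesColimitsOfShape J r] : P.IsClosedUnderColimitsOfShape J where
  colimitsOfShape_le := by
    rintro X ⟨h⟩
    refine (hP X).2 ((IsZero.iff_id_eq_zero _).2 ?_)
    exact (isColimitOfPreserves r h.isColimit).hom_ext
      (fun j => ((hP _).1 (h.prop_diag_obj j)).eq_of_src _ _)

lemma eq_zero_of_isZero_map (aR : r ⊣ rR) {Y : C} (hY : P Y) {N : Q} (f : Y ⟶ rR.obj N) : f = 0 :=
  (aR.homEquiv Y N).symm.injective (((hP Y).1 hY).eq_of_src _ _)

lemma eq_zero_of_isZero_map' (aL : rL ⊣ r) {Y : C} (hY : P Y) {N : Q} (f : rL.obj N ⟶ Y) : f = 0 :=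
  (aL.homEquiv N Y).injective (((hP Y).1 hY).eq_of_tgt _ _)

lemma prop_of_mono_of_map_eq_zero [PreservesFiniteLimits r] {X Y : C} (f : X ⟶ Y) [Mono f]
    (h : r.map f = 0) : P X :=
  (hP X).2 (IsZero.of_mono_eq_zero _ h)

lemma prop_of_epi_of_map_eq_zero [PreservesFiniteColimits r] {X Y : C} (f : X ⟶ Y) [Epi f]
    (h : r.map f = 0) : P Y :=
  (hP Y).2 (IsZero.of_epi_eq_zero _ h)

end Kernel

section Torsion

variable {P : ObjectProperty C} (hP : ∀ Y, P Y ↔ IsZero (r.obj Y)) (aL : rL ⊣ r) (aR : r ⊣ rR)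

include hP aL in
lemma kernel_unit_prop [rR.Full] [rR.Faithful] (X : C) : P (kernel (aR.unit.app X)) := by
  have := aL.rightAdjoint_preservesLimits
  have := aR.isLeftAdjoint
  have := r.preservesZeroMorphisms_of_isLeftAdjoint
  apply prop_of_mono_of_map_eq_zero hP (kernel.ι (aR.unit.app X))
  rw [← cancel_mono (r.map (aR.unit.app X)), ← r.map_comp, kernel.condition, r.map_zero, zero_comp]

include hP aR in
lemma cokernel_counit_prop [rL.Full] [rL.Faithful] (X : C) :
    P (cokernel (aL.counit.app X)) := by
  have := aR.leftAdjoint_preservesColimits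
  have := aR.isLeftAdjoint
  have := r.preservesZeroMorphisms_of_isLeftAdjoint
  apply prop_of_epi_of_map_eq_zero hP (cokernel.π (aL.counit.app X))
  rw [← cancel_epi (r.map (aL.counit.app X)), ← r.map_comp, cokernel.condition, r.map_zero,
    comp_zero]

/-- Morphisms from an object of the kernel of `r` to `X` factor through the kernel of the unit
`X ⟶ rR (r X)`. -/
def torsionEquiv [rR.Full] [rR.Faithful] (Y : P.FullSubcategory) (X : C) :
    (P.ι.obj Y ⟶ X) ≃
      (Y ⟶ (⟨kernel (aR.unit.app X), kernel_unit_prop hP aL aR X⟩ : P.FullSubcategory)) where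
  toFun f := ObjectProperty.homMk
    (kernel.lift _ f (eq_zero_of_isZero_map hP aR Y.property _))
  invFun g := P.ι.map g ≫ kernel.ι _
  left_inv f := kernel.lift_ι _ _ _
  right_inv g := by
    apply P.ι.map_injective
    exact (cancel_mono (kernel.ι (aR.unit.app X))).1 (kernel.lift_ι _ _ _)

/-- The functor sending `X` to the kernel of the unit `X ⟶ rR (r X)`. -/
def torsionRight [rR.Full] [rR.Faithful] : C ⥤ P.FullSubcategory :=
  Adjunction.rightAdjointOfEquiv (torsionEquiv hP aL aR) (fun Y' Y X f g => by
    apply (torsionEquiv hP aL aR Y' X).symm.injective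
    refine (Equiv.symm_apply_apply _ _).trans ?_
    refine (congrArg (P.ι.map f ≫ ·) ((torsionEquiv hP aL aR Y X).symm_apply_apply g).symm).trans ?_
    exact (Category.assoc _ _ _).symm.trans
      (congrArg (· ≫ kernel.ι (aR.unit.app X)) (P.ι.map_comp f _).symm))

/-- The inclusion of the kernel of `r` is left adjoint to `torsionRight`. -/
def torsionRightAdjunction [rR.Full] [rR.Faithful] : P.ι ⊣ torsionRight hP aL aR :=
  Adjunction.adjunctionOfEquivRight _ _

lemma torsionRightAdjunction_counit_app [rR.Full] [rR.Faithful] (X : C) :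
    (torsionRightAdjunction hP aL aR).counit.app X = kernel.ι (aR.unit.app X) := by
  refine (Adjunction.adjunctionOfEquivRight_counit_app _ _ X).trans ?_
  exact Category.id_comp _

lemma isTorsionFunctor_torsionRight [rR.Full] [rR.Faithful] :
    IsTorsionFunctor P (torsionRightAdjunction hP aL aR) := by
  intro X
  rw [torsionRightAdjunction_counit_app]
  exact ⟨inferInstanceAs (Mono (kernel.ι (aR.unit.app X))), fun Y f hY _ =>
    ⟨kernel.lift _ f (eq_zero_of_isZero_map hP aR hY _), kernel.lift_ι _ _ _⟩⟩

/-- Morphisms from `X` to an object of the kernel of `r` factor through the cokernel of the counit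
`rL (r X) ⟶ X`. -/
def torsionFreeEquiv [rL.Full] [rL.Faithful] (X : C) (Y : P.FullSubcategory) :
    ((⟨cokernel (aL.counit.app X), cokernel_counit_prop hP aL aR X⟩ : P.FullSubcategory) ⟶ Y) ≃
      (X ⟶ P.ι.obj Y) where
  toFun g := cokernel.π (aL.counit.app X) ≫ P.ι.map g
  invFun f := ObjectProperty.homMk
    (cokernel.desc _ f (eq_zero_of_isZero_map' hP aL Y.property _))
  right_inv f := cokernel.π_desc _ _ _
  left_inv g := by
    apply P.ι.map_injective
    exact (cancel_epi (cokernel.π (aL.counit.app X))).1 (cokernel.π_desc _ _ _)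

/-- The functor sending `X` to the cokernel of the counit `rL (r X) ⟶ X`. -/
def torsionLeft [rL.Full] [rL.Faithful] : C ⥤ P.FullSubcategory :=
  Adjunction.leftAdjointOfEquiv (G := P.ι) (torsionFreeEquiv hP aL aR) (fun X _ _ g h =>
    (congrArg (cokernel.π (aL.counit.app X) ≫ ·) (P.ι.map_comp h g)).trans
      (Category.assoc _ _ _).symm)

/-- The inclusion of the kernel of `r` is right adjoint to `torsionLeft`. -/
def torsionLeftAdjunction [rL.Full] [rL.Faithful] : torsionLeft hP aL aR ⊣ P.ι :=
  Adjunction.adjunctionOfEquivLeft _ _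

include hP in
omit [Abelian C] in
lemma essImage_ι_iff (X : C) : P.ι.essImage X ↔ IsZero (r.obj X) := by
  constructor
  · rintro ⟨Y, ⟨e⟩⟩
    exact ((hP _).1 Y.property).of_iso (r.mapIso e.symm)
  · intro h
    exact ⟨⟨X, (hP X).2 h⟩, ⟨Iso.refl _⟩⟩

end Torsion

section Closed

variable {P : ObjectProperty C} (hP : ∀ Y, P Y ↔ IsZero (r.obj Y)) (aR : r ⊣ rR)
  [PreservesFiniteLimits r]
  {X I₀ I₁ I₂ : C} (i : X ⟶ I₀) [Mono i] (d₀ : I₀ ⟶ I₁) (d₁ : I₁ ⟶ I₂) (w : i ≫ d₀ = 0)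
  (hi : ∀ {A : C} (f : A ⟶ I₀), f ≫ d₀ = 0 → ∃ g, g ≫ i = f)

include hP aR w hi in
lemma exists_lift_of_isIso_unit (w' : d₀ ≫ d₁ = 0) (hd : (ShortComplex.mk d₀ d₁ w').Exact)
    [IsIso (aR.unit.app X)] {K : C} (hK : P K) (k : K ⟶ I₁) (hk : k ≫ d₁ = 0) :
    ∃ s, s ≫ d₀ = k := by
  have := aR.isLeftAdjoint
  have := r.preservesZeroMorphisms_of_isLeftAdjoint
  have : Epi (kernel.lift d₁ d₀ w') := hd.epi_kernelLift
  let e := kernel.lift d₁ d₀ w'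
  let k' := kernel.lift d₁ k hk
  have he : e ≫ kernel.ι d₁ = d₀ := kernel.lift_ι _ _ _
  have hk' : k' ≫ kernel.ι d₁ = k := kernel.lift_ι _ _ _
  have he' : ∀ {A : C} (x : A ⟶ I₀), x ≫ d₀ = x ≫ e ≫ kernel.ι d₁ := fun x =>
    congrArg (x ≫ ·) he.symm
  have hie : i ≫ e = 0 := by
    rw [← cancel_mono (kernel.ι d₁), Category.assoc, he, w, zero_comp]
  let j : X ⟶ pullback e k' := pullback.lift i 0 (by rw [hie, zero_comp])
  have hj₁ : j ≫ pullback.fst e k' = i := pullback.lift_fst _ _ _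
  have hj₂ : j ≫ pullback.snd e k' = 0 := pullback.lift_snd _ _ _
  have : Mono j := mono_of_mono_fac hj₁
  have : Epi (pullback.snd e k') := inferInstance
  let S := ShortComplex.mk j (pullback.snd e k') hj₂
  have hS : S.ShortExact := by
    refine ShortComplex.ShortExact.mk' ?_ ‹_› ‹_›
    refine ShortComplex.exact_of_f_is_kernel S (KernelFork.IsLimit.ofι' _ _ (fun {A} f hf => ?_))
    have hf' : f ≫ pullback.snd e k' = 0 := hf
    have h : (f ≫ pullback.fst e k') ≫ d₀ = 0 := by
      rw [Category.assoc, he', pullback.condition_assoc, reassoc_of% hf', zero_comp]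
    refine ⟨(hi _ h).choose, ?_⟩
    apply pullback.hom_ext
    · exact (Category.assoc _ _ _).trans ((congrArg (_ ≫ ·) hj₁).trans (hi _ h).choose_spec)
    · exact (Category.assoc _ _ _).trans ((congrArg (_ ≫ ·) hj₂).trans (comp_zero.trans hf'.symm))
  have : IsIso (r.map j) := (hS.map_of_exact r).isIso_f_iff.2 ((hP K).1 hK)
  let ρ : pullback e k' ⟶ X := aR.unit.app (pullback e k') ≫ rR.map (inv (r.map j)) ≫ inv (aR.unit.app X)
  have hρ : j ≫ ρ = 𝟙 X := by
    have h : j ≫ aR.unit.app (pullback e k') = aR.unit.app X ≫ rR.map (r.map j) :=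
      aR.unit.naturality j
    refine (reassoc_of% h) _ |>.trans ?_
    rw [← rR.map_comp_assoc, IsIso.hom_inv_id, rR.map_id, Category.id_comp,
      IsIso.hom_inv_id]
  obtain ⟨s, hs⟩ : ∃ s, pullback.snd e k' ≫ s = pullback.fst e k' - ρ ≫ i :=
    have h : j ≫ (pullback.fst e k' - ρ ≫ i) = 0 := by
      rw [Preadditive.comp_sub, hj₁, reassoc_of% hρ, sub_self]
    ⟨hS.exact.desc _ h, hS.exact.g_desc _ h⟩
  refine ⟨s, ?_⟩
  rw [← cancel_epi (pullback.snd e k'), reassoc_of% hs, Preadditive.sub_comp, Category.assoc, w,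
    comp_zero, sub_zero, he', pullback.condition_assoc, hk']

include hP aR w hi in
lemma isIso_unit_of_exists_lift [rR.Full] [rR.Faithful] [Injective I₀]
    (hd : d₀ ≫ d₁ = 0) (hX : ∀ {Y : C} (_ : P Y) (f : Y ⟶ X), f = 0)
    (h : ∀ {K : C} (_ : P K) (k : K ⟶ I₁), k ≫ d₁ = 0 → ∃ s, s ≫ d₀ = k) :
    IsIso (aR.unit.app X) := by
  have := aR.isLeftAdjoint
  have := r.preservesZeroMorphisms_of_isLeftAdjoint
  have := aR.leftAdjoint_preservesColimits
  let η : X ⟶ rR.obj (r.obj X) := aR.unit.app X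
  have : IsIso (r.map η) := inferInstanceAs (IsIso (r.map (aR.unit.app X)))
  have hmono : Mono η := Preadditive.mono_of_kernel_zero (hX
    (prop_of_mono_of_map_eq_zero hP (kernel.ι η) (by
      rw [← cancel_mono (r.map η), ← r.map_comp, kernel.condition, r.map_zero, zero_comp]))
    (kernel.ι η))
  have hQ : P (cokernel η) := prop_of_epi_of_map_eq_zero hP (cokernel.π η) (by
    rw [← cancel_epi (r.map η), ← r.map_comp, cokernel.condition, r.map_zero, comp_zero])
  let g := Injective.factorThru i η
  have hg : η ≫ g = i := Injective.comp_factorThru i η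
  have hg' : η ≫ g ≫ d₀ = 0 := by rw [reassoc_of% hg, w]
  obtain ⟨u, hu⟩ := h hQ (cokernel.desc η (g ≫ d₀) hg') (by
    rw [← cancel_epi (cokernel.π η), cokernel.π_desc_assoc, Category.assoc, hd, comp_zero,
      comp_zero])
  obtain ⟨ρ, hρ⟩ := hi (g - cokernel.π η ≫ u) (by
    rw [Preadditive.sub_comp, Category.assoc, hu, cokernel.π_desc, sub_self])
  have hηρ : η ≫ ρ = 𝟙 X := by
    rw [← cancel_mono i, Category.assoc, hρ, Preadditive.comp_sub, hg, cokernel.condition_assoc,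
      zero_comp, sub_zero, Category.id_comp]
  have h0 : η ≫ (𝟙 _ - ρ ≫ η) = 0 := by
    rw [Preadditive.comp_sub, reassoc_of% hηρ, Category.comp_id, sub_self]
  have h1 : 𝟙 _ - ρ ≫ η = 0 := by
    rw [← cokernel.π_desc η _ h0, eq_zero_of_isZero_map hP aR hQ (cokernel.desc η _ h0), comp_zero]
  exact ⟨ρ, hηρ, (sub_eq_zero.1 h1).symm⟩

end Closed

section ClosedObjects

variable {P : ObjectProperty C} {R : C ⥤ P.FullSubcategory} {adj : P.ι ⊣ R}

variable (adj) in
/-- The counit `t(X) ⟶ X`. -/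
def torsionι (X : C) : (R ⋙ P.ι).obj X ⟶ X := adj.counit.app X

lemma map_torsionι {X Y : C} (f : X ⟶ Y) :
    (R ⋙ P.ι).map f ≫ torsionι adj Y = torsionι adj X ≫ f := adj.counit.naturality f

lemma exists_lift_torsionι {X Y : C} (hY : P Y) (f : Y ⟶ X) :
    ∃ g : Y ⟶ (R ⋙ P.ι).obj X, g ≫ torsionι adj X = f := by
  let Y' : P.FullSubcategory := ⟨Y, hY⟩
  let f' : P.ι.obj Y' ⟶ X := f
  exact ⟨P.ι.map (adj.homEquiv Y' X f'), (adj.homEquiv_counit Y' X _).symm.trans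
    ((adj.homEquiv Y' X).symm_apply_apply f')⟩

lemma torsion_prop (X : C) : P ((R ⋙ P.ι).obj X) := (R.obj X).property

variable (ht : ∀ X, Mono (torsionι adj X))
include ht

lemma isZero_torsion_iff (X : C) :
    IsZero ((R ⋙ P.ι).obj X) ↔ ∀ {Y : C} (_ : P Y) (f : Y ⟶ X), f = 0 := by
  have := ht X
  constructor
  · intro h Y hY f
    obtain ⟨g, hg⟩ := exists_lift_torsionι (adj := adj) hY f
    rw [← hg, show g = 0 from h.eq_of_tgt _ _, zero_comp]
  · intro h
    exact IsZero.of_mono_eq_zero _ (h (torsion_prop X) (torsionι adj X))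

lemma exact_torsion_iff [P.IsSerreClass] {X I₀ I₁ I₂ : C} (i : X ⟶ I₀) (d₀ : I₀ ⟶ I₁)
    (d₁ : I₁ ⟶ I₂) (hi : ∀ {A : C} (f : A ⟶ I₀), f ≫ d₀ = 0 → ∃ g, g ≫ i = f)
    (hX : ∀ {Y : C} (_ : P Y) (f : Y ⟶ X), f = 0)
    (w : (R ⋙ P.ι).map d₀ ≫ (R ⋙ P.ι).map d₁ = 0) :
    (ShortComplex.mk _ _ w).Exact ↔
      ∀ {K : C} (_ : P K) (k : K ⟶ I₁), k ≫ d₁ = 0 → ∃ s, s ≫ d₀ = k := by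
  have h₀ := ht I₀
  have h₁ := ht I₁
  have h₂ := ht I₂
  have hP : ∀ {A B : C} (f : A ⟶ B) [Mono f], P B → P A := fun f _ h => P.prop_of_mono f h
  have hmono : Mono ((R ⋙ P.ι).map d₀) := Preadditive.mono_of_kernel_zero (by
    have hk : P (kernel ((R ⋙ P.ι).map d₀)) := hP (kernel.ι _) (torsion_prop I₀)
    obtain ⟨g, hg⟩ := hi (kernel.ι ((R ⋙ P.ι).map d₀) ≫ torsionι adj I₀) (by
      rw [Category.assoc, ← map_torsionι, kernel.condition_assoc, zero_comp])
    rw [← cancel_mono (torsionι adj I₀), ← hg, hX hk g, zero_comp, zero_comp])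
  constructor
  · intro h K hK k hk
    obtain ⟨k', rfl⟩ := exists_lift_torsionι (adj := adj) hK k
    have hk' : k' ≫ (R ⋙ P.ι).map d₁ = 0 := by
      rw [← cancel_mono (torsionι adj I₂), Category.assoc, map_torsionι, ← Category.assoc, hk,
        zero_comp]
    refine ⟨h.lift k' hk' ≫ torsionι adj I₀, ?_⟩
    rw [Category.assoc, ← map_torsionι, ← Category.assoc]
    exact congrArg (· ≫ torsionι adj I₁) (h.lift_f k' hk')
  · intro h
    have hk : P (kernel ((R ⋙ P.ι).map d₁)) := hP (kernel.ι _) (torsion_prop I₁)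
    obtain ⟨s, hs⟩ := h hk (kernel.ι _ ≫ torsionι adj I₁) (by
      rw [Category.assoc, ← map_torsionι, kernel.condition_assoc, zero_comp])
    obtain ⟨s, rfl⟩ := exists_lift_torsionι (adj := adj) hk s
    rw [ShortComplex.exact_iff_kernel_ι_comp_cokernel_π_zero]
    have e : kernel.ι ((R ⋙ P.ι).map d₁) = s ≫ (R ⋙ P.ι).map d₀ := by
      rw [← cancel_mono (torsionι adj I₁), Category.assoc, map_torsionι, ← hs, Category.assoc]
    exact (congrArg (· ≫ _) e).trans ((Category.assoc _ _ _).trans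
      ((congrArg (s ≫ ·) (cokernel.condition _)).trans comp_zero))

omit ht in
lemma isZero_rightDerived_one_iff [EnoughInjectives C] (F : C ⥤ C) [F.Additive] {X : C}
    (I : InjectiveResolution X) (w : F.map (I.cocomplex.d 0 1) ≫ F.map (I.cocomplex.d 1 2) = 0) :
    IsZero ((F.rightDerived 1).obj X) ↔ (ShortComplex.mk _ _ w).Exact := by
  rw [(I.isoRightDerivedObj F 1).isZero_iff]
  refine (HomologicalComplex.exactAt_iff_isZero_homology _ 1).symm.trans ?_
  exact HomologicalComplex.exactAt_iff' _ 0 1 2 (by simp) (by simp)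

lemma closedObjects_iff [EnoughInjectives C] (hP : ∀ Y, P Y ↔ IsZero (r.obj Y)) (aR : r ⊣ rR)
    [PreservesFiniteLimits r] [PreservesFiniteColimits r] [rR.Full] [rR.Faithful] (X : C) :
    closedObjects adj X ↔ IsIso (aR.unit.app X) := by
  have := torsion_additive adj
  have : P.IsSerreClass := isSerreClass_of_exact hP
  let I := injectiveResolution X
  let e : X ≅ ((CochainComplex.single₀ C).obj X).X 0 := Iso.refl X
  let i : X ⟶ I.cocomplex.X 0 := e.hom ≫ I.ι.f 0
  have : Mono i := mono_comp _ _
  have w : i ≫ I.cocomplex.d 0 1 = 0 := by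
    rw [Category.assoc, I.ι_f_zero_comp_complex_d, comp_zero]
  have hi : ∀ {A : C} (f : A ⟶ I.cocomplex.X 0), f ≫ I.cocomplex.d 0 1 = 0 → ∃ g, g ≫ i = f :=
    fun f hf => by
      obtain ⟨g, hg⟩ : ∃ g : _ ⟶ ((CochainComplex.single₀ C).obj X).X 0, g ≫ I.ι.f 0 = f :=
        ⟨_, (KernelFork.IsLimit.lift' I.isLimitKernelFork f hf).2⟩
      exact ⟨g ≫ e.inv, by rw [Category.assoc, Iso.inv_hom_id_assoc, hg]⟩
  have w' : (R ⋙ P.ι).map (I.cocomplex.d 0 1) ≫ (R ⋙ P.ι).map (I.cocomplex.d 1 2) = 0 := by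
    rw [← Functor.map_comp, I.complex_d_comp, Functor.map_zero]
  have : Injective (I.cocomplex.X 0) := I.injective 0
  rw [closedObjects, isZero_torsion_iff ht, isZero_rightDerived_one_iff _ I w']
  constructor
  · rintro ⟨hX, h⟩
    exact isIso_unit_of_exists_lift hP aR i _ _ w hi (I.complex_d_comp 0) hX
      ((exact_torsion_iff ht i _ _ hi hX w').1 h)
  · intro h
    have hX : ∀ {Y : C} (_ : P Y) (f : Y ⟶ X), f = 0 := fun {Y} hY f =>
      (cancel_mono (aR.unit.app X)).1 ((eq_zero_of_isZero_map hP aR hY _).trans zero_comp.symm)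
    exact ⟨hX, (exact_torsion_iff ht i _ _ hi hX w').2 (fun hK k hk =>
      exists_lift_of_isIso_unit hP aR i _ _ w hi _ (I.exact_succ 0) hK k hk)⟩

end ClosedObjects

section Quotient

variable {D : ObjectProperty C} (aR : r ⊣ rR) (hD : ∀ X, D X ↔ IsIso (aR.unit.app X))
  [rR.Full] [rR.Faithful]

include hD

/-- The functor from `Q` to the full subcategory of the objects `X` with `X ≅ rR (r X)`. -/
def liftRight : Q ⥤ D.FullSubcategory :=
  D.lift rR (fun _ => (hD _).2 inferInstance)

instance : (liftRight aR hD).IsEquivalence where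
  faithful := inferInstanceAs (D.lift rR _).Faithful
  full := inferInstanceAs (D.lift rR _).Full
  essSurj := ⟨fun X => ⟨r.obj X.obj, ⟨by
    have := (hD X.obj).1 X.property
    exact D.isoMk (asIso (aR.unit.app X.obj)).symm⟩⟩⟩

/-- The functor `X ↦ rR (r X)` to the full subcategory of the objects `X` with `X ≅ rR (r X)` is
left adjoint to the inclusion. -/
def reflectionAdjunction : r ⋙ liftRight aR hD ⊣ D.ι :=
  (aR.comp (liftRight aR hD).asEquivalence.toAdjunction).ofNatIsoRight
    (show (liftRight aR hD).asEquivalence.inverse ⋙ rR ≅ D.ι from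
      (Functor.associator _ (liftRight aR hD) D.ι).symm ≪≫
      Functor.isoWhiskerRight (liftRight aR hD).asEquivalence.counitIso D.ι ≪≫
      D.ι.leftUnitor)

lemma isEquivalence_reflection (aL : rL ⊣ r) [IsIso aL.unit] :
    (rL ⋙ r ⋙ liftRight aR hD).IsEquivalence :=
  Functor.isEquivalence_of_iso (Functor.isoWhiskerRight (asIso aL.unit) (liftRight aR hD))

end Quotient

end AdjointTriple

end

end EnrichedRingoid

namespace EnrichedRingoid

section Vanishing

variable (V : Type u) [Category.{v} V] [Abelian V] [IsGrothendieckAbelian.{v} V]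
  [MonoidalCategory V] [SymmetricCategory V] [MonoidalClosed V] [IsFinitelyPresentable.{v} (𝟙_ V)]
  (A : Type w) [EnrichedCategory V A] [EssentiallySmall.{v} (ForgetEnrichment V A)]

lemma vanishing_iff (Y : GenMod V A) :
    vanishing V A Y ↔ IsZero ((restrictionToA V A).obj Y) :=
  (VFun.isZero_iff ((restrictionToA V A).obj Y)).symm

variable {V A} in
lemma vanishing_copower (Y : GenMod V A) (W : V) (h : vanishing V A Y) :
    vanishing V A (Y.copower W) :=
  fun a => (tensorRight W).map_isZero (h a)

instance : IsIso (tensorAdjunction V A).unit := by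
  have (N : LeftMod V A) : IsIso ((tensorAdjunction V A).unit.app N) := by
    have h : (tensorAdjunction V A).unit.app N = tensorUnit N := by
      simp [tensorAdjunction]
    rw [h]
    exact tensorUnit_isIso N
  exact NatIso.isIso_of_isIso_app _

end Vanishing

end EnrichedRingoid

theorem mainTheorem5
    (V : Type u) [Category.{v} V] [Abelian V] [IsGrothendieckAbelian.{v} V]
    [MonoidalCategory V] [SymmetricCategory V] [MonoidalClosed V]
    [IsFinitelyPresentable.{v} (𝟙_ V)]
    (I : Type v) (g : I → V) (hg : (ObjectProperty.ofObj g).IsSeparating)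
    (hdual : ∀ i, Nonempty (HasRightDual (g i)))
    (A : Type w) [EnrichedCategory V A] [EssentiallySmall.{v} (ForgetEnrichment V A)] :
    ∃ (_ : Abelian (LeftMod V A)) (_ : IsGrothendieckAbelian.{v} (LeftMod V A))
      (_ : Abelian (GenMod V A)) (_ : IsGrothendieckAbelian.{v} (GenMod V A)),
      (IsLocalizing.{v} (vanishing V A) ∧
        ∀ (Y : GenMod V A) (W : V), vanishing V A Y → vanishing V A (Y.copower W)) ∧
      ∃ (iL iR : GenMod V A ⥤ (vanishing V A).FullSubcategory)
        (rR : LeftMod V A ⥤ GenMod V A)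
        (R : Recollement iL (vanishing V A).ι iR tensorFunctor (restrictionToA V A) rR),
        (∀ N : LeftMod V A, IsEnrichedRan (yonedaFp V A) N (rR.obj N) (R.adjRR.counit.app N)) ∧
        IsTorsionFunctor (vanishing V A) R.adjIR ∧
        ∃ (L : GenMod V A ⥤ (closedObjects R.adjIR).FullSubcategory)
          (_ : L ⊣ (closedObjects R.adjIR).ι), (tensorFunctor ⋙ L).IsEquivalence := by
  have := essentiallySmall_fpMod V A hg hdual
  refine ⟨inferInstance, inferInstance, inferInstance, inferInstance, ?_⟩
  let aL := tensorAdjunction V A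
  let aR := ranAdjunction (yonedaFp V A)
  have hP := vanishing_iff V A
  have fL : (tensorFunctor (V := V) (A := A)).FullyFaithful := aL.fullyFaithfulLOfIsIsoUnit
  have fR : (ranFunctor (yonedaFp V A)).FullyFaithful :=
    Adjunction.Triple.fullyFaithfulEquiv ⟨aL, aR⟩ fL
  have := fL.full
  have := fL.faithful
  have := fR.full
  have := fR.faithful
  have := aL.rightAdjoint_preservesLimits
  have := aR.leftAdjoint_preservesColimits
  let R : Recollement (torsionLeft hP aL aR) (vanishing V A).ι (torsionRight hP aL aR)
      tensorFunctor (restrictionToA V A) (ranFunctor (yonedaFp V A)) :=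
    { adjIL := torsionLeftAdjunction hP aL aR
      adjIR := torsionRightAdjunction hP aL aR
      adjRL := aL
      adjRR := aR
      full_i := inferInstance
      faithful_i := inferInstance
      full_rL := fL.full
      faithful_rL := fL.faithful
      full_rR := fR.full
      faithful_rR := fR.faithful
      essImage_iff := essImage_ι_iff hP }
  have ht := isTorsionFunctor_torsionRight hP aL aR
  have hD := closedObjects_iff (adj := R.adjIR) (fun X => (ht X).1) hP aR
  exact ⟨⟨⟨isSerreClass_of_exact hP, fun J _ _ =>
    have := aR.leftAdjoint_preservesColimits
    isClosedUnderColimits_of_preserves hP J⟩,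
    vanishing_copower⟩, _, _, _, R, isEnrichedRan_counit (yonedaFp V A), ht,
    restrictionToA V A ⋙ liftRight aR hD, reflectionAdjunction aR hD,
    isEquivalence_reflection aR hD aL⟩
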